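/- Consider the equations $$u_t-u_{xx}+f^1(u)\,u_y=f^2(u),\qquad u=u(t,x,y),\qquad (*)$$ where $f^1,f^2$ are smooth real functions on a nonempty open interval $J$ and $f^1$ is not constant on $J$. Let $D\subseteq\mathbb R^3$ be a nonempty connected open set of points $(t,x,y)$. The maximal Lie invariance algebra $A^{\max}$ of $(*)$ consists of all smooth vector fields $\xi^0\partial_t+\xi^1\partial_x+\xi^2\partial_y+\eta\,\partial_u$ on $D\times J$ (coefficients depending on $t,x,y,u$) which satisfy Lie's infinitesimal criterion: the second prolongation of the field, applied to $u_t-u_{xx}+f^1(u)u_y-f^2(u)$, vanishes at all second-order jets satisfying $(*)$. It always contains $A^{\ker}=\langle\partial_t,\partial_x,\partial_y\rangle$. The group $G^{\rm equiv}$ consists of the transformations $$\bar t=a_1^2t+a_2,\quad \bar x=a_1x+a_3,\quad \bar y=a_4y+a_5t+a_6,\quad \bar u=a_7u+a_8,\qquad a_i\in\mathbb R,\ a_1a_4a_7\neq0,$$ which take $(*)$ to the equation of the same form with $F^1(\bar u)=\frac{a_4}{a_1^2}f^1(u)+\frac{a_5}{a_1^2}$, $F^2(\bar u)=\frac{a_7}{a_1^2}f^2(u)$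 on the interval $a_7J+a_8$. **Theorem.** (a) If $A^{\max}\supsetneq A^{\ker}$, then $(*)$ is reduced by a transformation from $G^{\rm equiv}$ to one of the 22 equations below. (b) For each of the equations below, on every nonempty open interval of values of $u$ contained in the natural domain of the functions in its row, $\partial_t,\partial_x,\partial_y$ and the listed generators form a basis of $A^{\max}$. Here $\varepsilon,\varepsilon_1,\varepsilon_2\in\{1,-1\}$, $m,n\in\mathbb R$; $\ln u$ requires $u>0$; a power $u^m$ is considered for $u>0$, also for $u<0$ if $m\in\mathbb Z$, and also at $u=0$ if $m\in\{0,1,2,\dots\}$. In rows 7–10 $u>0$. In row 1, $f^1$ is any nonconstant smooth function for which the equation $(*)$ with $f^2=0$ cannot be taken by $G^{\rm equiv}$ to an equation of row 6, 10, 14 or 22. 1. $f^1$ (as just described), $f^2=0$: $\ t\partial_t+\frac12x\partial_x+y\partial_y$. 2. $e^u$, $\varepsilon e^{mu}$, $m\ne0,1$: $\ t\partial_t+\frac12x\partial_x+\frac{m-1}{m}y\partial_y-\frac1m\partial_u$. 3. $e^u$, $\varepsilon_1e^u+\varepsilon_2$: $\ e^{\varepsilon_1y}(\partial_y+\varepsilon_1\partial_u)$.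 4. $e^u$, $\varepsilon$: $\ y\partial_y+\partial_u$. 5. $e^u$, $\varepsilon e^u$: $\ t\partial_t+\frac12x\partial_x-\partial_u$, $\ e^{\varepsilon y}(\partial_y+\varepsilon\partial_u)$. 6. $e^u$, $0$: $\ t\partial_t+\frac12x\partial_x+y\partial_y$, $\ y\partial_y+\partial_u$. 7. $\ln u$, $\varepsilon u^m$, $m\ne1$: $\ t\partial_t+\frac12x\partial_x+\left(y-\frac{t}{m-1}\right)\partial_y-\frac{u}{m-1}\partial_u$. 8. $\ln u$, $\varepsilon u\ln u$: $\ e^{\varepsilon t}(\partial_y+\varepsilon u\partial_u)$. 9. $\ln u$, $\varepsilon u$: $\ t\partial_t+\frac12x\partial_x+\left(y+\frac{\varepsilon}{2}t^2\right)\partial_y+\varepsilon tu\partial_u$, $\ t\partial_y+u\partial_u$. 10. $\ln u$, $0$: $\ t\partial_t+\frac12x\partial_x+y\partial_y$, $\ t\partial_y+u\partial_u$. 11. $u^m$, $\varepsilon u^n$, $m\ne0,1$, $n\ne m+1$: $\ (n-1)t\partial_t+\frac12(n-1)x\partial_x+(n-m-1)y\partial_y-u\partial_u$. 12. $u^m$,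 $\varepsilon_1u^{m+1}+\varepsilon_2u$, $m\ne0,1$: $\ e^{\varepsilon_1my}(\partial_y+\varepsilon_1u\partial_u)$. 13. $u^m$, $\varepsilon u^{m+1}$, $m\ne0,1$: $\ t\partial_t+\frac12x\partial_x-\frac1mu\partial_u$, $\ e^{\varepsilon my}(\partial_y+\varepsilon u\partial_u)$. 14. $u^m$, $0$, $m\ne0,1$: $\ t\partial_t+\frac12x\partial_x+y\partial_y$, $\ y\partial_y+\frac1mu\partial_u$. 15. $u$, $\varepsilon e^u$: $\ t\partial_t+\frac12x\partial_x+(y-t)\partial_y-\partial_u$. 16. $u$, $\varepsilon u^m$, $m\ne0,1,2$: $\ t\partial_t+\frac12x\partial_x+\frac{m-2}{m-1}y\partial_y-\frac{u}{m-1}\partial_u$. 17. $u$, $u^2+1$: $\ e^y(\sin t\,\partial_y+(\cos t+u\sin t)\partial_u)$, $\ e^y(\cos t\,\partial_y-(\sin t-u\cos t)\partial_u)$. 18. $u$, $u^2-1$: $\ e^y(\sinh t\,\partial_y+(\cosh t+u\sinh t)\partial_u)$, $\ e^y(\cosh t\,\partial_y+(\sinh t+u\cosh t)\partial_u)$. 19.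 $u$, $\varepsilon u$: $\ y\partial_y+u\partial_u$, $\ e^{\varepsilon t}(\partial_y+\varepsilon\partial_u)$. 20. $u$, $u^2$: $\ t\partial_t+\frac12x\partial_x-u\partial_u$, $\ e^y(\partial_y+u\partial_u)$, $\ e^y(t\partial_y+(tu+1)\partial_u)$. 21. $u$, $\varepsilon$: $\ t\partial_t+\frac12x\partial_x+\varepsilon t^2\partial_y+(2\varepsilon t-u)\partial_u$, $\ t\partial_y+\partial_u$, $\ \left(y-\frac12\varepsilon t^2\right)\partial_y+(u-\varepsilon t)\partial_u$. 22. $u$, $0$: $\ t\partial_t+\frac12x\partial_x+y\partial_y$, $\ t\partial_y+\partial_u$, $\ y\partial_y+u\partial_u$. -/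

import Mathlib

open scoped ContDiff

noncomputable section

namespace Kolmogorov

/-- Points `(t, x, y, u)`; the coordinates `0, 1, 2, 3` are `t, x, y, u`. -/
abbrev Pt := Fin 4 → ℝ

/-- Vector fields `ξ⁰ ∂_t + ξ¹ ∂_x + ξ² ∂_y + η ∂_u`; the components `0, 1, 2, 3` are
`ξ⁰, ξ¹, ξ², η`. -/
abbrev VField := Pt → Fin 4 → ℝ

/-- The vector field with components given as functions of `t, x, y, u`. -/
def vf (g : ℝ → ℝ → ℝ → ℝ → Fin 4 → ℝ) : VField := fun p => g (p 0) (p 1) (p 2) (p 3)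

/-- Partial derivative of a function of `(t, x, y, u)`. -/
def pd (i : Fin 4) (F : Pt → ℝ) (p : Pt) : ℝ := fderiv ℝ F p (Pi.single i 1)

/-- Second order jets of functions `u(t, x, y)`: the base point `(t, x, y)`, the value `u`,
the first derivatives `d1 i = u_i` and the second derivatives `d2 i k = u_{ik}`, where the
indices `0, 1, 2` stand for `t, x, y`. -/
structure Jet where
  base : Fin 3 → ℝ
  u : ℝ
  d1 : Fin 3 → ℝ
  d2 : Fin 3 → Fin 3 → ℝ
  d2_symm : ∀ i k, d2 i k = d2 k i

/-- The point `(t, x, y, u)` under a jet. -/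
def Jet.pt (j : Jet) : Pt := ![j.base 0, j.base 1, j.base 2, j.u]

/-- Total derivative `D_i F` of a function `F(t, x, y, u)`. -/
def totalD (i : Fin 3) (F : Pt → ℝ) (j : Jet) : ℝ :=
  pd i.castSucc F j.pt + j.d1 i * pd 3 F j.pt

/-- Second total derivative `D_i D_k F` of a function `F(t, x, y, u)`. -/
def totalD2 (i k : Fin 3) (F : Pt → ℝ) (j : Jet) : ℝ :=
  pd i.castSucc (pd k.castSucc F) j.pt
    + j.d1 i * pd 3 (pd k.castSucc F) j.pt
    + j.d1 k * pd i.castSucc (pd 3 F) j.pt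
    + j.d1 i * j.d1 k * pd 3 (pd 3 F) j.pt
    + j.d2 i k * pd 3 F j.pt

/-- Coefficient `η^i = D_i η - ∑_l u_l D_i ξ^l` of `∂/∂u_i` in the prolonged vector field. -/
def prolong1 (V : VField) (i : Fin 3) (j : Jet) : ℝ :=
  totalD i (fun p => V p 3) j - ∑ l : Fin 3, j.d1 l * totalD i (fun p => V p l.castSucc) j

/-- Coefficient `η^{ik} = D_k η^i - ∑_l u_{il} D_k ξ^l` of `∂/∂u_{ik}` in the prolonged vector
field, expanded. -/
def prolong2 (V : VField) (i k : Fin 3) (j : Jet) : ℝ :=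
  totalD2 i k (fun p => V p 3) j
    - ∑ l : Fin 3, (j.d1 l * totalD2 i k (fun p => V p l.castSucc) j
        + j.d2 i l * totalD k (fun p => V p l.castSucc) j
        + j.d2 k l * totalD i (fun p => V p l.castSucc) j)

/-- The equation is `delta f₁ f₂ = 0`, that is `u_t - u_xx + f₁(u) u_y - f₂(u) = 0`. -/
def delta (f₁ f₂ : ℝ → ℝ) (j : Jet) : ℝ :=
  j.d1 0 - j.d2 1 1 + f₁ j.u * j.d1 2 - f₂ j.u

/-- The second prolongation of `V` applied to the function `delta f₁ f₂` on the jet space. -/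
def prolongDelta (f₁ f₂ : ℝ → ℝ) (V : VField) (j : Jet) : ℝ :=
  prolong1 V 0 j - prolong2 V 1 1 j + f₁ j.u * prolong1 V 2 j
    + V j.pt 3 * (deriv f₁ j.u * j.d1 2 - deriv f₂ j.u)

/-- The domain `D × J` in the space of `(t, x, y, u)`. -/
def dom (D : Set (Fin 3 → ℝ)) (J : Set ℝ) : Set Pt :=
  {p | ![p 0, p 1, p 2] ∈ D ∧ p 3 ∈ J}

/-- Lie's infinitesimal criterion: the smooth vector field `V` on `D × J` is a Lie symmetry of
`u_t - u_xx + f₁(u) u_y = f₂(u)` if its second prolongation annihilates the equation at every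
jet (over `D × J`) that satisfies the equation. -/
def IsLieSymmetry (D : Set (Fin 3 → ℝ)) (J : Set ℝ) (f₁ f₂ : ℝ → ℝ) (V : VField) : Prop :=
  ContDiffOn ℝ ∞ V (dom D J) ∧
    ∀ j : Jet, j.base ∈ D → j.u ∈ J → delta f₁ f₂ j = 0 → prolongDelta f₁ f₂ V j = 0

/-- The maximal Lie invariance algebra of the equation: all its Lie symmetries, as vector
fields on `D × J`. -/
def maxAlgebra (D : Set (Fin 3 → ℝ)) (J : Set ℝ) (f₁ f₂ : ℝ → ℝ) :
    Set (dom D J → Fin 4 → ℝ) :=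
  {W | ∃ V : VField, IsLieSymmetry D J f₁ f₂ V ∧ W = (dom D J).domRestrict V}

/-- The vector fields `∂_t, ∂_x, ∂_y`. -/
def kerFields : List VField :=
  [vf fun _ _ _ _ => ![1, 0, 0, 0], vf fun _ _ _ _ => ![0, 1, 0, 0],
    vf fun _ _ _ _ => ![0, 0, 1, 0]]

/-- A finite list of vector fields, restricted to `D × J`. -/
def family (D : Set (Fin 3 → ℝ)) (J : Set ℝ) (L : List VField) :
    Fin L.length → (dom D J → Fin 4 → ℝ) :=
  fun i => (dom D J).domRestrict (L.get i)

/-- The linear span on `D × J` of a finite list of vector fields. -/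
def spanOn (D : Set (Fin 3 → ℝ)) (J : Set ℝ) (L : List VField) :
    Submodule ℝ (dom D J → Fin 4 → ℝ) :=
  Submodule.span ℝ (Set.range (family D J L))

/-- The transformations `t̄ = a₁² t + a₂`, `x̄ = a₁ x + a₃`, `ȳ = a₄ y + a₅ t + a₆`,
`ū = a₇ u + a₈` with `a₁ a₄ a₇ ≠ 0`. -/
structure EquivTransf where
  (a₁ a₂ a₃ a₄ a₅ a₆ a₇ a₈ : ℝ)
  ne_zero : a₁ * a₄ * a₇ ≠ 0

/-- The transformation as a map of the space of `(t, x, y, u)`. -/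
def EquivTransf.toFun (T : EquivTransf) (p : Pt) : Pt :=
  ![T.a₁ ^ 2 * p 0 + T.a₂, T.a₁ * p 1 + T.a₃, T.a₄ * p 2 + T.a₅ * p 0 + T.a₆,
    T.a₇ * p 3 + T.a₈]

/-- `T` takes the equation with arbitrary elements `f₁, f₂` on the interval `J` to the one with
`F₁(ū) = (a₄ f₁(u) + a₅) / a₁²`, `F₂(ū) = a₇ f₂(u) / a₁²` on the interval `J'` of all values `ū`,
where `ū = a₇ u + a₈` is the last coordinate of the transformed point. -/
def EquivTransf.Reduces (T : EquivTransf) (J : Set ℝ) (f₁ f₂ : ℝ → ℝ)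
    (J' : Set ℝ) (F₁ F₂ : ℝ → ℝ) : Prop :=
  J' = (fun p => T.toFun p 3) '' {p : Pt | p 3 ∈ J} ∧
    ∀ p : Pt, p 3 ∈ J →
      F₁ (T.toFun p 3) = T.a₄ / T.a₁ ^ 2 * f₁ (p 3) + T.a₅ / T.a₁ ^ 2 ∧
      F₂ (T.toFun p 3) = T.a₇ / T.a₁ ^ 2 * f₂ (p 3)

/-- `f` is not constant on `J`. -/
def NonconstOn (f : ℝ → ℝ) (J : Set ℝ) : Prop := ∃ u ∈ J, ∃ v ∈ J, f u ≠ f v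

/-- `J` lies in the natural domain of the real power `u ^ m`: positive `u` for every real `m`,
nonzero `u` for integers `m`, and all `u` for `m = 0, 1, 2, …`. -/
def PowDomain (m : ℝ) (J : Set ℝ) : Prop :=
  ∀ u ∈ J, 0 < u ∨ (u ≠ 0 ∧ ∃ k : ℤ, m = k) ∨ ∃ k : ℕ, m = k

/-- `e^u`, `ln u`, or `u^m` with `m ≠ 0`, on an interval in its domain. -/
def IsSpecial (J : Set ℝ) (f : ℝ → ℝ) : Prop :=
  f = Real.exp ∨ (f = Real.log ∧ J ⊆ Set.Ioi 0) ∨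
    ∃ m : ℝ, m ≠ 0 ∧ PowDomain m J ∧ f = fun u => u ^ m

/-- `ε = ±1`. -/
def IsSign (ε : ℝ) : Prop := ε = 1 ∨ ε = -1

/-- The table: `TableRow J n f₁ f₂ gens` says that row `n` contains the equation
`u_t - u_xx + f₁(u) u_y = f₂(u)`, with `u` in the interval `J`, and lists the generators `gens`.
In the first row `f₁` is a nonconstant smooth function that is not one of the functions with
`f₂ = 0` in the later rows, up to the equivalence transformations. -/
inductive TableRow (J : Set ℝ) : ℕ → (ℝ → ℝ) → (ℝ → ℝ) → List VField → Prop
  | row1 (f₁ : ℝ → ℝ) (hs : ContDiffOn ℝ ∞ f₁ J) (hc : NonconstOn f₁ J)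
      (hgen : ¬ ∃ (T : EquivTransf) (J' : Set ℝ) (F₁ : ℝ → ℝ),
        IsSpecial J' F₁ ∧ T.Reduces J f₁ (fun _ => 0) J' F₁ (fun _ => 0)) :
      TableRow J 1 f₁ (fun _ => 0) [vf fun t x y _ => ![t, x / 2, y, 0]]
  | row2 (ε m : ℝ) (hε : IsSign ε) (h0 : m ≠ 0) (h1 : m ≠ 1) :
      TableRow J 2 Real.exp (fun u => ε * Real.exp (m * u))
        [vf fun t x y _ => ![t, x / 2, (m - 1) / m * y, -(1 / m)]]
  | row3 (ε₁ ε₂ : ℝ) (hε₁ : IsSign ε₁) (hε₂ : IsSign ε₂) :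
      TableRow J 3 Real.exp (fun u => ε₁ * Real.exp u + ε₂)
        [vf fun _ _ y _ => ![0, 0, Real.exp (ε₁ * y), Real.exp (ε₁ * y) * ε₁]]
  | row4 (ε : ℝ) (hε : IsSign ε) :
      TableRow J 4 Real.exp (fun _ => ε) [vf fun _ _ y _ => ![0, 0, y, 1]]
  | row5 (ε : ℝ) (hε : IsSign ε) :
      TableRow J 5 Real.exp (fun u => ε * Real.exp u)
        [vf fun t x _ _ => ![t, x / 2, 0, -1],
          vf fun _ _ y _ => ![0, 0, Real.exp (ε * y), Real.exp (ε * y) * ε]]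
  | row6 :
      TableRow J 6 Real.exp (fun _ => 0)
        [vf fun t x y _ => ![t, x / 2, y, 0], vf fun _ _ y _ => ![0, 0, y, 1]]
  | row7 (ε m : ℝ) (hε : IsSign ε) (h1 : m ≠ 1) (hJ : J ⊆ Set.Ioi 0) :
      TableRow J 7 Real.log (fun u => ε * u ^ m)
        [vf fun t x y u => ![t, x / 2, y - t / (m - 1), -(u / (m - 1))]]
  | row8 (ε : ℝ) (hε : IsSign ε) (hJ : J ⊆ Set.Ioi 0) :
      TableRow J 8 Real.log (fun u => ε * (u * Real.log u))
        [vf fun t _ _ u => ![0, 0, Real.exp (ε * t), Real.exp (ε * t) * (ε * u)]]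
  | row9 (ε : ℝ) (hε : IsSign ε) (hJ : J ⊆ Set.Ioi 0) :
      TableRow J 9 Real.log (fun u => ε * u)
        [vf fun t x y u => ![t, x / 2, y + ε / 2 * t ^ 2, ε * t * u],
          vf fun t _ _ u => ![0, 0, t, u]]
  | row10 (hJ : J ⊆ Set.Ioi 0) :
      TableRow J 10 Real.log (fun _ => 0)
        [vf fun t x y _ => ![t, x / 2, y, 0], vf fun t _ _ u => ![0, 0, t, u]]
  | row11 (ε m n : ℝ) (hε : IsSign ε) (h0 : m ≠ 0) (h1 : m ≠ 1) (hn : n ≠ m + 1)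
      (hJm : PowDomain m J) (hJn : PowDomain n J) :
      TableRow J 11 (fun u => u ^ m) (fun u => ε * u ^ n)
        [vf fun t x y u => ![(n - 1) * t, (n - 1) * x / 2, (n - m - 1) * y, -u]]
  | row12 (ε₁ ε₂ m : ℝ) (hε₁ : IsSign ε₁) (hε₂ : IsSign ε₂) (h0 : m ≠ 0) (h1 : m ≠ 1)
      (hJm : PowDomain m J) :
      TableRow J 12 (fun u => u ^ m) (fun u => ε₁ * u ^ (m + 1) + ε₂ * u)
        [vf fun _ _ y u =>
          ![0, 0, Real.exp (ε₁ * m * y), Real.exp (ε₁ * m * y) * (ε₁ * u)]]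
  | row13 (ε m : ℝ) (hε : IsSign ε) (h0 : m ≠ 0) (h1 : m ≠ 1) (hJm : PowDomain m J) :
      TableRow J 13 (fun u => u ^ m) (fun u => ε * u ^ (m + 1))
        [vf fun t x _ u => ![t, x / 2, 0, -(1 / m * u)],
          vf fun _ _ y u =>
            ![0, 0, Real.exp (ε * m * y), Real.exp (ε * m * y) * (ε * u)]]
  | row14 (m : ℝ) (h0 : m ≠ 0) (h1 : m ≠ 1) (hJm : PowDomain m J) :
      TableRow J 14 (fun u => u ^ m) (fun _ => 0)
        [vf fun t x y _ => ![t, x / 2, y, 0], vf fun _ _ y u => ![0, 0, y, 1 / m * u]]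
  | row15 (ε : ℝ) (hε : IsSign ε) :
      TableRow J 15 (fun u => u) (fun u => ε * Real.exp u)
        [vf fun t x y _ => ![t, x / 2, y - t, -1]]
  | row16 (ε m : ℝ) (hε : IsSign ε) (h0 : m ≠ 0) (h1 : m ≠ 1) (h2 : m ≠ 2)
      (hJm : PowDomain m J) :
      TableRow J 16 (fun u => u) (fun u => ε * u ^ m)
        [vf fun t x y u => ![t, x / 2, (m - 2) / (m - 1) * y, -(u / (m - 1))]]
  | row17 :
      TableRow J 17 (fun u => u) (fun u => u ^ 2 + 1)
        [vf fun t _ y u =>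
            ![0, 0, Real.exp y * Real.sin t, Real.exp y * (Real.cos t + u * Real.sin t)],
          vf fun t _ y u =>
            ![0, 0, Real.exp y * Real.cos t, -(Real.exp y * (Real.sin t - u * Real.cos t))]]
  | row18 :
      TableRow J 18 (fun u => u) (fun u => u ^ 2 - 1)
        [vf fun t _ y u =>
            ![0, 0, Real.exp y * Real.sinh t, Real.exp y * (Real.cosh t + u * Real.sinh t)],
          vf fun t _ y u =>
            ![0, 0, Real.exp y * Real.cosh t, Real.exp y * (Real.sinh t + u * Real.cosh t)]]
  | row19 (ε : ℝ) (hε : IsSign ε) :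
      TableRow J 19 (fun u => u) (fun u => ε * u)
        [vf fun _ _ y u => ![0, 0, y, u],
          vf fun t _ _ _ => ![0, 0, Real.exp (ε * t), Real.exp (ε * t) * ε]]
  | row20 :
      TableRow J 20 (fun u => u) (fun u => u ^ 2)
        [vf fun t x _ u => ![t, x / 2, 0, -u],
          vf fun _ _ y u => ![0, 0, Real.exp y, Real.exp y * u],
          vf fun t _ y u => ![0, 0, Real.exp y * t, Real.exp y * (t * u + 1)]]
  | row21 (ε : ℝ) (hε : IsSign ε) :
      TableRow J 21 (fun u => u) (fun _ => ε)
        [vf fun t x _ u => ![t, x / 2, ε * t ^ 2, 2 * ε * t - u],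
          vf fun t _ _ _ => ![0, 0, t, 1],
          vf fun t _ y u => ![0, 0, y - 1 / 2 * ε * t ^ 2, u - ε * t]]
  | row22 :
      TableRow J 22 (fun u => u) (fun _ => 0)
        [vf fun t x y _ => ![t, x / 2, y, 0],
          vf fun t _ _ _ => ![0, 0, t, 1],
          vf fun _ _ y u => ![0, 0, y, u]]

end Kolmogorov

end

noncomputable section

namespace Kolmogorov

/-! Write `f = f¹`, `g = f²`. Once `u_xx` is eliminated by means of the equation, Lie's criterion is
polynomial in the free jet variables. Comparing coefficients, and using that `f` is not constant,
leaves only the fields `(l t + c₀) ∂_t + (l x / 2 + c₁) ∂_x + χ ∂_y + (η₁ u + η₀) ∂_u`, where `l` is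
a constant, `χ, η₁, η₀` have zero `x`- and `u`-derivatives, and two classifying equations hold for
`η = η₁ u + η₀`: `η f' = χ_t + (χ_y - l) f` and `η_t + f η_y + (η₁ - l) g = η g'`. Conversely every
such field is a symmetry (`IsLieSymmetry.exists_reducedSymmetry`, `ReducedSymmetry.isLieSymmetry`).

Part (a). If `g = 0`, there is nothing to prove, since the first row is by definition the complement
of the other rows without source. If `g ≠ 0`, a symmetry outside the kernel has `η ≠ 0` at some
point. The first equation, frozen there, is an ordinary differential equation `(a u + b) f' = c + d
f` with `(a, b) ≠ 0`, and its nonconstant smooth solutions are, up to affine changes of `u` and `f`,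
`exp`, `log` and powers (`exists_normalForm`). For each of these the first equation ties `η` to the
gradient of `χ`. The second one, frozen at a point or first differentiated along the base, is then
an ordinary differential equation for `g` (`DetSystem.tabled_exp`, `DetSystem.tabled_log`,
`DetSystem.tabled_rpow`, `DetSystem.tabled_id`). The remaining freedom in the equivalence group
normalises the constants of integration. Replacing `f` by `α f + β` would require new coordinates
`(t, y)`; `DetSystem` avoids transforming `D` by letting two constant directions play the roles of
`∂_t` and `∂_y`.

Part (b). In each row, linear independence of the functions of `u` in the classifying equations
turns them into an overdetermined linear system for `χ, η₁, η₀`, which is integrated explicitly;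
`basis_of_solutions` translates the result into the statement about the algebra. For the first row,
a nonzero `η` at any point would produce a normal form of `f`, which that row excludes. -/

/-- The derivative of `F` in the constant direction `v`. -/
def dirDeriv (v : Pt) (F : Pt → ℝ) (p : Pt) : ℝ := fderiv ℝ F p v

/-! ### Partial and directional derivatives of smooth functions on an open set of `ℝ⁴`. -/

section DirDeriv

variable {U : Set Pt} {F G : Pt → ℝ} {p : Pt} {v w : Pt}

theorem differentiableAt_of_smoothOn (hU : IsOpen U) (hF : ContDiffOn ℝ ∞ F U) (hp : p ∈ U) :
    DifferentiableAt ℝ F p :=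
  (hF.contDiffAt (hU.mem_nhds hp)).differentiableAt (by simp)

theorem smoothOn_dirDeriv (hU : IsOpen U) (hF : ContDiffOn ℝ ∞ F U) (v : Pt) :
    ContDiffOn ℝ ∞ (dirDeriv v F) U :=
  (hF.fderiv_of_isOpen (m := ∞) hU (by simp)).clm_apply contDiffOn_const

theorem smoothOn_pd (hU : IsOpen U) (hF : ContDiffOn ℝ ∞ F U) (i : Fin 4) :
    ContDiffOn ℝ ∞ (pd i F) U :=
  smoothOn_dirDeriv hU hF _

theorem dirDeriv_comm (hU : IsOpen U) (hF : ContDiffOn ℝ ∞ F U) (hp : p ∈ U) (v w : Pt) :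
    dirDeriv v (dirDeriv w F) p = dirDeriv w (dirDeriv v F) p := by
  have hc : ContDiffAt ℝ ∞ F p := hF.contDiffAt (hU.mem_nhds hp)
  have hd : DifferentiableAt ℝ (fderiv ℝ F) p :=
    ((hF.fderiv_of_isOpen (m := ∞) hU (by simp)).contDiffAt (hU.mem_nhds hp)).differentiableAt
      (by simp)
  have key : ∀ a b : Pt, dirDeriv a (dirDeriv b F) p = fderiv ℝ (fderiv ℝ F) p a b := by
    intro a b
    have : dirDeriv b F = fun q => (fderiv ℝ F q) b := rfl
    rw [this, dirDeriv, fderiv_clm_apply hd (differentiableAt_const b)]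
    simp
  rw [key, key]
  exact (hc.isSymmSndFDerivAt (by simp; exact WithTop.coe_le_coe.2 le_top)).eq v w

theorem pd_comm (hU : IsOpen U) (hF : ContDiffOn ℝ ∞ F U) (hp : p ∈ U) (i k : Fin 4) :
    pd i (pd k F) p = pd k (pd i F) p :=
  dirDeriv_comm hU hF hp _ _

theorem dirDeriv_congr (hU : IsOpen U) (h : ∀ q ∈ U, F q = G q) (hp : p ∈ U) :
    dirDeriv v F p = dirDeriv v G p := by
  have : F =ᶠ[nhds p] G := Filter.eventuallyEq_of_mem (hU.mem_nhds hp) h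
  rw [dirDeriv, dirDeriv, this.fderiv_eq]

theorem pd_congr (hU : IsOpen U) (h : ∀ q ∈ U, F q = G q) (hp : p ∈ U) (i : Fin 4) :
    pd i F p = pd i G p :=
  dirDeriv_congr hU h hp

theorem dirDeriv_const (c : ℝ) : dirDeriv v (fun _ => c) p = 0 := by
  simp [dirDeriv]

theorem dirDeriv_eq_zero (hU : IsOpen U) {c : ℝ} (h : ∀ q ∈ U, F q = c) (hp : p ∈ U) :
    dirDeriv v F p = 0 := by
  rw [dirDeriv_congr hU h hp, dirDeriv_const]

theorem pd_eq_zero (hU : IsOpen U) {c : ℝ} (h : ∀ q ∈ U, F q = c) (hp : p ∈ U) (i : Fin 4) :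
    pd i F p = 0 :=
  dirDeriv_eq_zero hU h hp

theorem dirDeriv_add (hF : DifferentiableAt ℝ F p) (hG : DifferentiableAt ℝ G p) :
    dirDeriv v (fun q => F q + G q) p = dirDeriv v F p + dirDeriv v G p := by
  simp only [dirDeriv]
  rw [fderiv_fun_add hF hG]; rfl

theorem dirDeriv_sub (hF : DifferentiableAt ℝ F p) (hG : DifferentiableAt ℝ G p) :
    dirDeriv v (fun q => F q - G q) p = dirDeriv v F p - dirDeriv v G p := by
  simp only [dirDeriv]
  rw [fderiv_fun_sub hF hG]; rfl

theorem dirDeriv_mul (hF : DifferentiableAt ℝ F p) (hG : DifferentiableAt ℝ G p) :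
    dirDeriv v (fun q => F q * G q) p = F p * dirDeriv v G p + G p * dirDeriv v F p := by
  simp only [dirDeriv]
  rw [fderiv_fun_mul hF hG]; rfl

theorem dirDeriv_const_mul (c : ℝ) (hF : DifferentiableAt ℝ F p) :
    dirDeriv v (fun q => c * F q) p = c * dirDeriv v F p := by
  rw [dirDeriv_mul (differentiableAt_const c) hF, dirDeriv_const]; ring

theorem pd_add (i : Fin 4) (hF : DifferentiableAt ℝ F p) (hG : DifferentiableAt ℝ G p) :
    pd i (fun q => F q + G q) p = pd i F p + pd i G p :=
  dirDeriv_add hF hG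

theorem pd_sub (i : Fin 4) (hF : DifferentiableAt ℝ F p) (hG : DifferentiableAt ℝ G p) :
    pd i (fun q => F q - G q) p = pd i F p - pd i G p :=
  dirDeriv_sub hF hG

theorem pd_mul (i : Fin 4) (hF : DifferentiableAt ℝ F p) (hG : DifferentiableAt ℝ G p) :
    pd i (fun q => F q * G q) p = F p * pd i G p + G p * pd i F p :=
  dirDeriv_mul hF hG

theorem pd_const_mul (i : Fin 4) (c : ℝ) (hF : DifferentiableAt ℝ F p) :
    pd i (fun q => c * F q) p = c * pd i F p :=
  dirDeriv_const_mul c hF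

theorem dirDeriv_dir_add : dirDeriv (v + w) F p = dirDeriv v F p + dirDeriv w F p := by
  simp [dirDeriv]

theorem dirDeriv_dir_smul (c : ℝ) : dirDeriv (c • v) F p = c * dirDeriv v F p := by
  simp [dirDeriv]

theorem pd_of_hasDerivAt (hF : DifferentiableAt ℝ F p) {i : Fin 4} {d : ℝ}
    (h : HasDerivAt (fun s => F (Function.update p i s)) d (p i)) : pd i F p = d := by
  have h1 : HasDerivAt (Function.update p i) (Pi.single i (1 : ℝ)) (p i) :=
    hasDerivAt_update p i (p i)
  have h2 : HasFDerivAt F (fderiv ℝ F p) (Function.update p i (p i)) := by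
    rw [Function.update_eq_self]; exact hF.hasFDerivAt
  exact (h2.comp_hasDerivAt (p i) h1).unique h

theorem differentiableAt_coord (k : Fin 4) : DifferentiableAt ℝ (fun q : Pt => q k) p :=
  differentiableAt_apply k p

theorem pd_coord (i k : Fin 4) : pd i (fun q : Pt => q k) p = if i = k then 1 else 0 := by
  have h : (fun q : Pt => q k) = (ContinuousLinearMap.proj k : Pt →L[ℝ] ℝ) := rfl
  rw [pd, h, ContinuousLinearMap.fderiv]
  simp [Pi.single_apply, eq_comm]

theorem pd_comp_coord {h : ℝ → ℝ} {d : ℝ} (i k : Fin 4) (hh : HasDerivAt h d (p k)) :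
    pd i (fun q : Pt => h (q k)) p = if i = k then d else 0 := by
  have h1 : HasFDerivAt (fun q : Pt => q k) (ContinuousLinearMap.proj k : Pt →L[ℝ] ℝ) p :=
    (ContinuousLinearMap.proj k : Pt →L[ℝ] ℝ).hasFDerivAt
  have h2 := hh.comp_hasFDerivAt p h1
  have h3 : (h ∘ fun q : Pt => q k) = fun q : Pt => h (q k) := rfl
  rw [h3] at h2
  rw [pd, h2.fderiv]
  simp [Pi.single_apply, eq_comm]

theorem exists_const_of_pd_eq_zero (hU : IsOpen U) (hU' : IsConnected U)
    (hF : DifferentiableOn ℝ F U) (h : ∀ i, ∀ q ∈ U, pd i F q = 0) :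
    ∃ c, ∀ q ∈ U, F q = c := by
  obtain ⟨q₀, hq₀⟩ := hU'.nonempty
  refine ⟨F q₀, fun q hq => ?_⟩
  refine hU.is_const_of_fderiv_eq_zero hU'.isPreconnected hF (fun r hr => ?_) hq hq₀
  ext w
  have hw : w = ∑ i, w i • (Pi.single i (1 : ℝ) : Pt) := by
    rw [← pi_eq_sum_univ' w]
  rw [hw, map_sum]
  simp only [map_smul]
  have : ∀ i, (fderiv ℝ F r) (Pi.single i 1) = 0 := fun i => h i r hr
  simp [this]

theorem exists_affine_of_pd (hU : IsOpen U) (hU' : IsConnected U) (hF : ContDiffOn ℝ ∞ F U)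
    (k : Fin 4) (c : ℝ) (h : ∀ i, ∀ q ∈ U, pd i F q = if i = k then c else 0) :
    ∃ d, ∀ q ∈ U, F q = c * q k + d := by
  obtain ⟨d, hd⟩ := exists_const_of_pd_eq_zero (F := fun q => F q - c * q k) hU hU'
    (fun q hq => ((differentiableAt_of_smoothOn hU hF hq).sub
      ((differentiableAt_coord k).const_mul c)).differentiableWithinAt)
    (fun i q hq => by
      rw [pd_sub i (differentiableAt_of_smoothOn hU hF hq)
        ((differentiableAt_coord k).const_mul c),
        pd_const_mul i c (differentiableAt_coord k), h i q hq, pd_coord]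
      split_ifs <;> ring)
  exact ⟨d, fun q hq => by linarith [hd q hq]⟩

/-- The quotient `F / E` has zero gradient on a connected open set, hence is constant. -/
theorem exists_mul_of_pd (hU : IsOpen U) (hU' : IsConnected U) (hF : ContDiffOn ℝ ∞ F U)
    {E e : ℝ → ℝ} (hE : ∀ s, HasDerivAt E (e s) s) (hE0 : ∀ s, E s ≠ 0) (k : Fin 4)
    (h : ∀ i, ∀ q ∈ U, pd i F q * E (q k) = if i = k then e (q k) * F q else 0) :
    ∃ d, ∀ q ∈ U, F q = d * E (q k) := by
  have hinv : ∀ s, HasDerivAt (fun r => (E r)⁻¹) (-e s / E s ^ 2) s := fun s =>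
    (hE s).fun_inv (hE0 s)
  have hdi : ∀ q : Pt, DifferentiableAt ℝ (fun r : Pt => (E (r k))⁻¹) q := fun q =>
    DifferentiableAt.comp (g := fun s => (E s)⁻¹) q (hinv (q k)).differentiableAt
      (differentiableAt_coord k)
  obtain ⟨d, hd⟩ := exists_const_of_pd_eq_zero (F := fun q => F q * (E (q k))⁻¹) hU hU'
    (fun q hq => ((differentiableAt_of_smoothOn hU hF hq).mul (hdi q)).differentiableWithinAt)
    (fun i q hq => by
      rw [pd_mul i (differentiableAt_of_smoothOn hU hF hq) (hdi q), pd_comp_coord i k (hinv (q k))]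
      have h1 := h i q hq
      have h2 := hE0 (q k)
      split_ifs at h1 ⊢
      · field_simp
        linarith
      · have : pd i F q = 0 := by simpa [h2] using h1
        rw [this]; ring)
  refine ⟨d, fun q hq => ?_⟩
  rw [← hd q hq, mul_assoc, inv_mul_cancel₀ (hE0 _), mul_one]

theorem exists_exp_of_pd (hU : IsOpen U) (hU' : IsConnected U) (hF : ContDiffOn ℝ ∞ F U)
    (k : Fin 4) (c : ℝ) (h : ∀ i, ∀ q ∈ U, pd i F q = if i = k then c * F q else 0) :
    ∃ d, ∀ q ∈ U, F q = d * Real.exp (c * q k) := by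
  refine exists_mul_of_pd (E := fun s => Real.exp (c * s)) (e := fun s => Real.exp (c * s) * c)
    hU hU' hF (fun s => ?_) (fun s => Real.exp_ne_zero _) k (fun i q hq => ?_)
  · simpa using ((hasDerivAt_id s).const_mul c).exp
  · rw [h i q hq]; split_ifs <;> ring

end DirDeriv

/-! ### The product domain `D × J` and its fibres in the direction of `u`. -/

section Domain

variable {D : Set (Fin 3 → ℝ)} {J : Set ℝ}

/-- Splitting `(t, x, y, u)` into `(t, x, y)` and `u`. -/
def basePt (b : Fin 3 → ℝ) (u : ℝ) : Pt := ![b 0, b 1, b 2, u]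

theorem basePt_mem {b : Fin 3 → ℝ} {u : ℝ} (hb : b ∈ D) (hu : u ∈ J) : basePt b u ∈ dom D J := by
  have : (![b 0, b 1, b 2] : Fin 3 → ℝ) = b := by ext i; fin_cases i <;> rfl
  simp [dom, basePt, this, hb, hu]

theorem continuous_basePt : Continuous fun q : (Fin 3 → ℝ) × ℝ => basePt q.1 q.2 := by
  refine continuous_pi fun i => ?_
  fin_cases i <;> simp [basePt] <;> fun_prop

theorem dom_eq_image : dom D J = (fun q : (Fin 3 → ℝ) × ℝ => basePt q.1 q.2) '' (D ×ˢ J) := by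
  ext p
  constructor
  · intro hp
    refine ⟨(![p 0, p 1, p 2], p 3), hp, ?_⟩
    ext i; fin_cases i <;> rfl
  · rintro ⟨⟨b, u⟩, ⟨hb, hu⟩, rfl⟩
    exact basePt_mem hb hu

theorem isOpen_dom (hD : IsOpen D) (hJ : IsOpen J) : IsOpen (dom D J) := by
  have h1 : Continuous fun p : Pt => (![p 0, p 1, p 2] : Fin 3 → ℝ) := by
    refine continuous_pi fun i => ?_
    fin_cases i <;> simp <;> fun_prop
  have h2 : Continuous fun p : Pt => p 3 := continuous_apply 3
  exact (hD.preimage h1).inter (hJ.preimage h2)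

theorem isConnected_dom (hD : IsConnected D) (hJ : IsConnected J) : IsConnected (dom D J) := by
  rw [dom_eq_image]
  exact (hD.prod hJ).image _ continuous_basePt.continuousOn

theorem update_mem_dom {p : Pt} (hp : p ∈ dom D J) {u : ℝ} (hu : u ∈ J) :
    Function.update p 3 u ∈ dom D J := by
  simpa [dom, Function.update] using And.intro hp.1 hu

/-- A function with vanishing `u`-derivative is constant along the fibres of the domain. -/
theorem eq_update_of_pd_eq_zero (hD : IsOpen D) (hJ : IsOpen J) (hJ' : IsConnected J)
    {F : Pt → ℝ} (hF : DifferentiableOn ℝ F (dom D J)) (h : ∀ q ∈ dom D J, pd 3 F q = 0) {p : Pt}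
    (hp : p ∈ dom D J) {u : ℝ} (hu : u ∈ J) : F (Function.update p 3 u) = F p := by
  have hder : ∀ s ∈ J, HasDerivAt (fun s => F (Function.update p 3 s)) 0 s := by
    intro s hs
    have hm := update_mem_dom hp hs
    have h1 : HasDerivAt (Function.update p 3) (Pi.single 3 (1 : ℝ)) s := hasDerivAt_update p 3 s
    have h2 := ((hF _ hm).differentiableAt ((isOpen_dom hD hJ).mem_nhds hm)).hasFDerivAt
    have h3 := h2.comp_hasDerivAt s h1
    have h4 := h _ hm
    rw [pd] at h4
    rw [h4] at h3
    exact h3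
  -- The fibre over a base point is all of the connected set `J`. Sections of `D` in the other
  -- directions need not be connected, so only the variable `u` can be eliminated in this way.
  have := hJ.is_const_of_deriv_eq_zero hJ'.isPreconnected
    (fun s hs => (hder s hs).differentiableAt.differentiableWithinAt)
    (fun s hs => (hder s hs).deriv) hu hp.2
  simpa using this

end Domain

/-! ### Jets, the written-out prolongation and the classifying equations. -/

/-- The jet over `p` with first derivatives `a, b, c` (in `t, x, y`), with `u_tx = r`, `u_xy = s`
and `u_xx = w`, the other second derivatives being zero. -/
def jetAt (p : Pt) (a b c r s w : ℝ) : Jet where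
  base := ![p 0, p 1, p 2]
  u := p 3
  d1 := ![a, b, c]
  d2 := ![![0, r, 0], ![r, w, s], ![0, s, 0]]
  d2_symm := by intro i k; fin_cases i <;> fin_cases k <;> rfl

theorem jetAt_pt (p : Pt) (a b c r s w : ℝ) : (jetAt p a b c r s w).pt = p := by
  ext i; fin_cases i <;> rfl

/-- The prolongation of the equation, written out in terms of the components
`T, X, Y, N` of the vector field. -/
theorem prolongDelta_eq (f g : ℝ → ℝ) (V : VField) (T X Y N : Pt → ℝ)
    (hT : T = fun p => V p 0) (hX : X = fun p => V p 1) (hY : Y = fun p => V p 2)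
    (hN : N = fun p => V p 3) (j : Jet) (p : Pt) (hp : j.pt = p) :
    prolongDelta f g V j =
      (pd 0 N p + j.d1 0 * pd 3 N p
        - (j.d1 0 * (pd 0 T p + j.d1 0 * pd 3 T p) + j.d1 1 * (pd 0 X p + j.d1 0 * pd 3 X p)
          + j.d1 2 * (pd 0 Y p + j.d1 0 * pd 3 Y p)))
      - ((pd 1 (pd 1 N) p + j.d1 1 * pd 3 (pd 1 N) p + j.d1 1 * pd 1 (pd 3 N) p
            + j.d1 1 * j.d1 1 * pd 3 (pd 3 N) p + j.d2 1 1 * pd 3 N p)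
        - ((j.d1 0 * (pd 1 (pd 1 T) p + j.d1 1 * pd 3 (pd 1 T) p + j.d1 1 * pd 1 (pd 3 T) p
            + j.d1 1 * j.d1 1 * pd 3 (pd 3 T) p + j.d2 1 1 * pd 3 T p)
            + j.d2 1 0 * (pd 1 T p + j.d1 1 * pd 3 T p)
            + j.d2 1 0 * (pd 1 T p + j.d1 1 * pd 3 T p))
          + (j.d1 1 * (pd 1 (pd 1 X) p + j.d1 1 * pd 3 (pd 1 X) p + j.d1 1 * pd 1 (pd 3 X) p
            + j.d1 1 * j.d1 1 * pd 3 (pd 3 X) p + j.d2 1 1 * pd 3 X p)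
            + j.d2 1 1 * (pd 1 X p + j.d1 1 * pd 3 X p)
            + j.d2 1 1 * (pd 1 X p + j.d1 1 * pd 3 X p))
          + (j.d1 2 * (pd 1 (pd 1 Y) p + j.d1 1 * pd 3 (pd 1 Y) p + j.d1 1 * pd 1 (pd 3 Y) p
            + j.d1 1 * j.d1 1 * pd 3 (pd 3 Y) p + j.d2 1 1 * pd 3 Y p)
            + j.d2 1 2 * (pd 1 Y p + j.d1 1 * pd 3 Y p)
            + j.d2 1 2 * (pd 1 Y p + j.d1 1 * pd 3 Y p))))
      + f (p 3) * (pd 2 N p + j.d1 2 * pd 3 N p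
        - (j.d1 0 * (pd 2 T p + j.d1 2 * pd 3 T p) + j.d1 1 * (pd 2 X p + j.d1 2 * pd 3 X p)
          + j.d1 2 * (pd 2 Y p + j.d1 2 * pd 3 Y p)))
      + N p * (deriv f (p 3) * j.d1 2 - deriv g (p 3)) := by
  have hu : j.u = p 3 := by rw [← hp]; rfl
  subst hT hX hY hN
  simp only [prolongDelta, prolong1, prolong2, totalD, totalD2, Fin.sum_univ_three, hp, hu]
  rfl

/-- The determining equations of the Lie symmetries, after integration: the symmetries are the
vector fields `(l t + c₀) ∂_t + (l x / 2 + c₁) ∂_x + χ ∂_y + (η₁ u + η₀) ∂_u` for the solutions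
`l, χ, η₁, η₀` of this system. -/
structure ReducedSymmetry (U : Set Pt) (J : Set ℝ) (f g : ℝ → ℝ) (l : ℝ) (χ η₁ η₀ : Pt → ℝ) :
    Prop where
  smooth_χ : ContDiffOn ℝ ∞ χ U
  smooth_η₁ : ContDiffOn ℝ ∞ η₁ U
  smooth_η₀ : ContDiffOn ℝ ∞ η₀ U
  χ_x : ∀ p ∈ U, pd 1 χ p = 0
  χ_u : ∀ p ∈ U, pd 3 χ p = 0
  η₁_x : ∀ p ∈ U, pd 1 η₁ p = 0
  η₁_u : ∀ p ∈ U, pd 3 η₁ p = 0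
  η₀_x : ∀ p ∈ U, pd 1 η₀ p = 0
  η₀_u : ∀ p ∈ U, pd 3 η₀ p = 0
  eq_f : ∀ p ∈ U, ∀ u ∈ J,
    (η₁ p * u + η₀ p) * deriv f u = pd 0 χ p + f u * (pd 2 χ p - l)
  eq_g : ∀ p ∈ U, ∀ u ∈ J,
    pd 0 η₁ p * u + pd 0 η₀ p + f u * (pd 2 η₁ p * u + pd 2 η₀ p) + g u * (η₁ p - l)
      - (η₁ p * u + η₀ p) * deriv g u = 0

theorem smoothOn_component {U : Set Pt} {V : VField} (h : ContDiffOn ℝ ∞ V U) (i : Fin 4) :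
    ContDiffOn ℝ ∞ (fun p => V p i) U :=
  contDiffOn_pi.1 h i

theorem exists_deriv_ne_zero {J : Set ℝ} {f : ℝ → ℝ} (hJ : IsOpen J) (hJ' : IsConnected J)
    (hf : ContDiffOn ℝ ∞ f J) (hc : NonconstOn f J) : ∃ u ∈ J, deriv f u ≠ 0 := by
  by_contra! h
  obtain ⟨u, hu, v, hv, huv⟩ := hc
  exact huv (hJ.is_const_of_deriv_eq_zero hJ'.isPreconnected
    (hf.differentiableOn (by simp)) (fun s hs => h s hs) hu hv)

/-- The derivative is continuous, so it stays nonzero near a point where it is nonzero. Two such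
points are needed to annihilate a function that is affine in `u`. -/
theorem exists_two_deriv_ne_zero {J : Set ℝ} {f : ℝ → ℝ} (hJ : IsOpen J) (hJ' : IsConnected J)
    (hf : ContDiffOn ℝ ∞ f J) (hc : NonconstOn f J) :
    ∃ u ∈ J, ∃ v ∈ J, u ≠ v ∧ deriv f u ≠ 0 ∧ deriv f v ≠ 0 := by
  obtain ⟨u, hu, h⟩ := exists_deriv_ne_zero hJ hJ' hf hc
  have hd : ContinuousAt (deriv f) u :=
    ((hf.deriv_of_isOpen (m := ∞) hJ (by simp)).continuousOn).continuousAt (hJ.mem_nhds hu)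
  have hev : ∀ᶠ v in nhds u, v ∈ J ∧ deriv f v ≠ 0 :=
    Filter.Eventually.and (hJ.mem_nhds hu) (hd.eventually_ne h)
  obtain ⟨v, ⟨hv, hv'⟩, hne⟩ :=
    ((hev.filter_mono nhdsWithin_le_nhds).and
      (self_mem_nhdsWithin : {u}ᶜ ∈ nhdsWithin u {u}ᶜ)).exists
  exact ⟨u, hu, v, hv, fun e => hne e.symm, h, hv'⟩

/-! ### From Lie's criterion to the classifying equations. -/

section Necessity

variable {D : Set (Fin 3 → ℝ)} {J : Set ℝ} {f g : ℝ → ℝ} {V : VField}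

/-- Over a fixed point the criterion is a polynomial in `u_t, u_x, u_y, u_tx, u_xy`; differences of
its values at small integers isolate the coefficients. Equations of the form `A + f B = C` with `A,
B, C` independent of `u` split further, because `f` takes two different values. -/
theorem IsLieSymmetry.exists_reducedSymmetry (hD : IsOpen D) (hD' : IsConnected D)
    (hJ : IsOpen J) (hJ' : IsConnected J) (hf : ContDiffOn ℝ ∞ f J) (hc : NonconstOn f J)
    (h : IsLieSymmetry D J f g V) :
    ∃ (l c₀ c₁ : ℝ) (χ η₁ η₀ : Pt → ℝ), ReducedSymmetry (dom D J) J f g l χ η₁ η₀ ∧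
      ∀ p ∈ dom D J, V p = ![l * p 0 + c₀, l / 2 * p 1 + c₁, χ p, η₁ p * p 3 + η₀ p] := by
  obtain ⟨hV, hj⟩ := h
  set U := dom D J with hUdef
  have hU : IsOpen U := isOpen_dom hD hJ
  have hU' : IsConnected U := isConnected_dom hD' hJ'
  obtain ⟨T, hT⟩ : ∃ T : Pt → ℝ, T = fun p => V p 0 := ⟨_, rfl⟩
  obtain ⟨X, hX⟩ : ∃ X : Pt → ℝ, X = fun p => V p 1 := ⟨_, rfl⟩
  obtain ⟨Y, hY⟩ : ∃ Y : Pt → ℝ, Y = fun p => V p 2 := ⟨_, rfl⟩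
  obtain ⟨N, hN⟩ : ∃ N : Pt → ℝ, N = fun p => V p 3 := ⟨_, rfl⟩
  have sT : ContDiffOn ℝ ∞ T U := hT ▸ smoothOn_component hV 0
  have sX : ContDiffOn ℝ ∞ X U := hX ▸ smoothOn_component hV 1
  have sY : ContDiffOn ℝ ∞ Y U := hY ▸ smoothOn_component hV 2
  have sN : ContDiffOn ℝ ∞ N U := hN ▸ smoothOn_component hV 3
  -- The value of `u_xx` is chosen so that the jet satisfies the equation; the other five jet
  -- variables stay free.
  have key : ∀ p ∈ U, ∀ a b c r s : ℝ, _ := fun p hp a b c r s =>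
    (prolongDelta_eq f g V T X Y N hT hX hY hN (jetAt p a b c r s (a + f (p 3) * c - g (p 3))) p
      (jetAt_pt _ _ _ _ _ _ _)).symm.trans (hj _ hp.1 hp.2 (by simp [delta, jetAt]; ring))
  simp only [jetAt, Matrix.cons_val_zero, Matrix.cons_val_one, Matrix.cons_val] at key
  -- The coefficient of `u_tx` is `2 (T_x + u_x T_u)` and that of `u_xy` is `2 (Y_x + u_x Y_u)`.
  have T1 : ∀ p ∈ U, pd 1 T p = 0 := fun p hp => by
    linear_combination (1 / 2) * (key p hp 0 0 0 1 0) - (1 / 2) * (key p hp 0 0 0 0 0)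
  have T3 : ∀ p ∈ U, pd 3 T p = 0 := fun p hp => by
    linear_combination (1 / 2) * (key p hp 0 1 0 1 0) - (1 / 2) * (key p hp 0 1 0 0 0) - T1 p hp
  have Y1 : ∀ p ∈ U, pd 1 Y p = 0 := fun p hp => by
    linear_combination (1 / 2) * (key p hp 0 0 0 0 1) - (1 / 2) * (key p hp 0 0 0 0 0)
  have Y3 : ∀ p ∈ U, pd 3 Y p = 0 := fun p hp => by
    linear_combination (1 / 2) * (key p hp 0 1 0 0 1) - (1 / 2) * (key p hp 0 1 0 0 0) - Y1 p hp
  have key2 := fun p hp a b c => key p hp a b c 0 0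
  clear key
  -- The mixed second difference isolates the coefficient `2 X_u` of `u_t u_x`.
  have X3 : ∀ p ∈ U, pd 3 X p = 0 := fun p hp => by
    have k := key2 p hp
    simp only [T1 p hp, T3 p hp, Y1 p hp, Y3 p hp, pd_eq_zero hU T1 hp, pd_eq_zero hU T3 hp,
      pd_eq_zero hU Y1 hp, pd_eq_zero hU Y3 hp] at k
    linear_combination (1 / 2) * (k 1 1 0) - (1 / 2) * (k 1 0 0) - (1 / 2) * (k 0 1 0)
      + (1 / 2) * (k 0 0 0)
  have key3 : ∀ p ∈ U, ∀ a b c : ℝ,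
      pd 0 N p + a * pd 3 N p - a * pd 0 T p - b * pd 0 X p - c * pd 0 Y p
        - (pd 1 (pd 1 N) p + b * (2 * pd 1 (pd 3 N) p) + b ^ 2 * pd 3 (pd 3 N) p
          + (a + f (p 3) * c - g (p 3)) * pd 3 N p)
        + b * pd 1 (pd 1 X) p + 2 * (a + f (p 3) * c - g (p 3)) * pd 1 X p
        + f (p 3) * (pd 2 N p + c * pd 3 N p - a * pd 2 T p - b * pd 2 X p - c * pd 2 Y p)
        + N p * (deriv f (p 3) * c - deriv g (p 3)) = 0 := fun p hp a b c => by
    have k := key2 p hp a b c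
    simp only [T1 p hp, T3 p hp, Y1 p hp, Y3 p hp, pd_eq_zero hU T1 hp, pd_eq_zero hU T3 hp,
      pd_eq_zero hU Y1 hp, pd_eq_zero hU Y3 hp, X3 p hp, pd_eq_zero hU X3 hp,
      pd_comm hU sX hp 3 1, pd_comm hU sN hp 3 1] at k
    linear_combination k
  clear key2
  -- The coefficients of `u_t`, `u_y`, `u_x²`, `u_x` and the constant term give, in this order,
  -- `eT`, `eY`, `N33`, `eX` and `eN`.
  have eT : ∀ p ∈ U, pd 0 T p + f (p 3) * pd 2 T p = 2 * pd 1 X p := fun p hp => by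
    linear_combination key3 p hp 0 0 0 - key3 p hp 1 0 0
  have eY : ∀ p ∈ U, N p * deriv f (p 3) = pd 0 Y p + f (p 3) * (pd 2 Y p - 2 * pd 1 X p) :=
    fun p hp => by linear_combination key3 p hp 0 0 1 - key3 p hp 0 0 0
  have N33 : ∀ p ∈ U, pd 3 (pd 3 N) p = 0 := fun p hp => by
    linear_combination key3 p hp 0 0 0 - (1 / 2) * (key3 p hp 0 1 0)
      - (1 / 2) * (key3 p hp 0 (-1) 0)
  have eX : ∀ p ∈ U, pd 0 X p + 2 * pd 1 (pd 3 N) p - pd 1 (pd 1 X) p + f (p 3) * pd 2 X p = 0 :=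
    fun p hp => by
      linear_combination (1 / 2) * (key3 p hp 0 (-1) 0) - (1 / 2) * (key3 p hp 0 1 0)
  have eN : ∀ p ∈ U, pd 0 N p - pd 1 (pd 1 N) p + g (p 3) * (pd 3 N p - 2 * pd 1 X p)
      + f (p 3) * pd 2 N p - N p * deriv g (p 3) = 0 := fun p hp => by
    linear_combination key3 p hp 0 0 0
  clear key3
  -- functions not depending on `u`
  have fib : ∀ F : Pt → ℝ, ContDiffOn ℝ ∞ F U → (∀ q ∈ U, pd 3 F q = 0) → ∀ p ∈ U, ∀ u ∈ J,
      F (Function.update p 3 u) = F p := fun F hF h p hp u hu =>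
    eq_update_of_pd_eq_zero hD hJ hJ' (hF.differentiableOn (by simp)) h hp hu
  have comm0 : ∀ F : Pt → ℝ, ContDiffOn ℝ ∞ F U → ∀ k : Fin 4, (∀ q ∈ U, pd k F q = 0) →
      ∀ i : Fin 4, ∀ q ∈ U, pd k (pd i F) q = 0 := fun F hF k h i q hq => by
    rw [pd_comm hU hF hq, pd_eq_zero hU h hq]
  have upd : ∀ (p : Pt) (u : ℝ), Function.update p 3 u 3 = u := fun p u => by simp
  have T2 : ∀ p ∈ U, pd 2 T p = 0 := fun p hp => by
    obtain ⟨u, hu, v, hv, huv⟩ := hc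
    have e : ∀ w ∈ J, pd 0 T p + f w * pd 2 T p = 2 * pd 1 X p := fun w hw => by
      have := eT _ (update_mem_dom hp hw)
      rwa [upd, fib _ (smoothOn_pd hU sT 0) (comm0 T sT 3 T3 0) p hp w hw,
        fib _ (smoothOn_pd hU sT 2) (comm0 T sT 3 T3 2) p hp w hw,
        fib _ (smoothOn_pd hU sX 1) (comm0 X sX 3 X3 1) p hp w hw] at this
    have : (f u - f v) * pd 2 T p = 0 := by linear_combination e u hu - e v hv
    exact (mul_eq_zero.1 this).resolve_left (sub_ne_zero.2 huv)
  have T0 : ∀ p ∈ U, pd 0 T p = 2 * pd 1 X p := fun p hp => by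
    have := eT p hp
    rw [T2 p hp] at this
    linarith
  have dbl : ∀ (i : Fin 4), ∀ p ∈ U, pd i (pd 0 T) p = 2 * pd i (pd 1 X) p := fun i p hp => by
    rw [pd_congr hU T0 hp i,
      pd_const_mul i 2 (differentiableAt_of_smoothOn hU (smoothOn_pd hU sX 1) hp)]
  -- Only the `t`-derivative of `T` can be nonzero, and `T_t = 2 X_x`, so `X_x` inherits this
  -- property.
  have X1i : ∀ i, i ≠ 0 → ∀ p ∈ U, pd i (pd 1 X) p = 0 := fun i hi p hp => by
    have h1 := dbl i p hp
    have h2 : pd i (pd 0 T) p = 0 := by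
      fin_cases i
      · exact absurd rfl hi
      · exact comm0 T sT 1 T1 0 p hp
      · exact comm0 T sT 2 T2 0 p hp
      · exact comm0 T sT 3 T3 0 p hp
    linarith
  -- `N` does not depend on `x`
  have sN1 := smoothOn_pd hU sN 1
  -- The right side of `eY` has zero `x`-derivative, since `Y_x = 0` and `X_xx = 0`.
  have N1f : ∀ p ∈ U, pd 1 N p * deriv f (p 3) = 0 := fun p hp => by
    have sf' : ContDiffOn ℝ ∞ (deriv f) J := hf.deriv_of_isOpen (m := ∞) hJ (by simp)
    have hp3 : p 3 ∈ J := hp.2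
    have df' := ((sf'.contDiffAt (hJ.mem_nhds hp3)).differentiableAt (by simp)).hasDerivAt
    have df := ((hf.contDiffAt (hJ.mem_nhds hp3)).differentiableAt (by simp)).hasDerivAt
    have cd : ∀ {h : ℝ → ℝ} {d : ℝ}, HasDerivAt h d (p 3) →
        DifferentiableAt ℝ (fun q : Pt => h (q 3)) p := fun {h} {d} hh =>
      DifferentiableAt.comp (g := h) p hh.differentiableAt (differentiableAt_coord 3)
    have d0 := differentiableAt_of_smoothOn hU (smoothOn_pd hU sY 0) hp
    have d2 := differentiableAt_of_smoothOn hU (smoothOn_pd hU sY 2) hp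
    have d1 := (differentiableAt_of_smoothOn hU (smoothOn_pd hU sX 1) hp)
    have h1 := pd_congr hU eY hp 1
    have d3 := d2.fun_sub (d1.const_mul 2)
    rw [pd_mul 1 (differentiableAt_of_smoothOn hU sN hp) (cd df'),
      pd_add 1 d0 ((cd df).fun_mul d3), pd_mul 1 (cd df) d3, pd_sub 1 d2 (d1.const_mul 2),
      pd_const_mul 1 2 d1] at h1
    rw [pd_comp_coord 1 3 df', pd_comp_coord 1 3 df, comm0 Y sY 1 Y1 0 p hp, comm0 Y sY 1 Y1 2 p hp,
      X1i 1 (by decide) p hp] at h1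
    simp at h1
    rcases h1 with h1 | h1 <;> simp [h1]
  -- By `N33` the function `N_x` is affine in `u` on each fibre, and by `N1f` it vanishes at two
  -- points where `f' ≠ 0`.
  have N13 : ∀ p ∈ U, pd 3 (pd 1 N) p = 0 ∧ pd 1 N p = 0 := by
    have a0 : ∀ q ∈ U, pd 3 (pd 3 (pd 1 N)) q = 0 := fun q hq => by
      rw [pd_congr hU (fun r hr => pd_comm hU sN hr 3 1) hq 3]
      exact (pd_comm hU (smoothOn_pd hU sN 3) hq 3 1).trans (pd_eq_zero hU N33 hq 1)
    intro p hp
    have c1 := fib _ (smoothOn_pd hU sN1 3) a0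
    have c2 : ∀ q ∈ U, pd 3 (fun r => pd 1 N r - pd 3 (pd 1 N) r * r 3) q = 0 := fun q hq => by
      have d3 := differentiableAt_of_smoothOn hU (smoothOn_pd hU sN1 3) hq
      rw [pd_sub 3 (differentiableAt_of_smoothOn hU sN1 hq)
        (d3.fun_mul (differentiableAt_coord 3)), pd_mul 3 d3 (differentiableAt_coord 3),
        a0 q hq, pd_coord]
      simp
    have c3 := fib _ (sN1.sub ((smoothOn_pd hU sN1 3).mul
      (contDiff_apply ℝ ℝ (3 : Fin 4)).contDiffOn)) c2
    have c4 : ∀ u ∈ J, pd 1 N (Function.update p 3 u)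
        = pd 3 (pd 1 N) p * u + (pd 1 N p - pd 3 (pd 1 N) p * p 3) := fun u hu => by
      have e1 := c3 p hp u hu
      have e2 := c1 p hp u hu
      simp only [upd] at e1
      rw [e2] at e1
      linarith
    obtain ⟨u, hu, v, hv, huv, hu', hv'⟩ := exists_two_deriv_ne_zero hJ hJ' hf hc
    have z : ∀ w ∈ J, deriv f w ≠ 0 →
        pd 3 (pd 1 N) p * w + (pd 1 N p - pd 3 (pd 1 N) p * p 3) = 0 := fun w hw hw' => by
      have e1 := N1f _ (update_mem_dom hp hw)
      rw [upd] at e1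
      rw [← c4 w hw]
      exact (mul_eq_zero.1 e1).resolve_right hw'
    have z0 : pd 3 (pd 1 N) p = 0 := by
      have : pd 3 (pd 1 N) p * (u - v) = 0 := by linear_combination z u hu hu' - z v hv hv'
      exact (mul_eq_zero.1 this).resolve_right (sub_ne_zero.2 huv)
    refine ⟨z0, ?_⟩
    have := z u hu hu'
    rw [z0] at this
    linarith
  have N1 : ∀ p ∈ U, pd 1 N p = 0 := fun p hp => (N13 p hp).2
  -- With `N_xu = X_xx = 0` the equation `eX` reads `X_t + f X_y = 0`, and two values of `f`
  -- separate the terms.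
  have X02 : ∀ p ∈ U, pd 0 X p = 0 ∧ pd 2 X p = 0 := fun p hp => by
    have e : ∀ w ∈ J, pd 0 X p + f w * pd 2 X p = 0 := fun w hw => by
      have hm := update_mem_dom hp hw
      have := eX _ hm
      rw [upd, fib _ (smoothOn_pd hU sX 0) (comm0 X sX 3 X3 0) p hp w hw,
        fib _ (smoothOn_pd hU sX 2) (comm0 X sX 3 X3 2) p hp w hw, X1i 1 (by decide) _ hm,
        pd_comm hU sN hm 1 3, (N13 _ hm).1] at this
      linarith
    obtain ⟨u, hu, v, hv, huv⟩ := hc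
    have z : (f u - f v) * pd 2 X p = 0 := by linear_combination e u hu - e v hv
    have z2 := (mul_eq_zero.1 z).resolve_left (sub_ne_zero.2 huv)
    have := e u hu
    rw [z2] at this
    exact ⟨by linarith, z2⟩
  obtain ⟨k, hk⟩ := exists_const_of_pd_eq_zero hU hU'
    ((smoothOn_pd hU sX 1).differentiableOn (by simp)) (fun i q hq => by
      by_cases hi : i = 0
      · subst hi
        rw [pd_comm hU sX hq 0 1, pd_eq_zero hU (fun r hr => (X02 r hr).1) hq]
      · exact X1i i hi q hq)
  obtain ⟨c₁, hc₁⟩ := exists_affine_of_pd hU hU' sX 1 k (fun i q hq => by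
    fin_cases i
    · simpa using (X02 q hq).1
    · simpa using hk q hq
    · simpa using (X02 q hq).2
    · simpa using X3 q hq)
  obtain ⟨c₀, hc₀⟩ := exists_affine_of_pd hU hU' sT 0 (2 * k) (fun i q hq => by
    fin_cases i
    · have := T0 q hq
      rw [hk q hq] at this
      simpa using this
    · simpa using T1 q hq
    · simpa using T2 q hq
    · simpa using T3 q hq)
  have sN3 := smoothOn_pd hU sN 3
  have sη₀ : ContDiffOn ℝ ∞ (fun p => N p - pd 3 N p * p 3) U :=
    sN.sub (sN3.mul (contDiff_apply ℝ ℝ (3 : Fin 4)).contDiffOn)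
  have hη₀ : ∀ i, ∀ q ∈ U, pd i (fun p => N p - pd 3 N p * p 3) q
      = pd i N q - pd i (pd 3 N) q * q 3 - (if i = 3 then pd 3 N q else 0) := fun i q hq => by
    have d3 := differentiableAt_of_smoothOn hU sN3 hq
    rw [pd_sub i (differentiableAt_of_smoothOn hU sN hq)
      (d3.fun_mul (differentiableAt_coord 3)), pd_mul i d3 (differentiableAt_coord 3), pd_coord]
    split_ifs <;> ring
  have N13' : ∀ q ∈ U, pd 1 (pd 3 N) q = 0 := fun q hq => by
    rw [pd_comm hU sN hq, (N13 q hq).1]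
  have η₀3 : ∀ q ∈ U, pd 3 (fun p => N p - pd 3 N p * p 3) q = 0 := fun q hq => by
    rw [hη₀ 3 q hq, N33 q hq]; simp
  have Nfib : ∀ p ∈ U, ∀ u ∈ J, N (Function.update p 3 u)
      = pd 3 N p * u + (N p - pd 3 N p * p 3) := fun p hp u hu => by
    have e1 := fib _ sη₀ η₀3 p hp u hu
    have e2 := fib _ sN3 N33 p hp u hu
    simp only [upd] at e1
    rw [e2] at e1
    linarith
  -- Here `l = T_t = 2 X_x`; since `N` is affine in `u`, its coefficients are `η₁ = N_u` and `η₀ = N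
  -- - u N_u`.
  refine ⟨2 * k, c₀, c₁, Y, pd 3 N, fun p => N p - pd 3 N p * p 3,
    ⟨sY, sN3, sη₀, Y1, Y3, N13', N33, fun q hq => by rw [hη₀ 1 q hq, N1 q hq, N13' q hq]; simp,
      η₀3, fun p hp u hu => ?_, fun p hp u hu => ?_⟩, fun p hp => ?_⟩
  · have hm := update_mem_dom hp hu
    have e := eY _ hm
    rw [upd, Nfib p hp u hu, fib _ (smoothOn_pd hU sY 0) (comm0 Y sY 3 Y3 0) p hp u hu,
      fib _ (smoothOn_pd hU sY 2) (comm0 Y sY 3 Y3 2) p hp u hu, hk _ hm] at e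
    exact e
  · have hm := update_mem_dom hp hu
    have e := eN _ hm
    have hN : ∀ i, i ≠ 3 → pd i N (Function.update p 3 u)
        = pd i (pd 3 N) p * u + pd i (fun p => N p - pd 3 N p * p 3) p := fun i hi => by
      have e1 := fib _ (smoothOn_pd hU sη₀ i) (comm0 _ sη₀ 3 η₀3 i) p hp u hu
      have e2 := fib _ (smoothOn_pd hU sN3 i) (comm0 _ sN3 3 N33 i) p hp u hu
      rw [hη₀ i _ hm, e2, upd, if_neg hi] at e1
      linarith
    rw [upd, Nfib p hp u hu, hN 0 (by decide), hN 2 (by decide), hk _ hm,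
      fib _ sN3 N33 p hp u hu, pd_eq_zero hU N1 hm] at e
    linear_combination e
  · ext i
    fin_cases i
    · simpa [hT] using hc₀ p hp
    · have := hc₁ p hp
      simp [hX] at this
      simp [this]
    · simp [hY]
    · simp [hN]

end Necessity

/-! ### From the classifying equations back to Lie's criterion. -/

section Sufficiency

variable {D : Set (Fin 3 → ℝ)} {J : Set ℝ} {f g : ℝ → ℝ} {V : VField}

theorem ReducedSymmetry.isLieSymmetry (hD : IsOpen D) (hJ : IsOpen J) {l c₀ c₁ : ℝ}
    {χ η₁ η₀ : Pt → ℝ} (h : ReducedSymmetry (dom D J) J f g l χ η₁ η₀)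
    (hV : ∀ p ∈ dom D J, V p = ![l * p 0 + c₀, l / 2 * p 1 + c₁, χ p, η₁ p * p 3 + η₀ p]) :
    IsLieSymmetry D J f g V := by
  have hU : IsOpen (dom D J) := isOpen_dom hD hJ
  have cs : ∀ i : Fin 4, ContDiffOn ℝ ∞ (fun p : Pt => p i) (dom D J) := fun i =>
    (contDiff_apply ℝ ℝ i).contDiffOn
  have vT : ∀ p ∈ dom D J, V p 0 = l * p 0 + c₀ := fun p hp => by rw [hV p hp]; rfl
  have vX : ∀ p ∈ dom D J, V p 1 = l / 2 * p 1 + c₁ := fun p hp => by rw [hV p hp]; rfl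
  have vY : ∀ p ∈ dom D J, V p 2 = χ p := fun p hp => by rw [hV p hp]; rfl
  have vN : ∀ p ∈ dom D J, V p 3 = η₁ p * p 3 + η₀ p := fun p hp => by rw [hV p hp]; rfl
  have aff : ∀ (k : Fin 4) (a b : ℝ) (p : Pt) (i : Fin 4),
      pd i (fun q => a * q k + b) p = if i = k then a else 0 := fun k a b p i => by
    have := pd_comp_coord (p := p) i k (((hasDerivAt_id (p k)).const_mul a).add_const b)
    simpa using this
  have pT : ∀ i, ∀ p ∈ dom D J, pd i (fun p => V p 0) p = if i = 0 then l else 0 :=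
    fun i p hp => by rw [pd_congr hU vT hp, aff]
  have pX : ∀ i, ∀ p ∈ dom D J, pd i (fun p => V p 1) p = if i = 1 then l / 2 else 0 :=
    fun i p hp => by rw [pd_congr hU vX hp, aff]
  have pY : ∀ i, ∀ p ∈ dom D J, pd i (fun p => V p 2) p = pd i χ p :=
    fun i p hp => pd_congr hU vY hp i
  have pN : ∀ i, ∀ p ∈ dom D J, pd i (fun p => V p 3) p
      = pd i η₁ p * p 3 + pd i η₀ p + if i = 3 then η₁ p else 0 := fun i p hp => by
    have d1 := differentiableAt_of_smoothOn hU h.smooth_η₁ hp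
    rw [pd_congr hU vN hp, pd_add i (d1.fun_mul (differentiableAt_coord 3))
      (differentiableAt_of_smoothOn hU h.smooth_η₀ hp),
      pd_mul i d1 (differentiableAt_coord 3), pd_coord]
    split_ifs <;> ring
  have pN1 : ∀ p ∈ dom D J, pd 1 (fun p => V p 3) p = 0 := fun p hp => by
    rw [pN 1 p hp, h.η₁_x p hp, h.η₀_x p hp]; simp
  have pN3 : ∀ p ∈ dom D J, pd 3 (fun p => V p 3) p = η₁ p := fun p hp => by
    rw [pN 3 p hp, h.η₁_u p hp, h.η₀_u p hp]; simp
  refine ⟨contDiffOn_pi.2 fun i => ?_, fun j hb hu hd => ?_⟩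
  · fin_cases i
    · exact ((contDiffOn_const.mul (cs 0)).add contDiffOn_const).congr vT
    · exact ((contDiffOn_const.mul (cs 1)).add contDiffOn_const).congr vX
    · exact h.smooth_χ.congr vY
    · exact ((h.smooth_η₁.mul (cs 3)).add h.smooth_η₀).congr vN
  · have hp : j.pt ∈ dom D J := by
      have : (![j.base 0, j.base 1, j.base 2] : Fin 3 → ℝ) = j.base := by
        ext i; fin_cases i <;> rfl
      exact ⟨show ![j.base 0, j.base 1, j.base 2] ∈ D by rwa [this], hu⟩
    rw [prolongDelta_eq f g V _ _ _ _ rfl rfl rfl rfl j j.pt rfl]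
    have hu3 : j.pt 3 = j.u := rfl
    have c : ∀ (F : Pt → ℝ) (i k : Fin 4) (c : ℝ), (∀ q ∈ dom D J, pd k F q = c) →
        pd i (pd k F) j.pt = 0 := fun F i k c hc => pd_eq_zero hU hc hp i
    rw [c (fun p => V p 0) 1 1 0 (fun q hq => by simp [pT 1 q hq]),
      c (fun p => V p 0) 3 1 0 (fun q hq => by simp [pT 1 q hq]),
      c (fun p => V p 0) 1 3 0 (fun q hq => by simp [pT 3 q hq]),
      c (fun p => V p 0) 3 3 0 (fun q hq => by simp [pT 3 q hq]),
      c (fun p => V p 1) 1 1 (l / 2) (fun q hq => by simp [pX 1 q hq]),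
      c (fun p => V p 1) 3 1 (l / 2) (fun q hq => by simp [pX 1 q hq]),
      c (fun p => V p 1) 1 3 0 (fun q hq => by simp [pX 3 q hq]),
      c (fun p => V p 1) 3 3 0 (fun q hq => by simp [pX 3 q hq]),
      c (fun p => V p 2) 1 1 0 (fun q hq => by simp [pY 1 q hq, h.χ_x q hq]),
      c (fun p => V p 2) 3 1 0 (fun q hq => by simp [pY 1 q hq, h.χ_x q hq]),
      c (fun p => V p 2) 1 3 0 (fun q hq => by simp [pY 3 q hq, h.χ_u q hq]),
      c (fun p => V p 2) 3 3 0 (fun q hq => by simp [pY 3 q hq, h.χ_u q hq]),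
      c (fun p => V p 3) 1 1 0 pN1, c (fun p => V p 3) 3 1 0 pN1,
      pd_congr hU pN3 hp 1, pd_congr hU pN3 hp 3, h.η₁_x _ hp, h.η₁_u _ hp,
      pN3 _ hp, pN 0 _ hp, pN 2 _ hp, vN _ hp]
    simp only [pT _ _ hp, pX _ _ hp, pY _ _ hp, h.χ_x _ hp, h.χ_u _ hp, hu3]
    have e1 := h.eq_f _ hp _ hu
    have e2 := h.eq_g _ hp _ hu
    have e3 : j.d2 1 1 = j.d1 0 + f j.u * j.d1 2 - g j.u := by
      simp only [delta] at hd; linarith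
    rw [e3]
    simp
    -- Without `u_xx` the criterion is affine in `u_y`: the first classifying equation is the
    -- coefficient of `u_y`, the second one the constant term.
    linear_combination j.d1 2 * e1 + e2

end Sufficiency

/-! ### Linear independence of exponentials, powers, logarithms and polynomials. -/

section Independence

/-- Eigenfunctions of a first order operator `w d/du` for distinct eigenvalues are linearly
independent. -/
theorem eq_zero_of_sum_eigenfunctions {ι : Type*} {V : Set ℝ} (hV : IsOpen V) {w : ℝ → ℝ}
    (s : Finset ι) {e : ι → ℝ} (he : Set.InjOn e s) {φ φ' : ι → ℝ → ℝ}
    (hφ : ∀ i ∈ s, ∀ u ∈ V, HasDerivAt (φ i) (φ' i u) u ∧ w u * φ' i u = e i * φ i u)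
    (c : ι → ℝ) (h : ∀ u ∈ V, ∑ i ∈ s, c i * φ i u = 0) :
    ∀ i ∈ s, ∀ u ∈ V, c i * φ i u = 0 := by
  classical
  induction s using Finset.induction_on generalizing c with
  | empty => simp
  | insert j s hj ih =>
    have h' : ∀ u ∈ V, ∑ i ∈ insert j s, c i * φ' i u = 0 := fun u hu => by
      have h1 : HasDerivAt (fun u => ∑ i ∈ insert j s, c i * φ i u)
          (∑ i ∈ insert j s, c i * φ' i u) u :=
        HasDerivAt.fun_sum fun i hi => (hφ i hi u hu).1.const_mul (c i)
      have h2 : HasDerivAt (fun u => ∑ i ∈ insert j s, c i * φ i u) 0 u :=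
        (hasDerivAt_const u (0 : ℝ)).congr_of_eventuallyEq
          (Filter.eventuallyEq_of_mem (hV.mem_nhds hu) h)
      exact h1.unique h2
    -- Applying `w d/du - e j` to the sum removes the term `j` and multiplies every other term `i`
    -- by `e i - e j ≠ 0`.
    have key : ∀ u ∈ V, ∑ i ∈ s, (c i * (e i - e j)) * φ i u = 0 := fun u hu => by
      have h1 : ∑ i ∈ insert j s, (c i * (e i - e j)) * φ i u = 0 := by
        calc ∑ i ∈ insert j s, (c i * (e i - e j)) * φ i u
            = ∑ i ∈ insert j s, (w u * (c i * φ' i u) - e j * (c i * φ i u)) :=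
              Finset.sum_congr rfl fun i hi => by
                linear_combination (-c i) * (hφ i hi u hu).2
          _ = 0 := by
              rw [Finset.sum_sub_distrib, ← Finset.mul_sum, ← Finset.mul_sum, h u hu, h' u hu]
              ring
      rw [Finset.sum_insert hj] at h1
      simpa using h1
    have hs : ∀ i ∈ s, ∀ u ∈ V, c i * φ i u = 0 := fun i hi u hu => by
      have h1 := ih (he.mono (by simp)) (fun i hi => hφ i (Finset.mem_insert_of_mem hi)) _ key i hi
        u hu
      have h2 : e i - e j ≠ 0 := fun h0 => hj (by
        have := he (by simp [hi]) (by simp) (sub_eq_zero.1 h0)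
        rwa [← this])
      have h3 : (e i - e j) * (c i * φ i u) = 0 := by linear_combination h1
      exact (mul_eq_zero.1 h3).resolve_left h2
    intro i hi u hu
    rcases Finset.mem_insert.1 hi with rfl | hi
    · have := h u hu
      rw [Finset.sum_insert hj, Finset.sum_eq_zero fun k hk => hs k hk u hu, add_zero] at this
      exact this
    · exact hs i hi u hu

theorem exp_independent {n : ℕ} {J : Set ℝ} (hJ : IsOpen J) (hJ' : J.Nonempty) (e c : Fin n → ℝ)
    (he : Function.Injective e) (h : ∀ u ∈ J, ∑ i, c i * Real.exp (e i * u) = 0) (i : Fin n) :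
    c i = 0 := by
  obtain ⟨u, hu⟩ := hJ'
  have := eq_zero_of_sum_eigenfunctions hJ (w := fun _ => 1) Finset.univ he.injOn
    (φ := fun i u => Real.exp (e i * u)) (φ' := fun i u => Real.exp (e i * u) * e i)
    (fun i _ u _ => ⟨by simpa using ((hasDerivAt_id u).const_mul (e i)).exp, by ring⟩) c h i
    (Finset.mem_univ i) u hu
  exact (mul_eq_zero.1 this).resolve_right (Real.exp_ne_zero _)

theorem rpow_independent {n : ℕ} {V : Set ℝ} (hV : IsOpen V) (hV' : V.Nonempty)
    (e c : Fin n → ℝ) (he : Function.Injective e) (h0 : ∀ u ∈ V, u ≠ 0)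
    (hp : ∀ u ∈ V, ∀ i, u ^ e i ≠ 0) (h : ∀ u ∈ V, ∑ i, c i * u ^ e i = 0) (i : Fin n) :
    c i = 0 := by
  obtain ⟨u, hu⟩ := hV'
  have := eq_zero_of_sum_eigenfunctions hV (w := fun u => u) Finset.univ he.injOn
    (φ := fun i u => u ^ e i) (φ' := fun i u => e i * u ^ (e i - 1))
    (fun i _ u hu => ⟨Real.hasDerivAt_rpow_const (Or.inl (h0 u hu)), by
      rw [Real.rpow_sub_one (h0 u hu)]; field_simp [h0 u hu]⟩) c h i (Finset.mem_univ i) u hu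
  exact (mul_eq_zero.1 this).resolve_right (hp u hu i)

theorem deriv_eq_of_eqOn {J : Set ℝ} (hJ : IsOpen J) {F G : ℝ → ℝ} (h : ∀ u ∈ J, F u = G u) {u : ℝ}
    (hu : u ∈ J) : deriv F u = deriv G u :=
  (Filter.eventuallyEq_of_mem (hJ.mem_nhds hu) h).deriv_eq

theorem hasDerivAt_eq_zero {J : Set ℝ} (hJ : IsOpen J) {F : ℝ → ℝ} {c d : ℝ}
    (h : ∀ u ∈ J, F u = c) {u : ℝ} (hu : u ∈ J) (hd : HasDerivAt F d u) : d = 0 := by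
  rw [← hd.deriv, deriv_eq_of_eqOn hJ h hu]; simp

theorem quadratic_eq_zero {J : Set ℝ} (hJ : IsOpen J) (hJ' : J.Nonempty) {a b c : ℝ}
    (h : ∀ u ∈ J, a * u ^ 2 + b * u + c = 0) : a = 0 ∧ b = 0 ∧ c = 0 := by
  have h1 : ∀ u ∈ J, 2 * a * u + b = 0 := fun u hu => by
    have hd : HasDerivAt (fun u : ℝ => a * u ^ 2 + b * u + c) (2 * a * u + b) u := by
      have := ((((hasDerivAt_id u).pow 2).const_mul a).add
        ((hasDerivAt_id u).const_mul b)).add_const c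
      exact this.congr_deriv (by simp; ring)
    exact hasDerivAt_eq_zero hJ h hu hd
  obtain ⟨u, hu⟩ := hJ'
  have h2 : 2 * a = 0 := by
    have hd : HasDerivAt (fun u : ℝ => 2 * a * u + b) (2 * a) u := by
      simpa using ((hasDerivAt_id u).const_mul (2 * a)).add_const b
    exact hasDerivAt_eq_zero hJ h1 hu hd
  have ha : a = 0 := by linarith
  have hb : b = 0 := by have := h1 u hu; rw [ha] at this; linarith
  exact ⟨ha, hb, by have := h u hu; rw [ha, hb] at this; linarith⟩

theorem affine_eq_zero {J : Set ℝ} (hJ : IsOpen J) (hJ' : J.Nonempty) {b c : ℝ}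
    (h : ∀ u ∈ J, b * u + c = 0) : b = 0 ∧ c = 0 :=
  (quadratic_eq_zero (a := 0) hJ hJ' fun u hu => by linarith [h u hu]).2

/-- The first classifying equation for `f = exp`. After division by `exp u`, two differentiations
isolate `c`. -/
theorem exp_relation {J : Set ℝ} (hJ : IsOpen J) (hJ' : J.Nonempty) {a b c d : ℝ}
    (h : ∀ u ∈ J, (a * u + b) * Real.exp u = c + Real.exp u * d) : a = 0 ∧ c = 0 ∧ b = d := by
  have h0 : ∀ u ∈ J, a * u - c * Real.exp (-u) = d - b := fun u hu => by
    have := h u hu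
    rw [Real.exp_neg]
    field_simp
    linarith
  have h1 : ∀ u ∈ J, c * Real.exp (-u) = -a := fun u hu => by
    have hd : HasDerivAt (fun u : ℝ => a * u - c * Real.exp (-u)) (a + c * Real.exp (-u)) u := by
      have := ((hasDerivAt_id u).const_mul a).sub (((hasDerivAt_id u).neg.exp).const_mul c)
      exact this.congr_deriv (by simp)
    linarith [hasDerivAt_eq_zero hJ h0 hu hd]
  obtain ⟨u, hu⟩ := hJ'
  have hd : HasDerivAt (fun u : ℝ => c * Real.exp (-u)) (-(c * Real.exp (-u))) u := by
    have := ((hasDerivAt_id u).neg.exp).const_mul c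
    exact this.congr_deriv (by simp)
  have h2 := hasDerivAt_eq_zero hJ h1 hu hd
  have hc : c = 0 := by simpa [Real.exp_ne_zero] using h2
  have ha : a = 0 := by have := h1 u hu; rw [hc] at this; linarith
  refine ⟨ha, hc, ?_⟩
  have := h0 u hu
  rw [ha, hc] at this
  linarith

/-- The first classifying equation for `f = log`, multiplied by `u`. It also settles the second one
for the source `ε u log u`. -/
theorem log_relation {J : Set ℝ} (hJ : IsOpen J) (hJ' : J.Nonempty) (hpos : J ⊆ Set.Ioi 0)
    {a b c d : ℝ} (h : ∀ u ∈ J, a * u + b = c * u + d * (u * Real.log u)) :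
    b = 0 ∧ a = c ∧ d = 0 := by
  have h1 : ∀ u ∈ J, d * Real.log u = a - c - d := fun u hu => by
    have hu0 : u ≠ 0 := (hpos hu).ne'
    have hd : HasDerivAt (fun u : ℝ => (a - c) * u - d * (u * Real.log u))
        ((a - c) - d * (Real.log u + 1)) u := by
      have := ((hasDerivAt_id u).const_mul (a - c)).sub
        ((Real.hasDerivAt_mul_log hu0).const_mul d)
      exact this.congr_deriv (by simp)
    linarith [hasDerivAt_eq_zero hJ (c := -b) (fun u hu => by linarith [h u hu]) hu hd]
  obtain ⟨u, hu⟩ := hJ'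
  have hu0 : u ≠ 0 := (hpos hu).ne'
  have h2 := hasDerivAt_eq_zero hJ h1 hu ((Real.hasDerivAt_log hu0).const_mul d)
  have hd : d = 0 := by simpa [hu0] using h2
  have hac : a = c := by have := h1 u hu; rw [hd] at this; linarith
  refine ⟨?_, hac, hd⟩
  have := h u hu
  rw [hd, hac] at this
  linarith

end Independence

/-! ### Real powers on their natural domain. -/

section Powers

variable {J : Set ℝ} {m : ℝ} {u : ℝ}

/-- The domain matters: for `u < 0` the value of `u ^ m` carries a factor `cos (π m)`, which
vanishes at half-integers. -/
theorem PowDomain.rpow_ne_zero (h : PowDomain m J) (hu : u ∈ J) (hu0 : u ≠ 0) : u ^ m ≠ 0 := by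
  rcases h u hu with hp | ⟨-, k, rfl⟩ | ⟨k, rfl⟩
  · exact (Real.rpow_pos_of_pos hp _).ne'
  · rw [Real.rpow_intCast]; exact zpow_ne_zero _ hu0
  · rw [Real.rpow_natCast]; exact pow_ne_zero _ hu0

theorem powDomain_natCast (k : ℕ) (J : Set ℝ) : PowDomain k J := fun _ _ => Or.inr (Or.inr ⟨k, rfl⟩)

theorem powDomain_one (J : Set ℝ) : PowDomain 1 J := by simpa using powDomain_natCast 1 J

theorem PowDomain.add_one (h : PowDomain m J) : PowDomain (m + 1) J := by
  intro u hu
  rcases h u hu with hp | ⟨h0, k, rfl⟩ | ⟨k, rfl⟩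
  · exact Or.inl hp
  · exact Or.inr (Or.inl ⟨h0, k + 1, by push_cast; rfl⟩)
  · exact Or.inr (Or.inr ⟨k + 1, by push_cast; rfl⟩)

theorem PowDomain.rpow_add_one (h : PowDomain m J) (hu : u ∈ J) : u ^ (m + 1) = u ^ m * u := by
  by_cases h0 : u = 0
  · rcases h u hu with hp | ⟨h1, -⟩ | ⟨k, rfl⟩
    · exact absurd h0 hp.ne'
    · exact absurd h0 h1
    · subst h0
      rw [mul_zero, Real.zero_rpow (by positivity)]
  · exact Real.rpow_add_one h0 m

theorem PowDomain.contDiffAt (h : PowDomain m J) (hu : u ∈ J) :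
    ContDiffAt ℝ ∞ (fun u : ℝ => u ^ m) u := by
  by_cases h0 : u = 0
  · rcases h u hu with hp | ⟨h1, -⟩ | ⟨k, rfl⟩
    · exact absurd h0 hp.ne'
    · exact absurd h0 h1
    · simp only [Real.rpow_natCast]
      exact (contDiff_id.pow k).contDiffAt
  · exact Real.contDiffAt_rpow_const_of_ne h0

theorem PowDomain.contDiffOn (h : PowDomain m J) : ContDiffOn ℝ ∞ (fun u : ℝ => u ^ m) J :=
  fun _ hu => (h.contDiffAt hu).contDiffWithinAt

theorem PowDomain.hasDerivAt (h : PowDomain m J) (hu : u ∈ J) :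
    HasDerivAt (fun u : ℝ => u ^ m) (deriv (fun u : ℝ => u ^ m) u) u :=
  ((h.contDiffAt hu).differentiableAt (by simp)).hasDerivAt

/-- Euler's relation, written without `u ^ (m - 1)` so that it includes `u = 0`. There `m` is a
natural number and both sides vanish, also for `m = 0`, where `0 ^ 0 = 1`. -/
theorem PowDomain.mul_deriv (h : PowDomain m J) (hu : u ∈ J) :
    u * deriv (fun u : ℝ => u ^ m) u = m * u ^ m := by
  by_cases h0 : u = 0
  · rcases h u hu with hp | ⟨h1, -⟩ | ⟨k, rfl⟩
    · exact absurd h0 hp.ne'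
    · exact absurd h0 h1
    · subst h0
      rcases Nat.eq_zero_or_pos k with rfl | hk
      · simp
      · rw [Real.zero_rpow (by positivity)]; simp
  · rw [(Real.hasDerivAt_rpow_const (Or.inl h0)).deriv, Real.rpow_sub_one h0]
    field_simp

theorem nonempty_diff_zero (hJ : IsOpen J) (hJ' : J.Nonempty) :
    IsOpen (J \ {0}) ∧ (J \ {0}).Nonempty := by
  refine ⟨hJ.sdiff isClosed_singleton, ?_⟩
  obtain ⟨u, hu⟩ := hJ'
  have hev : ∀ᶠ v in nhdsWithin u {u}ᶜ, v ∈ J := nhdsWithin_le_nhds (hJ.mem_nhds hu)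
  obtain ⟨v, hv, hne⟩ := (hev.and self_mem_nhdsWithin).exists
  by_cases h0 : u = 0
  · exact ⟨v, hv, fun hv0 => hne (by rw [Set.mem_singleton_iff] at *; rw [hv0, h0])⟩
  · exact ⟨u, hu, h0⟩

/-- Powers are eigenfunctions of `u d/du`, which is singular at zero; the open set without zero is
still nonempty. -/
theorem rpow_independent_powDomain {n : ℕ} (hJ : IsOpen J) (hJ' : J.Nonempty)
    (e c : Fin n → ℝ) (he : Function.Injective e)
    (hp : ∀ i, ∀ u ∈ J, u ≠ 0 → u ^ e i ≠ 0)
    (h : ∀ u ∈ J, u ≠ 0 → ∑ i, c i * u ^ e i = 0) (i : Fin n) : c i = 0 := by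
  obtain ⟨h1, h2⟩ := nonempty_diff_zero hJ hJ'
  exact rpow_independent h1 h2 e c he (fun u hu => hu.2) (fun u hu i => hp i u hu.1 hu.2)
    (fun u hu => h u hu.1 hu.2) i

/-- The first classifying equation for `f = u ^ m`. The exponents `m, m - 1, 0` are distinct exactly
for `m ≠ 0, 1`, which is why `f = u` needs its own treatment. -/
theorem pow_relation (hJ : IsOpen J) (hJ' : J.Nonempty) (hm : PowDomain m J) (h0 : m ≠ 0)
    (h1 : m ≠ 1) {a b c d : ℝ}
    (h : ∀ u ∈ J, (a * u + b) * deriv (fun u : ℝ => u ^ m) u = c + u ^ m * d) :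
    b = 0 ∧ c = 0 ∧ m * a = d := by
  have key := rpow_independent_powDomain hJ hJ' ![m, m - 1, 0] ![m * a - d, m * b, -c]
    (by
      intro i k hik
      fin_cases i <;> fin_cases k <;> simp at hik ⊢
      all_goals first
        | exact absurd hik h0
        | exact absurd hik.symm h0
        | exact absurd (by linarith : m = 1) h1)
    (by
      intro i u hu hu0
      fin_cases i
      · exact hm.rpow_ne_zero hu hu0
      · simp [Real.rpow_sub_one hu0, hu0, hm.rpow_ne_zero hu hu0]
      · simp)
    (fun u hu hu0 => by
      have e := h u hu
      rw [(Real.hasDerivAt_rpow_const (Or.inl hu0)).deriv] at e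
      simp only [Fin.sum_univ_three, Matrix.cons_val_zero, Matrix.cons_val_one, Matrix.cons_val,
        Real.rpow_zero]
      have e2 : u ^ m = u * u ^ (m - 1) := by rw [Real.rpow_sub_one hu0]; field_simp
      rw [e2] at e ⊢
      linear_combination e)
  have k0 := key 0
  have k1 := key 1
  have k2 := key 2
  simp [h0] at k0 k1 k2
  exact ⟨k1, k2, by linarith⟩

theorem nonconstOn_of_deriv_ne_zero {f : ℝ → ℝ} (hJ : IsOpen J) (hu : u ∈ J) (h : deriv f u ≠ 0) :
    NonconstOn f J := by
  by_contra hn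
  have : ∀ v ∈ J, f v = f u := fun v hv => by
    by_contra hne
    exact hn ⟨v, hv, u, hu, hne⟩
  apply h
  rw [deriv_eq_of_eqOn hJ this hu]
  simp

theorem PowDomain.nonconstOn (hJ : IsOpen J) (hJ' : J.Nonempty) (hm : PowDomain m J)
    (h0 : m ≠ 0) : NonconstOn (fun u : ℝ => u ^ m) J := by
  obtain ⟨u, hu, hu0⟩ := (nonempty_diff_zero hJ hJ').2
  refine nonconstOn_of_deriv_ne_zero hJ hu fun h => ?_
  have := hm.mul_deriv hu
  rw [h, mul_zero] at this
  exact (mul_ne_zero h0 (hm.rpow_ne_zero hu hu0)) this.symm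

end Powers

/-! ### Explicit functions of `(t, y)` and their gradients. -/

/-- A smooth function of `(t, y)` with its partial derivatives. -/
structure HasGrad (X Xt Xy : ℝ → ℝ → ℝ) : Prop where
  smooth : ContDiff ℝ ∞ fun q : ℝ × ℝ => X q.1 q.2
  dt : ∀ t y, HasDerivAt (fun s => X s y) (Xt t y) t
  dy : ∀ t y, HasDerivAt (fun s => X t s) (Xy t y) y

/-- A function of `(t, y)` as a function of `(t, x, y, u)`. -/
def liftTY (X : ℝ → ℝ → ℝ) : Pt → ℝ := fun p => X (p 0) (p 2)

section Lift

variable {X Xt Xy : ℝ → ℝ → ℝ}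

theorem HasGrad.contDiff (h : HasGrad X Xt Xy) : ContDiff ℝ ∞ (liftTY X) :=
  h.smooth.comp ((contDiff_apply ℝ ℝ (0 : Fin 4)).prodMk (contDiff_apply ℝ ℝ (2 : Fin 4)))

theorem HasGrad.differentiableAt (h : HasGrad X Xt Xy) (p : Pt) :
    DifferentiableAt ℝ (liftTY X) p :=
  h.contDiff.differentiable (by simp) p

theorem HasGrad.pd_zero (h : HasGrad X Xt Xy) (p : Pt) : pd 0 (liftTY X) p = Xt (p 0) (p 2) :=
  pd_of_hasDerivAt (h.differentiableAt p) (by simpa [liftTY] using h.dt (p 0) (p 2))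

theorem HasGrad.pd_two (h : HasGrad X Xt Xy) (p : Pt) : pd 2 (liftTY X) p = Xy (p 0) (p 2) :=
  pd_of_hasDerivAt (h.differentiableAt p) (by simpa [liftTY] using h.dy (p 0) (p 2))

theorem HasGrad.pd_one (h : HasGrad X Xt Xy) (p : Pt) : pd 1 (liftTY X) p = 0 :=
  pd_of_hasDerivAt (h.differentiableAt p) (by simp [liftTY, hasDerivAt_const])

theorem HasGrad.pd_three (h : HasGrad X Xt Xy) (p : Pt) : pd 3 (liftTY X) p = 0 :=
  pd_of_hasDerivAt (h.differentiableAt p) (by simp [liftTY, hasDerivAt_const])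

theorem HasGrad.add_const (h : HasGrad X Xt Xy) (c : ℝ) : HasGrad (fun t y => X t y + c) Xt Xy :=
  ⟨h.smooth.add contDiff_const, fun t y => (h.dt t y).add_const c,
    fun t y => (h.dy t y).add_const c⟩

end Lift

theorem sum_cons_cons_cons {L : List VField} (A B C : VField) (d : Fin (L.length + 3) → ℝ)
    (p : Pt) :
    ∑ i : Fin (A :: B :: C :: L).length, d i • (A :: B :: C :: L).get i p
      = d 0 • A p + d 1 • B p + d 2 • C p
        + ∑ i : Fin L.length, d i.succ.succ.succ • L.get i p := by
  have := Fin.sum_univ_succ (n := L.length + 2)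
    (fun i : Fin (L.length + 2 + 1) => d i • (A :: B :: C :: L).get i p)
  refine this.trans ?_
  rw [Fin.sum_univ_succ, Fin.sum_univ_succ]
  change d 0 • A p + (d 1 • B p + (d 2 • C p
    + ∑ i : Fin L.length, d i.succ.succ.succ • L.get i p)) = _
  exact ((add_assoc (d 0 • A p + d 1 • B p) (d 2 • C p) _).trans
    (add_assoc (d 0 • A p) (d 1 • B p) _)).symm

/-! ### A criterion for the listed fields to complete the kernel to a basis. -/

section Basis

variable {D : Set (Fin 3 → ℝ)} {J : Set ℝ} {f g : ℝ → ℝ} {L : List VField}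

theorem sum_family_apply (L : List VField) (d : Fin L.length → ℝ) (p : dom D J) :
    (∑ i, d i • family D J L i) p = ∑ i, d i • L.get i p := by
  rw [Finset.sum_apply]
  rfl

/-- If the linear combinations of the fields in `L` are given by explicit functions of `(t, y)`
that solve the determining equations, exhaust their solutions up to the kernel fields, and vanish
only trivially, then the fields in `L` complete the kernel fields to a basis of the maximal
invariance algebra. -/
theorem basis_of_solutions (hD : IsOpen D) (hD' : IsConnected D) (hJ : IsOpen J)
    (hJ' : IsConnected J) (hf : ContDiffOn ℝ ∞ f J) (hc : NonconstOn f J)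
    (l : (Fin L.length → ℝ) → ℝ)
    {X Xt Xy N Nt Ny M Mt My : (Fin L.length → ℝ) → ℝ → ℝ → ℝ}
    (hX : ∀ c, HasGrad (X c) (Xt c) (Xy c)) (hN : ∀ c, HasGrad (N c) (Nt c) (Ny c))
    (hM : ∀ c, HasGrad (M c) (Mt c) (My c))
    (hL : ∀ c p, ∑ i, c i • L.get i p =
      ![l c * p 0, l c / 2 * p 1, X c (p 0) (p 2), N c (p 0) (p 2) * p 3 + M c (p 0) (p 2)])
    (hA : ∀ c t y, ∀ u ∈ J,
      (N c t y * u + M c t y) * deriv f u = Xt c t y + f u * (Xy c t y - l c))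
    (hB : ∀ c t y, ∀ u ∈ J, Nt c t y * u + Mt c t y + f u * (Ny c t y * u + My c t y)
      + g u * (N c t y - l c) - (N c t y * u + M c t y) * deriv g u = 0)
    (hind : ∀ c, l c = 0 → ∀ t y, Xt c t y = 0 → Xy c t y = 0 → N c t y = 0 → M c t y = 0 → c = 0)
    (hsol : ∀ k χ η₁ η₀, ReducedSymmetry (dom D J) J f g k χ η₁ η₀ → ∃ c, k = l c ∧
      ∀ p ∈ dom D J, pd 0 χ p = Xt c (p 0) (p 2) ∧ pd 2 χ p = Xy c (p 0) (p 2) ∧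
        η₁ p = N c (p 0) (p 2) ∧ η₀ p = M c (p 0) (p 2)) :
    LinearIndependent ℝ (family D J (kerFields ++ L)) ∧
      maxAlgebra D J f g = (spanOn D J (kerFields ++ L) : Set (dom D J → Fin 4 → ℝ)) := by
  have hU : IsOpen (dom D J) := isOpen_dom hD hJ
  have hU' : IsConnected (dom D J) := isConnected_dom hD' hJ'
  have hsum : ∀ (d : Fin (L.length + 3) → ℝ) (p : Pt),
      ∑ i : Fin (kerFields ++ L).length, d i • (kerFields ++ L).get i p =
        ![l (fun i => d i.succ.succ.succ) * p 0 + d 0,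
          l (fun i => d i.succ.succ.succ) / 2 * p 1 + d 1,
          X (fun i => d i.succ.succ.succ) (p 0) (p 2) + d 2,
          N (fun i => d i.succ.succ.succ) (p 0) (p 2) * p 3
            + M (fun i => d i.succ.succ.succ) (p 0) (p 2)] := fun d p => by
    refine (sum_cons_cons_cons _ _ _ d p).trans ?_
    rw [hL]
    ext i
    fin_cases i <;> simp [vf] <;> ring
  refine ⟨Fintype.linearIndependent_iff.2 fun d hd => ?_, Set.Subset.antisymm ?_ ?_⟩
  · obtain ⟨c, hcdef⟩ : ∃ c : Fin L.length → ℝ, c = fun i => d (Fin.succ (Fin.succ (Fin.succ i))) :=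
      ⟨_, rfl⟩
    have hz : ∀ p ∈ dom D J, (0 : Fin 4 → ℝ) =
        ![l c * p 0 + d (0 : Fin (L.length + 3)), l c / 2 * p 1 + d (1 : Fin (L.length + 3)),
          X c (p 0) (p 2) + d (2 : Fin (L.length + 3)),
          N c (p 0) (p 2) * p 3 + M c (p 0) (p 2)] := fun p hp => by
      rw [hcdef]
      exact ((sum_family_apply (D := D) (J := J) _ d ⟨p, hp⟩).symm.trans
        (congrFun hd ⟨p, hp⟩)).symm.trans (hsum d p)
    have z0 : ∀ p ∈ dom D J, l c * p 0 + d (0 : Fin (L.length + 3)) = 0 := fun p hp =>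
      (congrFun (hz p hp) 0).symm
    have z1 : ∀ p ∈ dom D J, l c / 2 * p 1 + d (1 : Fin (L.length + 3)) = 0 := fun p hp =>
      (congrFun (hz p hp) 1).symm
    have z2 : ∀ p ∈ dom D J, X c (p 0) (p 2) + d (2 : Fin (L.length + 3)) = 0 := fun p hp =>
      (congrFun (hz p hp) 2).symm
    have z3 : ∀ p ∈ dom D J, N c (p 0) (p 2) * p 3 + M c (p 0) (p 2) = 0 := fun p hp =>
      (congrFun (hz p hp) 3).symm
    obtain ⟨p, hp⟩ := hU'.nonempty
    have hl : l c = 0 := by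
      have h1 := pd_eq_zero hU z0 hp 0
      have h2 := pd_comp_coord (p := p) 0 0 (((hasDerivAt_id (p 0)).const_mul (l c)).add_const
        (d (0 : Fin (L.length + 3))))
      simp only [id] at h2
      rw [h1] at h2
      simpa using h2.symm
    have hXz : ∀ i, pd i (liftTY (X c)) p = 0 :=
      pd_eq_zero hU (c := -d (2 : Fin (L.length + 3))) (fun q hq => by
        have := z2 q hq
        simp only [liftTY]; linarith) hp
    have hNM : ∀ u ∈ J, N c (p 0) (p 2) * u + M c (p 0) (p 2) = 0 := fun u hu => by
      simpa using z3 _ (update_mem_dom hp hu)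
    obtain ⟨hN0, hM0⟩ := affine_eq_zero hJ hJ'.nonempty hNM
    have hc0 : c = 0 := hind c hl (p 0) (p 2) (by rw [← (hX c).pd_zero, hXz])
      (by rw [← (hX c).pd_two, hXz]) hN0 hM0
    have hd0 := z0 p hp
    have hd1 := z1 p hp
    rw [hl] at hd0 hd1
    have hd2 : d (2 : Fin (L.length + 3)) = 0 := by
      have h1 := hL c p
      have h2 := congrFun h1 2
      rw [hc0] at h2
      have h3 := z2 p hp
      rw [hc0] at h3
      simp at h2
      linarith
    intro i
    change Fin (L.length + 3) at i
    refine Fin.cases ?_ (fun i => ?_) i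
    · simpa using hd0
    refine Fin.cases ?_ (fun i => ?_) i
    · simpa using hd1
    refine Fin.cases ?_ (fun i => ?_) i
    · exact hd2
    · exact (congrFun hcdef i).symm.trans (congrFun hc0 i)
  · rintro W ⟨V, hV, rfl⟩
    obtain ⟨k, c₀, c₁, χ, η₁, η₀, hred, hform⟩ :=
      hV.exists_reducedSymmetry hD hD' hJ hJ' hf hc
    obtain ⟨c, rfl, hcs⟩ := hsol k χ η₁ η₀ hred
    -- Only the gradient of `χ` is prescribed by `hsol`; the constant left over is the coefficient
    -- of `∂_y`.
    obtain ⟨c₂, hc₂⟩ := exists_const_of_pd_eq_zero (F := fun p => χ p - liftTY (X c) p) hU hU'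
      (fun p hp => ((differentiableAt_of_smoothOn hU hred.smooth_χ hp).sub
        ((hX c).differentiableAt p)).differentiableWithinAt) (fun i p hp => by
        rw [pd_sub i (differentiableAt_of_smoothOn hU hred.smooth_χ hp) ((hX c).differentiableAt p)]
        fin_cases i
        · simp [(hX c).pd_zero, (hcs p hp).1]
        · simp [(hX c).pd_one, hred.χ_x p hp]
        · simp [(hX c).pd_two, (hcs p hp).2.1]
        · simp [(hX c).pd_three, hred.χ_u p hp])
    refine (Submodule.mem_span_range_iff_exists_fun ℝ).2
      ⟨(Fin.cons c₀ (Fin.cons c₁ (Fin.cons c₂ c)) : Fin (L.length + 3) → ℝ), ?_⟩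
    funext p
    refine (sum_family_apply (kerFields ++ L) _ p).trans ?_
    refine (hsum _ _).trans ?_
    have h3 := (hcs p p.2).2.2
    have h2 := hc₂ p p.2
    simp only [liftTY] at h2
    refine Eq.trans ?_ (hform p p.2).symm
    simp only [Fin.cons_succ]
    have h4 : χ p = X c ((p : Pt) 0) ((p : Pt) 2) + c₂ := by linarith
    rw [h3.1, h3.2, h4]
    rfl
  · intro W hW
    obtain ⟨d, rfl⟩ := (Submodule.mem_span_range_iff_exists_fun ℝ).1 hW
    refine ⟨fun p => ∑ i, d i • (kerFields ++ L).get i p, ?_, ?_⟩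
    · obtain ⟨c, hcdef⟩ : ∃ c : Fin L.length → ℝ,
        c = fun i => d (Fin.succ (Fin.succ (Fin.succ i))) := ⟨_, rfl⟩
      have hX' := (hX c).add_const (d (2 : Fin (L.length + 3)))
      refine ReducedSymmetry.isLieSymmetry hD hJ (l := l c) (c₀ := d (0 : Fin (L.length + 3)))
        (c₁ := d (1 : Fin (L.length + 3))) (χ := liftTY _) (η₁ := liftTY (N c))
        (η₀ := liftTY (M c))
        ⟨hX'.contDiff.contDiffOn, (hN c).contDiff.contDiffOn, (hM c).contDiff.contDiffOn,
          fun p _ => hX'.pd_one p, fun p _ => hX'.pd_three p, fun p _ => (hN c).pd_one p,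
          fun p _ => (hN c).pd_three p, fun p _ => (hM c).pd_one p, fun p _ => (hM c).pd_three p,
          fun p _ u hu => ?_, fun p _ u hu => ?_⟩ (fun p hp => ?_)
      · rw [hX'.pd_zero, hX'.pd_two]
        exact hA c (p 0) (p 2) u hu
      · rw [(hN c).pd_zero, (hN c).pd_two, (hM c).pd_zero, (hM c).pd_two]
        exact hB c (p 0) (p 2) u hu
      · rw [hcdef]
        exact hsum d p
    · funext p
      rw [sum_family_apply]
      rfl

end Basis

/-! ### Integration of functions with zero `x`- and `u`-derivatives. -/

section Planar

variable {U : Set Pt} {F : Pt → ℝ}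

/-- A smooth function with vanishing derivatives in `x` and `u`. -/
structure Planar (U : Set Pt) (F : Pt → ℝ) : Prop where
  smooth : ContDiffOn ℝ ∞ F U
  dx : ∀ p ∈ U, pd 1 F p = 0
  du : ∀ p ∈ U, pd 3 F p = 0

theorem Planar.differentiableAt (hU : IsOpen U) (h : Planar U F) {p : Pt} (hp : p ∈ U) :
    DifferentiableAt ℝ F p :=
  differentiableAt_of_smoothOn hU h.smooth hp

theorem Planar.pd (hU : IsOpen U) (h : Planar U F) (i : Fin 4) : Planar U (pd i F) :=
  ⟨smoothOn_pd hU h.smooth i, fun p hp => by rw [pd_comm hU h.smooth hp, pd_eq_zero hU h.dx hp],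
    fun p hp => by rw [pd_comm hU h.smooth hp, pd_eq_zero hU h.du hp]⟩

theorem Planar.add (hU : IsOpen U) {G : Pt → ℝ} (h : Planar U F) (h' : Planar U G) :
    Planar U fun p => F p + G p :=
  ⟨h.smooth.add h'.smooth,
    fun p hp => by
      rw [pd_add 1 (h.differentiableAt hU hp) (h'.differentiableAt hU hp), h.dx p hp, h'.dx p hp,
        add_zero],
    fun p hp => by
      rw [pd_add 3 (h.differentiableAt hU hp) (h'.differentiableAt hU hp), h.du p hp, h'.du p hp,
        add_zero]⟩

theorem Planar.mul (hU : IsOpen U) {G : Pt → ℝ} (h : Planar U F) (h' : Planar U G) :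
    Planar U fun p => F p * G p :=
  ⟨h.smooth.mul h'.smooth,
    fun p hp => by
      rw [pd_mul 1 (h.differentiableAt hU hp) (h'.differentiableAt hU hp), h.dx p hp, h'.dx p hp]
      ring,
    fun p hp => by
      rw [pd_mul 3 (h.differentiableAt hU hp) (h'.differentiableAt hU hp), h.du p hp, h'.du p hp]
      ring⟩

theorem planar_const (U : Set Pt) (c : ℝ) : Planar U fun _ => c :=
  ⟨contDiffOn_const, fun _ _ => dirDeriv_const c, fun _ _ => dirDeriv_const c⟩

theorem planar_lift (U : Set Pt) {X Xt Xy : ℝ → ℝ → ℝ} (h : HasGrad X Xt Xy) :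
    Planar U (liftTY X) :=
  ⟨h.contDiff.contDiffOn, fun p _ => h.pd_one p, fun p _ => h.pd_three p⟩

/-- Since sections of `D` may be disconnected, a planar function need not be a function of `(t, y)`
globally. All integrations therefore go through a vanishing gradient on the connected set `U`. -/
theorem Planar.exists_const (hU : IsOpen U) (hU' : IsConnected U) (h : Planar U F)
    (h0 : ∀ p ∈ U, Kolmogorov.pd 0 F p = 0) (h2 : ∀ p ∈ U, Kolmogorov.pd 2 F p = 0) :
    ∃ c, ∀ p ∈ U, F p = c :=
  exists_const_of_pd_eq_zero hU hU' (h.smooth.differentiableOn (by simp)) fun i p hp => by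
    fin_cases i
    exacts [h0 p hp, h.dx p hp, h2 p hp, h.du p hp]

theorem Planar.exists_affine_t (hU : IsOpen U) (hU' : IsConnected U) (h : Planar U F) {c : ℝ}
    (h0 : ∀ p ∈ U, Kolmogorov.pd 0 F p = c) (h2 : ∀ p ∈ U, Kolmogorov.pd 2 F p = 0) :
    ∃ d, ∀ p ∈ U, F p = c * p 0 + d :=
  exists_affine_of_pd hU hU' h.smooth 0 c fun i p hp => by
    fin_cases i
    exacts [by simpa using h0 p hp, by simpa using h.dx p hp, by simpa using h2 p hp,
      by simpa using h.du p hp]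

theorem Planar.exists_exp_t (hU : IsOpen U) (hU' : IsConnected U) (h : Planar U F) {c : ℝ}
    (h0 : ∀ p ∈ U, Kolmogorov.pd 0 F p = c * F p) (h2 : ∀ p ∈ U, Kolmogorov.pd 2 F p = 0) :
    ∃ d, ∀ p ∈ U, F p = d * Real.exp (c * p 0) :=
  exists_exp_of_pd hU hU' h.smooth 0 c fun i p hp => by
    fin_cases i
    exacts [by simpa using h0 p hp, by simpa using h.dx p hp, by simpa using h2 p hp,
      by simpa using h.du p hp]

theorem Planar.exists_exp_y (hU : IsOpen U) (hU' : IsConnected U) (h : Planar U F) {c : ℝ}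
    (h0 : ∀ p ∈ U, Kolmogorov.pd 0 F p = 0) (h2 : ∀ p ∈ U, Kolmogorov.pd 2 F p = c * F p) :
    ∃ d, ∀ p ∈ U, F p = d * Real.exp (c * p 2) :=
  exists_exp_of_pd hU hU' h.smooth 2 c fun i p hp => by
    fin_cases i
    exacts [by simpa using h0 p hp, by simpa using h.dx p hp, by simpa using h2 p hp,
      by simpa using h.du p hp]

end Planar

/-! ### Rules for computing gradients in `(t, y)`. -/

section HasGradRules

theorem HasGrad.const (c : ℝ) : HasGrad (fun _ _ => c) (fun _ _ => 0) (fun _ _ => 0) :=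
  ⟨contDiff_const, fun t _ => hasDerivAt_const t c, fun _ y => hasDerivAt_const y c⟩

theorem HasGrad.ofT {h h' : ℝ → ℝ} (hs : ContDiff ℝ ∞ h) (hd : ∀ t, HasDerivAt h (h' t) t) :
    HasGrad (fun t _ => h t) (fun t _ => h' t) (fun _ _ => 0) :=
  ⟨hs.comp contDiff_fst, fun t _ => hd t, fun t y => hasDerivAt_const y (h t)⟩

theorem HasGrad.ofY {h h' : ℝ → ℝ} (hs : ContDiff ℝ ∞ h) (hd : ∀ t, HasDerivAt h (h' t) t) :
    HasGrad (fun _ y => h y) (fun _ _ => 0) (fun _ y => h' y) :=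
  ⟨hs.comp contDiff_snd, fun t y => hasDerivAt_const t (h y), fun _ y => hd y⟩

theorem HasGrad.t : HasGrad (fun t _ => t) (fun _ _ => 1) (fun _ _ => 0) :=
  HasGrad.ofT contDiff_id hasDerivAt_id

theorem HasGrad.y : HasGrad (fun _ y => y) (fun _ _ => 0) (fun _ _ => 1) :=
  HasGrad.ofY contDiff_id hasDerivAt_id

theorem hasDerivAt_exp_mul (c s : ℝ) :
    HasDerivAt (fun s => Real.exp (c * s)) (c * Real.exp (c * s)) s :=
  (((hasDerivAt_id s).const_mul c).exp).congr_deriv (by simp; ring)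

theorem contDiff_exp_mul (c : ℝ) : ContDiff ℝ ∞ fun s => Real.exp (c * s) :=
  Real.contDiff_exp.comp (contDiff_const.mul contDiff_id)

theorem HasGrad.expT (c : ℝ) : HasGrad (fun t _ => Real.exp (c * t))
    (fun t _ => c * Real.exp (c * t)) (fun _ _ => 0) :=
  HasGrad.ofT (contDiff_exp_mul c) (hasDerivAt_exp_mul c)

theorem HasGrad.expY (c : ℝ) : HasGrad (fun _ y => Real.exp (c * y))
    (fun _ _ => 0) (fun _ y => c * Real.exp (c * y)) :=
  HasGrad.ofY (contDiff_exp_mul c) (hasDerivAt_exp_mul c)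

variable {X Xt Xy Y Yt Yy : ℝ → ℝ → ℝ}

theorem HasGrad.add (h : HasGrad X Xt Xy) (h' : HasGrad Y Yt Yy) :
    HasGrad (fun t y => X t y + Y t y) (fun t y => Xt t y + Yt t y)
      (fun t y => Xy t y + Yy t y) :=
  ⟨h.smooth.add h'.smooth, fun t y => (h.dt t y).add (h'.dt t y),
    fun t y => (h.dy t y).add (h'.dy t y)⟩

theorem HasGrad.mul (h : HasGrad X Xt Xy) (h' : HasGrad Y Yt Yy) :
    HasGrad (fun t y => X t y * Y t y) (fun t y => Xt t y * Y t y + X t y * Yt t y)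
      (fun t y => Xy t y * Y t y + X t y * Yy t y) :=
  ⟨h.smooth.mul h'.smooth, fun t y => (h.dt t y).mul (h'.dt t y),
    fun t y => (h.dy t y).mul (h'.dy t y)⟩

theorem HasGrad.smul (c : ℝ) (h : HasGrad X Xt Xy) :
    HasGrad (fun t y => c * X t y) (fun t y => c * Xt t y) (fun t y => c * Xy t y) :=
  ⟨contDiff_const.mul h.smooth, fun t y => (h.dt t y).const_mul c,
    fun t y => (h.dy t y).const_mul c⟩

end HasGradRules

/-! ### The classifying equations for each normal form of `f`. -/

section Cases

variable {U : Set Pt} {J : Set ℝ} {f g : ℝ → ℝ} {l : ℝ} {χ η₁ η₀ : Pt → ℝ}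

theorem ReducedSymmetry.planar_χ (R : ReducedSymmetry U J f g l χ η₁ η₀) : Planar U χ :=
  ⟨R.smooth_χ, R.χ_x, R.χ_u⟩

theorem ReducedSymmetry.planar_η₁ (R : ReducedSymmetry U J f g l χ η₁ η₀) : Planar U η₁ :=
  ⟨R.smooth_η₁, R.η₁_x, R.η₁_u⟩

theorem ReducedSymmetry.planar_η₀ (R : ReducedSymmetry U J f g l χ η₁ η₀) : Planar U η₀ :=
  ⟨R.smooth_η₀, R.η₀_x, R.η₀_u⟩

/-- The first equation gives `η₁ = χ_t = 0` and expresses `η₀` by `χ_y`; hence `η₀_t = χ_yt = 0`,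
and the second equation loses most of its terms. -/
theorem ReducedSymmetry.exp_case (hU : IsOpen U) (hJ : IsOpen J) (hJ' : J.Nonempty)
    (R : ReducedSymmetry U J Real.exp g l χ η₁ η₀) :
    (∀ p ∈ U, η₁ p = 0) ∧ (∀ p ∈ U, pd 0 χ p = 0) ∧ (∀ p ∈ U, η₀ p = pd 2 χ p - l) ∧
      (∀ p ∈ U, pd 0 η₀ p = 0) ∧ (∀ p ∈ U, pd 2 η₀ p = pd 2 (pd 2 χ) p) ∧
      ∀ p ∈ U, ∀ u ∈ J, Real.exp u * pd 2 η₀ p - g u * l - η₀ p * deriv g u = 0 := by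
  have h : ∀ p ∈ U, η₁ p = 0 ∧ pd 0 χ p = 0 ∧ η₀ p = pd 2 χ p - l := fun p hp =>
    exp_relation hJ hJ' fun u hu => by simpa using R.eq_f p hp u hu
  have hd : ∀ i, ∀ p ∈ U, pd i η₀ p = pd i (pd 2 χ) p := fun i p hp => by
    rw [pd_congr hU (fun q hq => (h q hq).2.2) hp i,
      pd_sub i ((R.planar_χ.pd hU 2).differentiableAt hU hp) (differentiableAt_const l),
      pd_eq_zero hU (c := l) (fun _ _ => rfl) hp, sub_zero]
  have h0 : ∀ p ∈ U, pd 0 η₀ p = 0 := fun p hp => by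
    rw [hd 0 p hp, pd_comm hU R.smooth_χ hp, pd_eq_zero hU (fun q hq => (h q hq).2.1) hp]
  refine ⟨fun p hp => (h p hp).1, fun p hp => (h p hp).2.1, fun p hp => (h p hp).2.2, h0, hd 2,
    fun p hp u hu => ?_⟩
  have e := R.eq_g p hp u hu
  rw [(h p hp).1, h0 p hp, pd_eq_zero hU (fun q hq => (h q hq).1) hp,
    pd_eq_zero hU (fun q hq => (h q hq).1) hp] at e
  linear_combination e

/-- Compared with the exponential the roles of `t` and `y` are exchanged: now `χ_y` is constant and
`η₁ = χ_t`, so `η₁_y = 0`. -/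
theorem ReducedSymmetry.log_case (hU : IsOpen U) (hJ : IsOpen J) (hJ' : J.Nonempty)
    (hpos : J ⊆ Set.Ioi 0) (R : ReducedSymmetry U J Real.log g l χ η₁ η₀) :
    (∀ p ∈ U, η₀ p = 0) ∧ (∀ p ∈ U, η₁ p = pd 0 χ p) ∧ (∀ p ∈ U, pd 2 χ p = l) ∧
      (∀ p ∈ U, pd 2 η₁ p = 0) ∧
      ∀ p ∈ U, ∀ u ∈ J, pd 0 η₁ p * u + g u * (η₁ p - l) - η₁ p * (u * deriv g u) = 0 := by
  have h : ∀ p ∈ U, η₀ p = 0 ∧ η₁ p = pd 0 χ p ∧ pd 2 χ p - l = 0 := fun p hp =>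
    log_relation hJ hJ' hpos fun u hu => by
      have e := R.eq_f p hp u hu
      have hu0 : u ≠ 0 := (hpos hu).ne'
      rw [Real.deriv_log] at e
      field_simp at e
      linear_combination e
  have h2 : ∀ p ∈ U, pd 2 η₁ p = 0 := fun p hp => by
    rw [pd_congr hU (fun q hq => (h q hq).2.1) hp, pd_comm hU R.smooth_χ hp,
      pd_eq_zero hU (fun q hq => sub_eq_zero.1 (h q hq).2.2) hp]
  refine ⟨fun p hp => (h p hp).1, fun p hp => (h p hp).2.1, fun p hp => sub_eq_zero.1 (h p hp).2.2,
    h2, fun p hp u hu => ?_⟩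
  have e := R.eq_g p hp u hu
  rw [(h p hp).1, h2 p hp, pd_eq_zero hU (fun q hq => (h q hq).1) hp,
    pd_eq_zero hU (fun q hq => (h q hq).1) hp] at e
  linear_combination e

/-- As for the exponential, with `m η₁` in the role of `η₀`. -/
theorem ReducedSymmetry.pow_case (hU : IsOpen U) (hJ : IsOpen J) (hJ' : J.Nonempty) {m : ℝ}
    (hm : PowDomain m J) (hm0 : m ≠ 0) (hm1 : m ≠ 1)
    (R : ReducedSymmetry U J (fun u => u ^ m) g l χ η₁ η₀) :
    (∀ p ∈ U, η₀ p = 0) ∧ (∀ p ∈ U, pd 0 χ p = 0) ∧ (∀ p ∈ U, m * η₁ p = pd 2 χ p - l) ∧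
      (∀ p ∈ U, pd 0 η₁ p = 0) ∧
      ∀ p ∈ U, ∀ u ∈ J,
        pd 2 η₁ p * u ^ (m + 1) + g u * (η₁ p - l) - η₁ p * (u * deriv g u) = 0 := by
  have h : ∀ p ∈ U, η₀ p = 0 ∧ pd 0 χ p = 0 ∧ m * η₁ p = pd 2 χ p - l := fun p hp =>
    pow_relation hJ hJ' hm hm0 hm1 fun u hu => R.eq_f p hp u hu
  have h0 : ∀ p ∈ U, pd 0 η₁ p = 0 := fun p hp => by
    have e := pd_congr hU (fun q hq => (h q hq).2.2) hp 0
    rw [pd_const_mul 0 m (R.planar_η₁.differentiableAt hU hp),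
      pd_sub 0 ((R.planar_χ.pd hU 2).differentiableAt hU hp) (differentiableAt_const l),
      pd_eq_zero hU (c := l) (fun _ _ => rfl) hp, pd_comm hU R.smooth_χ hp,
      pd_eq_zero hU (fun q hq => (h q hq).2.1) hp, sub_zero] at e
    exact (mul_eq_zero.1 e).resolve_left hm0
  refine ⟨fun p hp => (h p hp).1, fun p hp => (h p hp).2.1, fun p hp => (h p hp).2.2, h0,
    fun p hp u hu => ?_⟩
  have e := R.eq_g p hp u hu
  rw [(h p hp).1, h0 p hp, pd_eq_zero hU (fun q hq => (h q hq).1) hp,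
    pd_eq_zero hU (fun q hq => (h q hq).1) hp] at e
  rw [hm.rpow_add_one hu]
  linear_combination e

/-- For `f = u` the first equation only says that `(η₀, η₁ + l)` is the gradient of `χ`. Both
coefficients of `η` survive, linked by the equality of the mixed derivatives of `χ`. -/
theorem ReducedSymmetry.id_case (hU : IsOpen U) (hJ : IsOpen J) (hJ' : J.Nonempty)
    (R : ReducedSymmetry U J (fun u => u) g l χ η₁ η₀) :
    (∀ p ∈ U, pd 0 χ p = η₀ p) ∧ (∀ p ∈ U, pd 2 χ p = η₁ p + l) ∧
      (∀ p ∈ U, pd 2 η₀ p = pd 0 η₁ p) ∧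
      ∀ p ∈ U, ∀ u ∈ J, pd 2 η₁ p * u ^ 2 + 2 * pd 0 η₁ p * u + pd 0 η₀ p + g u * (η₁ p - l)
        - (η₁ p * u + η₀ p) * deriv g u = 0 := by
  have h : ∀ p ∈ U, η₁ p - (pd 2 χ p - l) = 0 ∧ η₀ p - pd 0 χ p = 0 := fun p hp =>
    affine_eq_zero hJ hJ' fun u hu => by
      have e := R.eq_f p hp u hu
      rw [deriv_id''] at e
      linear_combination e
  have hA : ∀ p ∈ U, pd 0 χ p = η₀ p := fun p hp => by linarith [(h p hp).2]
  have hB : ∀ p ∈ U, pd 2 χ p = η₁ p + l := fun p hp => by linarith [(h p hp).1]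
  have hC : ∀ p ∈ U, pd 2 η₀ p = pd 0 η₁ p := fun p hp => by
    have e1 := pd_congr hU hA hp 2
    have e2 := pd_congr hU hB hp 0
    rw [pd_add 0 (R.planar_η₁.differentiableAt hU hp) (differentiableAt_const l),
      pd_eq_zero hU (c := l) (fun _ _ => rfl) hp, add_zero] at e2
    rw [← e1, ← e2, pd_comm hU R.smooth_χ hp]
  refine ⟨hA, hB, hC, fun p hp u hu => ?_⟩
  have e := R.eq_g p hp u hu
  rw [hC p hp] at e
  linear_combination e

/-- The second equation is now quadratic in `u`. Its three coefficients and the integrability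
condition form a linear first order system for `(η₁, η₀)` with constant coefficients. -/
theorem ReducedSymmetry.quadratic_case (hU : IsOpen U) (hJ : IsOpen J) (hJ' : J.Nonempty)
    {a b c : ℝ} (hg : ∀ u, g u = a * u ^ 2 + b * u + c)
    (R : ReducedSymmetry U J (fun u => u) g l χ η₁ η₀) :
    (∀ p ∈ U, pd 2 η₁ p = a * (η₁ p + l)) ∧ (∀ p ∈ U, 2 * pd 0 η₁ p = b * l + 2 * a * η₀ p) ∧
      (∀ p ∈ U, pd 0 η₀ p = b * η₀ p - c * (η₁ p - l)) ∧
      (∀ p ∈ U, pd 2 η₀ p = pd 0 η₁ p) := by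
  obtain ⟨-, -, hC, hE⟩ := R.id_case hU hJ hJ'
  have hg' : ∀ u, deriv g u = 2 * a * u + b := fun u => by
    rw [show g = fun u => a * u ^ 2 + b * u + c from funext hg]
    have := ((((hasDerivAt_id u).pow 2).const_mul a).add
      ((hasDerivAt_id u).const_mul b)).add_const c
    refine (this.congr_deriv ?_).deriv
    simp; ring
  have key : ∀ p ∈ U, _ := fun p hp => quadratic_eq_zero hJ hJ'
    (a := pd 2 η₁ p - a * (η₁ p + l)) (b := 2 * pd 0 η₁ p - (b * l + 2 * a * η₀ p))
    (c := pd 0 η₀ p - (b * η₀ p - c * (η₁ p - l))) fun u hu => by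
      have e := hE p hp u hu
      rw [hg, hg'] at e
      linear_combination e
  exact ⟨fun p hp => sub_eq_zero.1 (key p hp).1, fun p hp => sub_eq_zero.1 (key p hp).2.1,
    fun p hp => sub_eq_zero.1 (key p hp).2.2, hC⟩

/-- Two differentiations reduce the polynomial to a constant, and `exp_relation` applies. -/
theorem exp_quadratic_relation (hJ : IsOpen J) (hJ' : J.Nonempty) {a b α β γ : ℝ}
    (h : ∀ u ∈ J, (a * u + b) * Real.exp u + (α * u ^ 2 + β * u + γ) = 0) : a = 0 ∧ b = 0 := by
  have h1 : ∀ u ∈ J, (a * u + b + a) * Real.exp u + (2 * α * u + β) = 0 := fun u hu =>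
    hasDerivAt_eq_zero hJ h hu (((((((hasDerivAt_id u).const_mul a).add_const b).mul
      (Real.hasDerivAt_exp u)).add (((((hasDerivAt_id u).pow 2).const_mul α).add
      ((hasDerivAt_id u).const_mul β)).add_const γ))).congr_deriv (by simp; ring))
  have h2 : ∀ u ∈ J, (a * u + b + a + a) * Real.exp u + 2 * α = 0 := fun u hu =>
    hasDerivAt_eq_zero hJ h1 hu ((((((((hasDerivAt_id u).const_mul a).add_const b).add_const a).mul
      (Real.hasDerivAt_exp u)).add
      (((hasDerivAt_id u).const_mul (2 * α)).add_const β))).congr_deriv (by simp; ring))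
  obtain ⟨ha, -, hb⟩ := exp_relation (a := a) (b := b + a + a) (c := -(2 * α)) (d := 0) hJ hJ'
    fun u hu => by linear_combination h2 u hu
  exact ⟨ha, by rw [ha] at hb; linarith⟩

end Cases

/-! ### The basis property and elementary facts about signs, `exp` and `log`. -/

/-- The fields in `L` complete the kernel fields to a basis of the maximal invariance algebra. -/
def CompletesBasis (D : Set (Fin 3 → ℝ)) (J : Set ℝ) (f g : ℝ → ℝ) (L : List VField) : Prop :=
  LinearIndependent ℝ (family D J (kerFields ++ L)) ∧
    maxAlgebra D J f g = (spanOn D J (kerFields ++ L) : Set (dom D J → Fin 4 → ℝ))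

theorem IsSign.ne_zero {ε : ℝ} (h : IsSign ε) : ε ≠ 0 := by
  rcases h with rfl | rfl <;> norm_num

theorem IsSign.mul_self {ε : ℝ} (h : IsSign ε) : ε * ε = 1 := by
  rcases h with rfl | rfl <;> norm_num

theorem exp_nonconstOn {J : Set ℝ} (hJ : IsOpen J) (hJ' : J.Nonempty) : NonconstOn Real.exp J := by
  obtain ⟨u, hu⟩ := hJ'
  exact nonconstOn_of_deriv_ne_zero hJ hu (by rw [Real.deriv_exp]; exact Real.exp_ne_zero u)

theorem log_nonconstOn {J : Set ℝ} (hJ : IsOpen J) (hJ' : J.Nonempty) (hpos : J ⊆ Set.Ioi 0) :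
    NonconstOn Real.log J := by
  obtain ⟨u, hu⟩ := hJ'
  exact nonconstOn_of_deriv_ne_zero hJ hu (by rw [Real.deriv_log]; exact inv_ne_zero (hpos hu).ne')

theorem log_contDiffOn {J : Set ℝ} (hpos : J ⊆ Set.Ioi 0) : ContDiffOn ℝ ∞ Real.log J :=
  fun _ hu => (Real.contDiffAt_log.2 (hpos hu).ne').contDiffWithinAt

theorem deriv_exp_mul (c s : ℝ) :
    deriv (fun s => Real.exp (c * s)) s = c * Real.exp (c * s) :=
  (hasDerivAt_exp_mul c s).deriv

/-! ### Bases for `f = exp`. -/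

section ExpRows

variable {D : Set (Fin 3 → ℝ)} {J : Set ℝ}

theorem completesBasis_exp_expMul (hD : IsOpen D) (hD' : IsConnected D) (hJ : IsOpen J)
    (hJ' : IsConnected J) {ε m : ℝ} (hε : IsSign ε) (h0 : m ≠ 0) (h1 : m ≠ 1) :
    CompletesBasis D J Real.exp (fun u => ε * Real.exp (m * u))
      [vf fun t x y _ => ![t, x / 2, (m - 1) / m * y, -(1 / m)]] := by
  refine basis_of_solutions hD hD' hJ hJ' Real.contDiff_exp.contDiffOn
    (exp_nonconstOn hJ hJ'.nonempty) (fun c => c 0)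
    (fun c => HasGrad.y.smul (c 0 * ((m - 1) / m))) (fun c => HasGrad.const 0)
    (fun c => HasGrad.const (-(c 0 / m))) (fun c p => ?_) (fun c t y u hu => ?_)
    (fun c t y u hu => ?_) (fun c hl t y h1 h2 h3 h4 => ?_) (fun k χ η₁ η₀ R => ?_)
  · ext i; fin_cases i <;> simp [vf] <;> ring
  · rw [Real.deriv_exp]; field_simp; ring
  · rw [deriv_const_mul_field, deriv_exp_mul]; field_simp; ring
  · ext i; fin_cases i; exact hl
  · obtain ⟨hη₁, hχ₀, hη₀, -, -, hE⟩ :=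
      R.exp_case (isOpen_dom hD hJ) hJ hJ'.nonempty
    -- Since `m ≠ 1`, the functions `e^u` and `e^(m u)` are independent; the relation sought is the
    -- coefficient of `e^(m u)`.
    have key : ∀ p ∈ dom D J, m * η₀ p = -k := fun p hp => by
      have := exp_independent hJ hJ'.nonempty ![1, m] ![pd 2 η₀ p, -(ε * (k + m * η₀ p))]
        (by
          intro i j hij
          fin_cases i <;> fin_cases j <;> simp at hij ⊢
          · exact h1 hij.symm
          · exact h1 hij)
        (fun u hu => by
          have := hE p hp u hu
          rw [deriv_const_mul_field, deriv_exp_mul] at this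
          simp
          linear_combination this) 1
      simp [hε.ne_zero] at this
      linarith
    refine ⟨fun _ => k, rfl, fun p hp => ⟨?_, ?_, ?_, ?_⟩⟩
    · simpa using hχ₀ p hp
    · field_simp
      linear_combination key p hp - m * hη₀ p hp
    · exact hη₁ p hp
    · field_simp
      linarith [key p hp]

theorem completesBasis_exp_exp_add (hD : IsOpen D) (hD' : IsConnected D) (hJ : IsOpen J)
    (hJ' : IsConnected J) {ε₁ ε₂ : ℝ} (hε₁ : IsSign ε₁) (hε₂ : IsSign ε₂) :
    CompletesBasis D J Real.exp (fun u => ε₁ * Real.exp u + ε₂)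
      [vf fun _ _ y _ => ![0, 0, Real.exp (ε₁ * y), Real.exp (ε₁ * y) * ε₁]] := by
  have hg : ∀ u, deriv (fun u => ε₁ * Real.exp u + ε₂) u = ε₁ * Real.exp u := fun u =>
    (((Real.hasDerivAt_exp u).const_mul ε₁).add_const ε₂).deriv
  refine basis_of_solutions hD hD' hJ hJ' Real.contDiff_exp.contDiffOn
    (exp_nonconstOn hJ hJ'.nonempty) (fun c => 0)
    (fun c => (HasGrad.expY ε₁).smul (c 0)) (fun c => HasGrad.const 0)
    (fun c => (HasGrad.expY ε₁).smul (c 0 * ε₁)) (fun c p => ?_) (fun c t y u hu => ?_)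
    (fun c t y u hu => ?_) (fun c hl t y h1 h2 h3 h4 => ?_) (fun k χ η₁ η₀ R => ?_)
  · ext i; fin_cases i <;> simp [vf]; ring
  · rw [Real.deriv_exp]; ring
  · rw [hg]; ring
  · ext i; fin_cases i
    simpa [hε₁.ne_zero] using h4
  · obtain ⟨hη₁, hχ₀, hη₀, h0, -, hE⟩ :=
      R.exp_case (isOpen_dom hD hJ) hJ hJ'.nonempty
    -- The constant term `ε₂ k` excludes the scaling; the coefficient of `e^u` then gives the
    -- equation for `η₀`.
    have key : ∀ p ∈ dom D J, k = 0 ∧ pd 2 η₀ p = ε₁ * η₀ p := fun p hp => by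
      have := exp_independent hJ hJ'.nonempty ![1, 0]
        ![pd 2 η₀ p - ε₁ * k - ε₁ * η₀ p, -(ε₂ * k)]
        (by
          intro i j hij
          fin_cases i <;> fin_cases j <;> simp at hij ⊢)
        (fun u hu => by
          have := hE p hp u hu
          rw [hg] at this
          simp
          linear_combination this)
      have e0 := this 0
      have e1 := this 1
      simp [hε₂.ne_zero] at e0 e1
      rw [e1] at e0
      exact ⟨e1, by linarith⟩
    obtain ⟨p₀, hp₀⟩ := (isConnected_dom hD' hJ').nonempty
    obtain ⟨d, hd⟩ := R.planar_η₀.exists_exp_y (isOpen_dom hD hJ) (isConnected_dom hD' hJ') h0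
      fun p hp => (key p hp).2
    have hk := (key p₀ hp₀).1
    -- The generator has `ε₁ exp (ε₁ y)` where the solution has `d exp (ε₁ y)`, and `1 / ε₁ = ε₁`.
    refine ⟨fun _ => d * ε₁, hk, fun p hp => ⟨?_, ?_, ?_, ?_⟩⟩
    · simpa using hχ₀ p hp
    · linear_combination -hη₀ p hp + hd p hp + hk
        - d * Real.exp (ε₁ * p 2) * hε₁.mul_self
    · exact hη₁ p hp
    · linear_combination hd p hp - d * Real.exp (ε₁ * p 2) * hε₁.mul_self

theorem completesBasis_exp_const (hD : IsOpen D) (hD' : IsConnected D) (hJ : IsOpen J)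
    (hJ' : IsConnected J) {ε : ℝ} (hε : IsSign ε) :
    CompletesBasis D J Real.exp (fun _ => ε) [vf fun _ _ y _ => ![0, 0, y, 1]] := by
  refine basis_of_solutions hD hD' hJ hJ' Real.contDiff_exp.contDiffOn
    (exp_nonconstOn hJ hJ'.nonempty) (fun c => 0)
    (fun c => HasGrad.y.smul (c 0)) (fun c => HasGrad.const 0)
    (fun c => HasGrad.const (c 0)) (fun c p => ?_) (fun c t y u hu => ?_)
    (fun c t y u hu => ?_) (fun c hl t y h1 h2 h3 h4 => ?_) (fun k χ η₁ η₀ R => ?_)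
  · ext i; fin_cases i <;> simp [vf]
  · rw [Real.deriv_exp]; ring
  · rw [deriv_const]; ring
  · ext i; fin_cases i; exact h4
  · obtain ⟨hη₁, hχ₀, hη₀, h0, -, hE⟩ :=
      R.exp_case (isOpen_dom hD hJ) hJ hJ'.nonempty
    have key : ∀ p ∈ dom D J, k = 0 ∧ pd 2 η₀ p = 0 := fun p hp => by
      have := exp_independent hJ hJ'.nonempty ![1, 0] ![pd 2 η₀ p, -(ε * k)]
        (by
          intro i j hij
          fin_cases i <;> fin_cases j <;> simp at hij ⊢)
        (fun u hu => by
          have := hE p hp u hu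
          rw [deriv_const] at this
          simp
          linear_combination this)
      have e0 := this 0
      have e1 := this 1
      simp [hε.ne_zero] at e0 e1
      exact ⟨e1, e0⟩
    obtain ⟨p₀, hp₀⟩ := (isConnected_dom hD' hJ').nonempty
    obtain ⟨d, hd⟩ := R.planar_η₀.exists_const (isOpen_dom hD hJ) (isConnected_dom hD' hJ') h0
      fun p hp => (key p hp).2
    have hk := (key p₀ hp₀).1
    refine ⟨fun _ => d, hk, fun p hp => ⟨?_, ?_, ?_, ?_⟩⟩
    · simpa using hχ₀ p hp
    · linear_combination -hη₀ p hp + hd p hp + hk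
    · exact hη₁ p hp
    · exact hd p hp

theorem completesBasis_exp_exp (hD : IsOpen D) (hD' : IsConnected D) (hJ : IsOpen J)
    (hJ' : IsConnected J) {ε : ℝ} (hε : IsSign ε) :
    CompletesBasis D J Real.exp (fun u => ε * Real.exp u)
      [vf fun t x _ _ => ![t, x / 2, 0, -1],
        vf fun _ _ y _ => ![0, 0, Real.exp (ε * y), Real.exp (ε * y) * ε]] := by
  refine basis_of_solutions hD hD' hJ hJ' Real.contDiff_exp.contDiffOn
    (exp_nonconstOn hJ hJ'.nonempty) (fun c => c 0)
    (fun c => (HasGrad.expY ε).smul (c 1)) (fun c => HasGrad.const 0)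
    (fun c => (HasGrad.const (-(c 0))).add ((HasGrad.expY ε).smul (c 1 * ε))) (fun c p => ?_)
    (fun c t y u hu => ?_)
    (fun c t y u hu => ?_) (fun c hl t y h1 h2 h3 h4 => ?_) (fun k χ η₁ η₀ R => ?_)
  · ext i; fin_cases i <;> simp [vf] <;> ring
  · rw [Real.deriv_exp]; ring
  · rw [deriv_const_mul_field, Real.deriv_exp]
    ring
  · ext i; fin_cases i
    · exact hl
    · simpa [hε.ne_zero] using h2
  · have hU := isOpen_dom hD hJ
    obtain ⟨hη₁, hχ₀, hη₀, h0, h2, hE⟩ := R.exp_case hU hJ hJ'.nonempty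
    -- As `g` is proportional to `f`, only one function of `u` occurs and a single value of `u`
    -- suffices: `η₀_y = ε (k + η₀)` with `η₀ = χ_y - k`.
    have key : ∀ p ∈ dom D J, pd 2 (pd 2 χ) p = ε * pd 2 χ p := fun p hp => by
      obtain ⟨u, hu⟩ := hJ'.nonempty
      have := hE p hp u hu
      rw [deriv_const_mul_field, Real.deriv_exp] at this
      have e : Real.exp u * (pd 2 η₀ p - ε * (k + η₀ p)) = 0 := by linear_combination this
      have e2 := (mul_eq_zero.1 e).resolve_left (Real.exp_ne_zero u)
      rw [← h2 p hp]
      linear_combination e2 + ε * hη₀ p hp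
    obtain ⟨d, hd⟩ := (R.planar_χ.pd hU 2).exists_exp_y hU (isConnected_dom hD' hJ')
      (fun p hp => by rw [pd_comm hU R.smooth_χ hp, pd_eq_zero hU hχ₀ hp]) key
    refine ⟨![k, d * ε], rfl, fun p hp => ⟨?_, ?_, ?_, ?_⟩⟩
    · simpa using hχ₀ p hp
    · simp
      linear_combination hd p hp - d * Real.exp (ε * p 2) * hε.mul_self
    · exact hη₁ p hp
    · simp
      linear_combination hη₀ p hp + hd p hp - d * Real.exp (ε * p 2) * hε.mul_self

theorem completesBasis_exp_zero (hD : IsOpen D) (hD' : IsConnected D) (hJ : IsOpen J)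
    (hJ' : IsConnected J) :
    CompletesBasis D J Real.exp (fun _ => 0)
      [vf fun t x y _ => ![t, x / 2, y, 0], vf fun _ _ y _ => ![0, 0, y, 1]] := by
  refine basis_of_solutions hD hD' hJ hJ' Real.contDiff_exp.contDiffOn
    (exp_nonconstOn hJ hJ'.nonempty) (fun c => c 0)
    (fun c => HasGrad.y.smul (c 0 + c 1)) (fun c => HasGrad.const 0)
    (fun c => HasGrad.const (c 1)) (fun c p => ?_) (fun c t y u hu => ?_)
    (fun c t y u hu => ?_) (fun c hl t y h1 h2 h3 h4 => ?_) (fun k χ η₁ η₀ R => ?_)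
  · ext i; fin_cases i <;> simp [vf] <;> ring
  · rw [Real.deriv_exp]; ring
  · rw [deriv_const]; ring
  · ext i; fin_cases i
    · exact hl
    · exact h4
  · obtain ⟨hη₁, hχ₀, hη₀, h0, -, hE⟩ :=
      R.exp_case (isOpen_dom hD hJ) hJ hJ'.nonempty
    obtain ⟨d, hd⟩ := R.planar_η₀.exists_const (isOpen_dom hD hJ) (isConnected_dom hD' hJ') h0
      fun p hp => by
        obtain ⟨u, hu⟩ := hJ'.nonempty
        simpa using hE p hp u hu
    refine ⟨![k, d], rfl, fun p hp => ⟨?_, ?_, ?_, ?_⟩⟩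
    · simpa using hχ₀ p hp
    · simp
      linear_combination -hη₀ p hp + hd p hp
    · exact hη₁ p hp
    · exact hd p hp

end ExpRows

/-! ### Bases for `f = log`. -/

section LogRows

variable {D : Set (Fin 3 → ℝ)} {J : Set ℝ}

theorem completesBasis_log_rpow (hD : IsOpen D) (hD' : IsConnected D) (hJ : IsOpen J)
    (hJ' : IsConnected J) (hpos : J ⊆ Set.Ioi 0) {ε m : ℝ} (hε : IsSign ε) (h1 : m ≠ 1) :
    CompletesBasis D J Real.log (fun u => ε * u ^ m)
      [vf fun t x y u => ![t, x / 2, y - t / (m - 1), -(u / (m - 1))]] := by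
  have hm1 : m - 1 ≠ 0 := sub_ne_zero.2 h1
  have hg : ∀ u ∈ J, u * deriv (fun u => ε * u ^ m) u = m * (ε * u ^ m) := fun u hu => by
    have hu0 : u ≠ 0 := (hpos hu).ne'
    rw [deriv_const_mul_field, (Real.hasDerivAt_rpow_const (Or.inl hu0)).deriv,
      Real.rpow_sub_one hu0]
    field_simp
  refine basis_of_solutions hD hD' hJ hJ' (log_contDiffOn hpos)
    (log_nonconstOn hJ hJ'.nonempty hpos) (fun c => c 0)
    (fun c => (HasGrad.y.smul (c 0)).add (HasGrad.t.smul (-(c 0 / (m - 1)))))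
    (fun c => HasGrad.const (-(c 0 / (m - 1))))
    (fun c => HasGrad.const 0) (fun c p => ?_) (fun c t y u hu => ?_)
    (fun c t y u hu => ?_) (fun c hl t y h1 h2 h3 h4 => ?_) (fun k χ η₁ η₀ R => ?_)
  · ext i; fin_cases i <;> simp [vf] <;> ring
  · have hu0 : u ≠ 0 := (hpos hu).ne'
    rw [Real.deriv_log]; field_simp; ring
  · have e : -(c 0 / (m - 1)) - c 0 + c 0 / (m - 1) * m = 0 := by field_simp; ring
    linear_combination (c 0 / (m - 1)) * hg u hu + ε * u ^ m * e
  · ext i; fin_cases i; exact hl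
  · obtain ⟨hη₀, hη₁, hχ₂, -, hE⟩ :=
      R.log_case (isOpen_dom hD hJ) hJ hJ'.nonempty hpos
    have key : ∀ p ∈ dom D J, (m - 1) * η₁ p = -k := fun p hp => by
      have := rpow_independent_powDomain hJ hJ'.nonempty ![1, m]
        ![pd 0 η₁ p, ε * (η₁ p - k - η₁ p * m)]
        (by
          intro i j hij
          fin_cases i <;> fin_cases j <;> simp at hij ⊢
          · exact h1 hij.symm
          · exact h1 hij)
        (fun i u hu _ => (Real.rpow_pos_of_pos (hpos hu) _).ne')
        (fun u hu _ => by
          have := hE p hp u hu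
          rw [hg u hu] at this
          simp
          linear_combination this) 1
      simp [hε.ne_zero] at this
      linarith
    refine ⟨fun _ => k, rfl, fun p hp => ⟨?_, ?_, ?_, ?_⟩⟩
    · rw [← hη₁ p hp]
      field_simp
      linear_combination key p hp
    · simpa using hχ₂ p hp
    · field_simp
      linear_combination key p hp
    · exact hη₀ p hp

theorem completesBasis_log_mul_log (hD : IsOpen D) (hD' : IsConnected D) (hJ : IsOpen J)
    (hJ' : IsConnected J) (hpos : J ⊆ Set.Ioi 0) {ε : ℝ} (hε : IsSign ε) :
    CompletesBasis D J Real.log (fun u => ε * (u * Real.log u))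
      [vf fun t _ _ u => ![0, 0, Real.exp (ε * t), Real.exp (ε * t) * (ε * u)]] := by
  have hg : ∀ u ∈ J, deriv (fun u => ε * (u * Real.log u)) u = ε * (Real.log u + 1) :=
    fun u hu => by
      rw [deriv_const_mul_field, (Real.hasDerivAt_mul_log (hpos hu).ne').deriv]
  refine basis_of_solutions hD hD' hJ hJ' (log_contDiffOn hpos)
    (log_nonconstOn hJ hJ'.nonempty hpos) (fun c => 0)
    (fun c => (HasGrad.expT ε).smul (c 0))
    (fun c => (HasGrad.expT ε).smul (c 0 * ε))
    (fun c => HasGrad.const 0) (fun c p => ?_) (fun c t y u hu => ?_)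
    (fun c t y u hu => ?_) (fun c hl t y h1 h2 h3 h4 => ?_) (fun k χ η₁ η₀ R => ?_)
  · ext i; fin_cases i <;> simp [vf]; ring
  · have hu0 : u ≠ 0 := (hpos hu).ne'
    rw [Real.deriv_log]; field_simp; ring
  · rw [hg u hu]; ring
  · ext i; fin_cases i
    simpa [hε.ne_zero] using h1
  · obtain ⟨hη₀, hη₁, hχ₂, h2, hE⟩ :=
      R.log_case (isOpen_dom hD hJ) hJ hJ'.nonempty hpos
    -- The coefficient of `u log u` excludes the scaling, that of `u` governs `η₁`.
    have key : ∀ p ∈ dom D J, pd 0 η₁ p = ε * η₁ p ∧ k = 0 := fun p hp => by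
      obtain ⟨-, e1, e2⟩ := log_relation hJ hJ'.nonempty hpos (a := pd 0 η₁ p) (b := 0)
        (c := ε * η₁ p) (d := ε * k) fun u hu => by
          have := hE p hp u hu
          rw [hg u hu] at this
          linear_combination this
      exact ⟨e1, (mul_eq_zero.1 e2).resolve_left hε.ne_zero⟩
    obtain ⟨p₀, hp₀⟩ := (isConnected_dom hD' hJ').nonempty
    have hk := (key p₀ hp₀).2
    obtain ⟨d, hd⟩ := R.planar_η₁.exists_exp_t (isOpen_dom hD hJ) (isConnected_dom hD' hJ')
      (fun p hp => (key p hp).1) h2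
    refine ⟨fun _ => d * ε, hk, fun p hp => ⟨?_, ?_, ?_, ?_⟩⟩
    · rw [← hη₁ p hp]
      linear_combination hd p hp - d * Real.exp (ε * p 0) * hε.mul_self
    · simpa [hk] using hχ₂ p hp
    · linear_combination hd p hp - d * Real.exp (ε * p 0) * hε.mul_self
    · exact hη₀ p hp

/-- Here `ε` is any real number, so that `ε = 0` covers the equation without source. -/
theorem completesBasis_log_linear (hD : IsOpen D) (hD' : IsConnected D) (hJ : IsOpen J)
    (hJ' : IsConnected J) (hpos : J ⊆ Set.Ioi 0) {ε : ℝ} :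
    CompletesBasis D J Real.log (fun u => ε * u)
      [vf fun t x y u => ![t, x / 2, y + ε / 2 * t ^ 2, ε * t * u],
        vf fun t _ _ u => ![0, 0, t, u]] := by
  have hg : ∀ u, deriv (fun u => ε * u) u = ε := fun u => by
    simp
  refine basis_of_solutions hD hD' hJ hJ' (log_contDiffOn hpos)
    (log_nonconstOn hJ hJ'.nonempty hpos) (fun c => c 0)
    (fun c => ((HasGrad.y.smul (c 0)).add ((HasGrad.t.mul HasGrad.t).smul (c 0 * (ε / 2)))).add
      (HasGrad.t.smul (c 1)))
    (fun c => (HasGrad.t.smul (c 0 * ε)).add (HasGrad.const (c 1)))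
    (fun c => HasGrad.const 0) (fun c p => ?_) (fun c t y u hu => ?_)
    (fun c t y u hu => ?_) (fun c hl t y h1 h2 h3 h4 => ?_) (fun k χ η₁ η₀ R => ?_)
  · ext i; fin_cases i <;> simp [vf] <;> ring
  · have hu0 : u ≠ 0 := (hpos hu).ne'
    rw [Real.deriv_log]; field_simp; ring
  · rw [hg u]; ring
  · ext i; fin_cases i
    · exact hl
    · simpa [hl] using h3
  · obtain ⟨hη₀, hη₁, hχ₂, h2, hE⟩ :=
      R.log_case (isOpen_dom hD hJ) hJ hJ'.nonempty hpos
    have key : ∀ p ∈ dom D J, pd 0 η₁ p = k * ε := fun p hp => by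
      obtain ⟨u, hu⟩ := hJ'.nonempty
      have := hE p hp u hu
      rw [hg u] at this
      have e : (pd 0 η₁ p - k * ε) * u = 0 := by linear_combination this
      exact sub_eq_zero.1 ((mul_eq_zero.1 e).resolve_right (hpos hu).ne')
    obtain ⟨d, hd⟩ := R.planar_η₁.exists_affine_t (isOpen_dom hD hJ) (isConnected_dom hD' hJ')
      key h2
    refine ⟨![k, d], rfl, fun p hp => ⟨?_, ?_, ?_, ?_⟩⟩
    · rw [← hη₁ p hp]
      simp
      linear_combination hd p hp
    · simpa using hχ₂ p hp
    · simpa using hd p hp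
    · exact hη₀ p hp

theorem completesBasis_log_zero (hD : IsOpen D) (hD' : IsConnected D) (hJ : IsOpen J)
    (hJ' : IsConnected J) (hpos : J ⊆ Set.Ioi 0) :
    CompletesBasis D J Real.log (fun _ => 0)
      [vf fun t x y _ => ![t, x / 2, y, 0], vf fun t _ _ u => ![0, 0, t, u]] := by
  simpa using completesBasis_log_linear hD hD' hJ hJ' hpos (ε := 0)

end LogRows

/-! ### Bases for `f = u ^ m` with `m ≠ 0, 1`. -/

section PowRows

variable {D : Set (Fin 3 → ℝ)} {J : Set ℝ}

theorem completesBasis_rpow_rpow (hD : IsOpen D) (hD' : IsConnected D) (hJ : IsOpen J)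
    (hJ' : IsConnected J) {ε m n : ℝ} (hε : IsSign ε) (h0 : m ≠ 0) (h1 : m ≠ 1) (hn : n ≠ m + 1)
    (hJm : PowDomain m J) (hJn : PowDomain n J) :
    CompletesBasis D J (fun u => u ^ m) (fun u => ε * u ^ n)
      [vf fun t x y u => ![(n - 1) * t, (n - 1) * x / 2, (n - m - 1) * y, -u]] := by
  have hg : ∀ u ∈ J, u * deriv (fun u => ε * u ^ n) u = n * (ε * u ^ n) := fun u hu => by
    rw [deriv_const_mul_field]
    linear_combination ε * hJn.mul_deriv hu
  refine basis_of_solutions hD hD' hJ hJ' hJm.contDiffOn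
    (hJm.nonconstOn hJ hJ'.nonempty h0) (fun c => (n - 1) * c 0)
    (fun c => HasGrad.y.smul ((n - m - 1) * c 0))
    (fun c => HasGrad.const (-(c 0)))
    (fun c => HasGrad.const 0) (fun c p => ?_) (fun c t y u hu => ?_)
    (fun c t y u hu => ?_) (fun c hl t y h1 h2 h3 h4 => ?_) (fun k χ η₁ η₀ R => ?_)
  · ext i; fin_cases i <;> simp [vf] <;> ring
  · linear_combination -c 0 * hJm.mul_deriv hu
  · linear_combination c 0 * hg u hu
  · ext i; fin_cases i; simpa using h3
  · have hU := isOpen_dom hD hJ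
    obtain ⟨hη₀, hχ₀, hχ₂, h0', hE⟩ := R.pow_case hU hJ hJ'.nonempty hJm h0 h1
    -- The exponents `m + 1` and `n` differ, so both coefficients vanish.
    have key : ∀ p ∈ dom D J, pd 2 η₁ p = 0 ∧ η₁ p - k - n * η₁ p = 0 := fun p hp => by
      have := rpow_independent_powDomain hJ hJ'.nonempty ![m + 1, n]
        ![pd 2 η₁ p, ε * (η₁ p - k - n * η₁ p)]
        (by
          intro i j hij
          fin_cases i <;> fin_cases j <;> simp at hij ⊢
          · exact hn hij.symm
          · exact hn hij)
        (fun i u hu hu0 => by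
          fin_cases i
          · exact hJm.add_one.rpow_ne_zero hu hu0
          · exact hJn.rpow_ne_zero hu hu0)
        (fun u hu _ => by
          have := hE p hp u hu
          rw [hg u hu] at this
          simp
          linear_combination this)
      have e0 := this 0
      have e1 := this 1
      simp [hε.ne_zero] at e0 e1
      exact ⟨e0, e1⟩
    obtain ⟨p₀, hp₀⟩ := (isConnected_dom hD' hJ').nonempty
    obtain ⟨d, hd⟩ := R.planar_η₁.exists_const hU (isConnected_dom hD' hJ') h0'
      fun p hp => (key p hp).1
    have hk := (key p₀ hp₀).2
    rw [hd p₀ hp₀] at hk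
    -- The generator is normalised by its component `-u` and not by `l`, which is zero for `n = 1`.
    refine ⟨fun _ => -d, by linarith, fun p hp => ⟨?_, ?_, ?_, ?_⟩⟩
    · simpa using hχ₀ p hp
    · linear_combination -hχ₂ p hp + m * hd p hp - hk
    · simpa using hd p hp
    · exact hη₀ p hp

theorem completesBasis_rpow_add_linear (hD : IsOpen D) (hD' : IsConnected D) (hJ : IsOpen J)
    (hJ' : IsConnected J) {ε₁ ε₂ m : ℝ} (hε₁ : IsSign ε₁) (hε₂ : IsSign ε₂) (h0 : m ≠ 0)
    (h1 : m ≠ 1) (hJm : PowDomain m J) :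
    CompletesBasis D J (fun u => u ^ m) (fun u => ε₁ * u ^ (m + 1) + ε₂ * u)
      [vf fun _ _ y u =>
        ![0, 0, Real.exp (ε₁ * m * y), Real.exp (ε₁ * m * y) * (ε₁ * u)]] := by
  have hg : ∀ u ∈ J, u * deriv (fun u => ε₁ * u ^ (m + 1) + ε₂ * u) u
      = (m + 1) * (ε₁ * u ^ (m + 1)) + ε₂ * u := fun u hu => by
    have : HasDerivAt (fun u => ε₁ * u ^ (m + 1) + ε₂ * u) _ u :=
      ((hJm.add_one.hasDerivAt hu).const_mul ε₁).add ((hasDerivAt_id u).const_mul ε₂)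
    rw [this.deriv]
    linear_combination ε₁ * hJm.add_one.mul_deriv hu
  refine basis_of_solutions hD hD' hJ hJ' hJm.contDiffOn
    (hJm.nonconstOn hJ hJ'.nonempty h0) (fun c => 0)
    (fun c => (HasGrad.expY (ε₁ * m)).smul (c 0))
    (fun c => (HasGrad.expY (ε₁ * m)).smul (c 0 * ε₁))
    (fun c => HasGrad.const 0) (fun c p => ?_) (fun c t y u hu => ?_)
    (fun c t y u hu => ?_) (fun c hl t y h1 h2 h3 h4 => ?_) (fun k χ η₁ η₀ R => ?_)
  · ext i; fin_cases i <;> simp [vf]; ring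
  · linear_combination c 0 * ε₁ * Real.exp (ε₁ * m * y) * hJm.mul_deriv hu
  · have e := hJm.rpow_add_one hu
    linear_combination -(c 0 * ε₁ * Real.exp (ε₁ * m * y)) * hg u hu
      - (c 0 * ε₁ * ε₁ * m * Real.exp (ε₁ * m * y)) * e
  · ext i; fin_cases i
    simpa [hε₁.ne_zero] using h3
  · have hU := isOpen_dom hD hJ
    obtain ⟨hη₀, hχ₀, hχ₂, h0', hE⟩ := R.pow_case hU hJ hJ'.nonempty hJm h0 h1
    have key : ∀ p ∈ dom D J, k = 0 ∧ pd 2 η₁ p = ε₁ * m * η₁ p := fun p hp => by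
      have := rpow_independent_powDomain hJ hJ'.nonempty ![m + 1, 1]
        ![pd 2 η₁ p - ε₁ * k - ε₁ * m * η₁ p, -(ε₂ * k)]
        (by
          intro i j hij
          fin_cases i <;> fin_cases j <;> simp at hij ⊢
          · exact h0 hij
          · exact h0 hij)
        (fun i u hu hu0 => by
          fin_cases i
          · exact hJm.add_one.rpow_ne_zero hu hu0
          · simpa using hu0)
        (fun u hu _ => by
          have := hE p hp u hu
          rw [hg u hu] at this
          simp
          linear_combination this)
      have e0 := this 0
      have e1 := this 1
      simp [hε₂.ne_zero] at e0 e1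
      rw [e1] at e0
      exact ⟨e1, by linarith⟩
    obtain ⟨p₀, hp₀⟩ := (isConnected_dom hD' hJ').nonempty
    obtain ⟨d, hd⟩ := R.planar_η₁.exists_exp_y hU (isConnected_dom hD' hJ') h0'
      fun p hp => (key p hp).2
    have hk := (key p₀ hp₀).1
    refine ⟨fun _ => d * ε₁, hk, fun p hp => ⟨?_, ?_, ?_, ?_⟩⟩
    · simpa using hχ₀ p hp
    · linear_combination -hχ₂ p hp + m * hd p hp + hk
        - d * m * Real.exp (ε₁ * m * p 2) * hε₁.mul_self
    · linear_combination hd p hp - d * Real.exp (ε₁ * m * p 2) * hε₁.mul_self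
    · exact hη₀ p hp

theorem completesBasis_rpow_rpow_succ (hD : IsOpen D) (hD' : IsConnected D) (hJ : IsOpen J)
    (hJ' : IsConnected J) {ε m : ℝ} (hε : IsSign ε) (h0 : m ≠ 0) (h1 : m ≠ 1)
    (hJm : PowDomain m J) :
    CompletesBasis D J (fun u => u ^ m) (fun u => ε * u ^ (m + 1))
      [vf fun t x _ u => ![t, x / 2, 0, -(1 / m * u)],
        vf fun _ _ y u => ![0, 0, Real.exp (ε * m * y), Real.exp (ε * m * y) * (ε * u)]] := by
  have hg : ∀ u ∈ J, u * deriv (fun u => ε * u ^ (m + 1)) u = (m + 1) * (ε * u ^ (m + 1)) :=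
    fun u hu => by
      rw [deriv_const_mul_field]
      linear_combination ε * hJm.add_one.mul_deriv hu
  refine basis_of_solutions hD hD' hJ hJ' hJm.contDiffOn
    (hJm.nonconstOn hJ hJ'.nonempty h0) (fun c => c 0)
    (fun c => (HasGrad.expY (ε * m)).smul (c 1))
    (fun c => (HasGrad.const (-(c 0 / m))).add ((HasGrad.expY (ε * m)).smul (c 1 * ε)))
    (fun c => HasGrad.const 0) (fun c p => ?_) (fun c t y u hu => ?_)
    (fun c t y u hu => ?_) (fun c hl t y h1 h2 h3 h4 => ?_) (fun k χ η₁ η₀ R => ?_)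
  · ext i; fin_cases i <;> simp [vf] <;> ring
  · have e : c 0 / m * m = c 0 := by field_simp
    linear_combination (-(c 0 / m) + c 1 * ε * Real.exp (ε * m * y)) * hJm.mul_deriv hu - u ^ m * e
  · have e : c 0 / m * m = c 0 := by field_simp
    linear_combination (c 0 / m - c 1 * ε * Real.exp (ε * m * y)) * hg u hu
      - (c 1 * ε * ε * m * Real.exp (ε * m * y)) * hJm.rpow_add_one hu + ε * u ^ (m + 1) * e
  · ext i; fin_cases i
    · exact hl
    · simpa [hε.ne_zero, h0] using h2
  · have hU := isOpen_dom hD hJ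
    obtain ⟨hη₀, hχ₀, hχ₂, h0', hE⟩ := R.pow_case hU hJ hJ'.nonempty hJm h0 h1
    -- Only the power `u ^ (m + 1)` occurs: `η₁_y = ε (k + m η₁) = ε χ_y`, while `m η₁_y = χ_yy`.
    have key : ∀ p ∈ dom D J, pd 2 (pd 2 χ) p = ε * m * pd 2 χ p := fun p hp => by
      have := rpow_independent_powDomain hJ hJ'.nonempty ![m + 1]
        ![pd 2 η₁ p - ε * (k + m * η₁ p)]
        (Function.injective_of_subsingleton _)
        (fun i u hu hu0 => by
          fin_cases i
          exact hJm.add_one.rpow_ne_zero hu hu0)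
        (fun u hu _ => by
          have := hE p hp u hu
          rw [hg u hu] at this
          rw [Fin.sum_univ_one]
          simp only [Matrix.cons_val_zero]
          linear_combination this) 0
      simp at this
      have e := pd_congr hU hχ₂ hp 2
      rw [pd_const_mul 2 m (R.planar_η₁.differentiableAt hU hp),
        pd_sub 2 ((R.planar_χ.pd hU 2).differentiableAt hU hp) (differentiableAt_const k),
        pd_eq_zero hU (c := k) (fun _ _ => rfl) hp, sub_zero] at e
      linear_combination m * this - e + ε * m * hχ₂ p hp
    obtain ⟨d, hd⟩ := (R.planar_χ.pd hU 2).exists_exp_y hU (isConnected_dom hD' hJ')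
      (fun p hp => by rw [pd_comm hU R.smooth_χ hp, pd_eq_zero hU hχ₀ hp]) key
    -- Integrating `χ_y = d exp (ε m y)` divides `d` by `ε m`, and `1 / ε = ε`.
    refine ⟨![k, d * ε / m], rfl, fun p hp => ⟨?_, ?_, ?_, ?_⟩⟩
    · simpa using hχ₀ p hp
    · have e : d * ε / m * m = d * ε := by field_simp
      simp
      linear_combination hd p hp - d * Real.exp (ε * m * p 2) * hε.mul_self
        - ε * Real.exp (ε * m * p 2) * e
    · have e : d * ε / m * m = d * ε := by field_simp
      have e' : k / m * m = k := by field_simp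
      refine mul_left_cancel₀ h0 ?_
      simp only [Matrix.cons_val_zero, Matrix.cons_val_one]
      linear_combination hχ₂ p hp + hd p hp - d * Real.exp (ε * m * p 2) * hε.mul_self
        - ε * Real.exp (ε * m * p 2) * e + e'
    · exact hη₀ p hp

theorem completesBasis_rpow_zero (hD : IsOpen D) (hD' : IsConnected D) (hJ : IsOpen J)
    (hJ' : IsConnected J) {m : ℝ} (h0 : m ≠ 0) (h1 : m ≠ 1) (hJm : PowDomain m J) :
    CompletesBasis D J (fun u => u ^ m) (fun _ => 0)
      [vf fun t x y _ => ![t, x / 2, y, 0], vf fun _ _ y u => ![0, 0, y, 1 / m * u]] := by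
  refine basis_of_solutions hD hD' hJ hJ' hJm.contDiffOn
    (hJm.nonconstOn hJ hJ'.nonempty h0) (fun c => c 0)
    (fun c => HasGrad.y.smul (c 0 + c 1)) (fun c => HasGrad.const (c 1 / m))
    (fun c => HasGrad.const 0) (fun c p => ?_) (fun c t y u hu => ?_)
    (fun c t y u hu => ?_) (fun c hl t y h1 h2 h3 h4 => ?_) (fun k χ η₁ η₀ R => ?_)
  · ext i; fin_cases i <;> simp [vf] <;> ring
  · have e : c 1 / m * m = c 1 := by field_simp
    linear_combination c 1 / m * hJm.mul_deriv hu + u ^ m * e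
  · rw [deriv_const]; ring
  · ext i; fin_cases i
    · exact hl
    · simpa [h0] using h3
  · have hU := isOpen_dom hD hJ
    obtain ⟨hη₀, hχ₀, hχ₂, h0', hE⟩ := R.pow_case hU hJ hJ'.nonempty hJm h0 h1
    obtain ⟨d, hd⟩ := R.planar_η₁.exists_const hU (isConnected_dom hD' hJ') h0'
      fun p hp => by
        obtain ⟨u, hu, hu0⟩ := (nonempty_diff_zero hJ hJ'.nonempty).2
        have := hE p hp u hu
        simpa [hJm.add_one.rpow_ne_zero hu hu0] using this
    refine ⟨![k, m * d], rfl, fun p hp => ⟨?_, ?_, ?_, ?_⟩⟩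
    · simpa using hχ₀ p hp
    · simp
      linear_combination -hχ₂ p hp + m * hd p hp
    · simp
      field_simp
      exact hd p hp
    · exact hη₀ p hp

end PowRows

/-! ### Bases for `f = u` with an exponential or power source. -/

section IdRows

variable {D : Set (Fin 3 → ℝ)} {J : Set ℝ}

theorem id_contDiffOn : ContDiffOn ℝ ∞ (fun u : ℝ => u) J := contDiffOn_id

theorem id_nonconstOn (hJ : IsOpen J) (hJ' : J.Nonempty) : NonconstOn (fun u => u) J := by
  obtain ⟨u, hu⟩ := hJ'
  exact nonconstOn_of_deriv_ne_zero hJ hu (by rw [deriv_id'']; exact one_ne_zero)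

theorem completesBasis_id_exp (hD : IsOpen D) (hD' : IsConnected D) (hJ : IsOpen J)
    (hJ' : IsConnected J) {ε : ℝ} (hε : IsSign ε) :
    CompletesBasis D J (fun u => u) (fun u => ε * Real.exp u)
      [vf fun t x y _ => ![t, x / 2, y - t, -1]] := by
  refine basis_of_solutions hD hD' hJ hJ' id_contDiffOn
    (id_nonconstOn hJ hJ'.nonempty) (fun c => c 0)
    (fun c => (HasGrad.y.smul (c 0)).add (HasGrad.t.smul (-(c 0))))
    (fun c => HasGrad.const 0)
    (fun c => HasGrad.const (-(c 0))) (fun c p => ?_) (fun c t y u hu => ?_)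
    (fun c t y u hu => ?_) (fun c hl t y h1 h2 h3 h4 => ?_) (fun k χ η₁ η₀ R => ?_)
  · ext i; fin_cases i <;> simp [vf] <;> ring
  · rw [deriv_id'']; ring
  · rw [deriv_const_mul_field, Real.deriv_exp]; ring
  · ext i; fin_cases i; exact hl
  · obtain ⟨hχ₀, hχ₂, -, hE⟩ := R.id_case (isOpen_dom hD hJ) hJ hJ'.nonempty
    have key : ∀ p ∈ dom D J, η₁ p = 0 ∧ η₀ p = -k := fun p hp => by
      obtain ⟨e1, e2⟩ := exp_quadratic_relation hJ hJ'.nonempty (a := -(ε * η₁ p))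
        (b := ε * (η₁ p - k - η₀ p)) (α := pd 2 η₁ p) (β := 2 * pd 0 η₁ p) (γ := pd 0 η₀ p)
        (fun u hu => by
          have := hE p hp u hu
          rw [deriv_const_mul_field, Real.deriv_exp] at this
          linear_combination this)
      simp [hε.ne_zero] at e1 e2
      rw [e1] at e2
      exact ⟨e1, by linarith⟩
    refine ⟨fun _ => k, rfl, fun p hp => ⟨?_, ?_, ?_, ?_⟩⟩
    · linear_combination hχ₀ p hp + (key p hp).2
    · linear_combination hχ₂ p hp + (key p hp).1
    · exact (key p hp).1
    · exact (key p hp).2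

theorem completesBasis_id_rpow (hD : IsOpen D) (hD' : IsConnected D) (hJ : IsOpen J)
    (hJ' : IsConnected J) {ε m : ℝ} (hε : IsSign ε) (h0 : m ≠ 0) (h1 : m ≠ 1) (h2 : m ≠ 2)
    (hJm : PowDomain m J) :
    CompletesBasis D J (fun u => u) (fun u => ε * u ^ m)
      [vf fun t x y u => ![t, x / 2, (m - 2) / (m - 1) * y, -(u / (m - 1))]] := by
  have hm1 : m - 1 ≠ 0 := sub_ne_zero.2 h1
  have hg : ∀ u ∈ J, u * deriv (fun u => ε * u ^ m) u = m * (ε * u ^ m) := fun u hu => by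
    rw [deriv_const_mul_field]
    linear_combination ε * hJm.mul_deriv hu
  refine basis_of_solutions hD hD' hJ hJ' id_contDiffOn
    (id_nonconstOn hJ hJ'.nonempty) (fun c => c 0)
    (fun c => HasGrad.y.smul (c 0 * ((m - 2) / (m - 1))))
    (fun c => HasGrad.const (-(c 0 / (m - 1))))
    (fun c => HasGrad.const 0) (fun c p => ?_) (fun c t y u hu => ?_)
    (fun c t y u hu => ?_) (fun c hl t y h1 h2 h3 h4 => ?_) (fun k χ η₁ η₀ R => ?_)
  · ext i; fin_cases i <;> simp [vf] <;> ring
  · rw [deriv_id'']; field_simp; ring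
  · have e : -(c 0 / (m - 1)) - c 0 + c 0 / (m - 1) * m = 0 := by field_simp; ring
    linear_combination (c 0 / (m - 1)) * hg u hu + ε * u ^ m * e
  · ext i; fin_cases i; exact hl
  · obtain ⟨hχ₀, hχ₂, -, hE⟩ := R.id_case (isOpen_dom hD hJ) hJ hJ'.nonempty
    have hU := isOpen_dom hD hJ
    have hE' : ∀ p ∈ dom D J, ∀ u ∈ J, u ≠ 0 → pd 2 η₁ p * u ^ (2 : ℝ)
        + 2 * pd 0 η₁ p * u ^ (1 : ℝ) + pd 0 η₀ p * u ^ (0 : ℝ)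
        + ε * (η₁ p - k - m * η₁ p) * u ^ m - ε * m * η₀ p * u ^ (m - 1) = 0 :=
      fun p hp u hu hu0 => by
        have e := hE p hp u hu
        rw [deriv_const_mul_field, (Real.hasDerivAt_rpow_const (Or.inl hu0)).deriv] at e
        have e2 : u ^ m = u * u ^ (m - 1) := by rw [Real.rpow_sub_one hu0]; field_simp
        rw [Real.rpow_two, Real.rpow_one, Real.rpow_zero]
        rw [e2] at e ⊢
        linear_combination e
    have hne : ∀ u ∈ J, u ≠ 0 → u ^ m ≠ 0 ∧ u ^ (m - 1) ≠ 0 := fun u hu hu0 => by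
      have := hJm.rpow_ne_zero hu hu0
      exact ⟨this, by rw [Real.rpow_sub_one hu0]; exact div_ne_zero this hu0⟩
    have key : ∀ p ∈ dom D J, η₁ p = -(k / (m - 1)) := fun p hp => by
      -- Among the exponents `m, m - 1, 2, 1, 0` only `m - 1` and `2` can still coincide, namely for
      -- `m = 3`; there the two terms are merged.
      have hz : η₁ p - k - m * η₁ p = 0 := by
        by_cases h3 : m = 3
        · subst h3
          have := rpow_independent_powDomain hJ hJ'.nonempty ![3, 2, 1, 0]
            ![ε * (η₁ p - k - 3 * η₁ p), pd 2 η₁ p - ε * 3 * η₀ p, 2 * pd 0 η₁ p, pd 0 η₀ p]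
            (by
              intro i j hij
              fin_cases i <;> fin_cases j <;> first | rfl | norm_num at hij)
            (fun i u hu hu0 => by
              fin_cases i
              · exact (hne u hu hu0).1
              · simpa using hu0
              · simpa using hu0
              · simp)
            (fun u hu hu0 => by
              have := hE' p hp u hu hu0
              rw [show (3 : ℝ) - 1 = 2 by norm_num] at this
              simp only [Fin.sum_univ_four, Matrix.cons_val_zero, Matrix.cons_val_one,
                Matrix.cons_val]
              linear_combination this) 0
          simpa [hε.ne_zero] using this
        · have := rpow_independent_powDomain hJ hJ'.nonempty ![m, m - 1, 2, 1, 0]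
            ![ε * (η₁ p - k - m * η₁ p), -(ε * m * η₀ p), pd 2 η₁ p, 2 * pd 0 η₁ p, pd 0 η₀ p]
            (by
              have a1 : m - 1 ≠ 2 := fun h => h3 (by linarith)
              have a2 : m - 1 ≠ 1 := fun h => h2 (by linarith)
              have a3 : m ≠ m - 1 := fun h => by linarith
              intro i j hij
              fin_cases i <;> fin_cases j <;>
                simp [h0, h1, h2, hm1, a1, a2, a3, h0.symm, h1.symm, h2.symm, hm1.symm, a1.symm,
                  a2.symm, a3.symm] at hij ⊢)
            (fun i u hu hu0 => by
              fin_cases i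
              · exact (hne u hu hu0).1
              · exact (hne u hu hu0).2
              · simpa using hu0
              · simpa using hu0
              · simp)
            (fun u hu hu0 => by
              have := hE' p hp u hu hu0
              simp only [Fin.sum_univ_five, Matrix.cons_val_zero, Matrix.cons_val_one,
                Matrix.cons_val]
              linear_combination this) 0
          simpa [hε.ne_zero] using this
      field_simp
      linear_combination -hz
    -- As `η₁` is now constant, only the powers `u ^ (m - 1)` and `1` remain.
    have hη₀ : ∀ p ∈ dom D J, η₀ p = 0 := fun p hp => by
      have := rpow_independent_powDomain hJ hJ'.nonempty ![m - 1, 0]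
        ![-(ε * m * η₀ p), pd 0 η₀ p]
        (by
          intro i j hij
          fin_cases i <;> fin_cases j <;> simp [hm1, hm1.symm] at hij ⊢)
        (fun i u hu hu0 => by
          fin_cases i
          · exact (hne u hu hu0).2
          · simp)
        (fun u hu hu0 => by
          have e := hE' p hp u hu hu0
          rw [pd_eq_zero hU key hp, pd_eq_zero hU key hp, key p hp] at e
          have e2 : -(k / (m - 1)) - k - m * -(k / (m - 1)) = 0 := by field_simp; ring
          simp only [Fin.sum_univ_two, Matrix.cons_val_zero, Matrix.cons_val_one]
          linear_combination e - ε * u ^ m * e2) 0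
      simpa [hε.ne_zero, h0] using this
    refine ⟨fun _ => k, rfl, fun p hp => ⟨?_, ?_, ?_, ?_⟩⟩
    · simpa [hη₀ p hp] using hχ₀ p hp
    · rw [hχ₂ p hp, key p hp]
      field_simp
      ring
    · exact key p hp
    · exact hη₀ p hp

end IdRows

/-! ### Bases for `f = u` with a source of degree at most two. -/

section QuadraticRows

variable {D : Set (Fin 3 → ℝ)} {J : Set ℝ}

theorem deriv_sq_add_const (c u : ℝ) : deriv (fun u : ℝ => u ^ 2 + c) u = 2 * u :=
  ((((hasDerivAt_id u).pow 2).add_const c).congr_deriv (by simp)).deriv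

theorem HasGrad.expY_one : HasGrad (fun _ y => Real.exp y) (fun _ _ => 0) (fun _ y => Real.exp y) :=
  HasGrad.ofY Real.contDiff_exp Real.hasDerivAt_exp

/-- The system is `η₁_t = η₀`, `η₀_t = k - η₁`, `η₁_y = η₁ + k`, `η₀_y = η₀`. Integrability forces
`k = 0`; then `exp (-y) (η₁, η₀)` rotates with `t`, and undoing the rotation gives two first
integrals. -/
theorem completesBasis_id_sq_add_one (hD : IsOpen D) (hD' : IsConnected D) (hJ : IsOpen J)
    (hJ' : IsConnected J) :
    CompletesBasis D J (fun u => u) (fun u => u ^ 2 + 1)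
      [vf fun t _ y u =>
          ![0, 0, Real.exp y * Real.sin t, Real.exp y * (Real.cos t + u * Real.sin t)],
        vf fun t _ y u =>
          ![0, 0, Real.exp y * Real.cos t, -(Real.exp y * (Real.sin t - u * Real.cos t))]] := by
  have gs : HasGrad (fun t _ => Real.sin t) _ _ :=
    HasGrad.ofT Real.contDiff_sin Real.hasDerivAt_sin
  have gc : HasGrad (fun t _ => Real.cos t) _ _ :=
    HasGrad.ofT Real.contDiff_cos Real.hasDerivAt_cos
  refine basis_of_solutions hD hD' hJ hJ' id_contDiffOn
    (id_nonconstOn hJ hJ'.nonempty) (fun c => 0)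
    (fun c => HasGrad.expY_one.mul ((gs.smul (c 0)).add (gc.smul (c 1))))
    (fun c => HasGrad.expY_one.mul ((gs.smul (c 0)).add (gc.smul (c 1))))
    (fun c => HasGrad.expY_one.mul ((gc.smul (c 0)).add (gs.smul (-(c 1)))))
    (fun c p => ?_) (fun c t y u hu => ?_)
    (fun c t y u hu => ?_) (fun c hl t y h1 h2 h3 h4 => ?_) (fun k χ η₁ η₀ R => ?_)
  · ext i; fin_cases i <;> simp [vf] <;> ring
  · rw [deriv_id'']; ring
  · rw [deriv_sq_add_const]; ring
  · have e1 := (mul_eq_zero.1 h3).resolve_left (Real.exp_ne_zero y)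
    have e2 := (mul_eq_zero.1 h4).resolve_left (Real.exp_ne_zero y)
    have e3 := Real.sin_sq_add_cos_sq t
    have f0 : c 0 = 0 := by linear_combination Real.sin t * e1 + Real.cos t * e2 - c 0 * e3
    have f1 : c 1 = 0 := by linear_combination Real.cos t * e1 - Real.sin t * e2 - c 1 * e3
    ext i; fin_cases i
    exacts [f0, f1]
  · have hU := isOpen_dom hD hJ
    have hU' := isConnected_dom hD' hJ'
    obtain ⟨hχ₀, hχ₂, -, -⟩ := R.id_case hU hJ hJ'.nonempty
    obtain ⟨a1, a2, a3, a4⟩ := R.quadratic_case (a := 1) (b := 0) (c := 1) hU hJ hJ'.nonempty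
      (fun u => by ring)
    have b2 : ∀ p ∈ dom D J, pd 0 η₁ p = η₀ p := fun p hp => by linarith [a2 p hp]
    have b4 : ∀ p ∈ dom D J, pd 2 η₀ p = η₀ p := fun p hp => by rw [a4 p hp, b2 p hp]
    have b3 : ∀ p ∈ dom D J, pd 0 η₀ p = (-1) * η₁ p + k := fun p hp => by linarith [a3 p hp]
    obtain ⟨p₀, hp₀⟩ := hU'.nonempty
    -- The mixed derivative of `η₀` is both `-(η₁ + k)` and `k - η₁`.
    have hk : k = 0 := by
      have e1 := pd_congr hU b3 hp₀ 2
      have e2 := pd_congr hU b4 hp₀ 0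
      rw [pd_add 2 ((R.planar_η₁.differentiableAt hU hp₀).const_mul _) (differentiableAt_const k),
        pd_const_mul 2 _ (R.planar_η₁.differentiableAt hU hp₀), pd_comm hU R.smooth_η₀ hp₀, e2,
        pd_eq_zero hU (c := k) (fun _ _ => rfl) hp₀, a1 p₀ hp₀, b3 p₀ hp₀] at e1
      linarith
    have c1 : ∀ p ∈ dom D J, pd 2 η₁ p = η₁ p := fun p hp => by rw [a1 p hp, hk]; ring
    have c3 : ∀ p ∈ dom D J, pd 0 η₀ p = -η₁ p := fun p hp => by rw [b3 p hp, hk]; ring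
    have pE := planar_lift (dom D J) (HasGrad.expY (-1))
    have pS := planar_lift (dom D J) gs
    have pC := planar_lift (dom D J) gc
    have ge := HasGrad.expY (-1)
    have d : ∀ {F : Pt → ℝ}, Planar (dom D J) F → ∀ {p}, p ∈ dom D J → DifferentiableAt ℝ F p :=
      fun h _ hp => h.differentiableAt hU hp
    have P1 := R.planar_η₁
    have P0 := R.planar_η₀
    -- The first integrals are `exp (-y) (sin t η₁ + cos t η₀)` and `exp (-y) (cos t η₁ - sin t
    -- η₀)`.
    obtain ⟨A, hA⟩ := (pE.mul hU ((pS.mul hU P1).add hU (pC.mul hU P0))).exists_const hU hU'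
      (fun p hp => by
        rw [pd_mul 0 (d pE hp) (d ((pS.mul hU P1).add hU (pC.mul hU P0)) hp),
          pd_add 0 (d (pS.mul hU P1) hp) (d (pC.mul hU P0) hp), pd_mul 0 (d pS hp) (d P1 hp),
          pd_mul 0 (d pC hp) (d P0 hp), gs.pd_zero, gc.pd_zero, ge.pd_zero, b2 p hp, c3 p hp]
        simp only [liftTY]
        ring)
      (fun p hp => by
        rw [pd_mul 2 (d pE hp) (d ((pS.mul hU P1).add hU (pC.mul hU P0)) hp),
          pd_add 2 (d (pS.mul hU P1) hp) (d (pC.mul hU P0) hp), pd_mul 2 (d pS hp) (d P1 hp),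
          pd_mul 2 (d pC hp) (d P0 hp), gs.pd_two, gc.pd_two, ge.pd_two, c1 p hp, b4 p hp]
        simp only [liftTY]
        ring)
    have pN := planar_const (dom D J) (-1)
    obtain ⟨B, hB⟩ := (pE.mul hU ((pC.mul hU P1).add hU (pN.mul hU (pS.mul hU P0)))).exists_const
      hU hU'
      (fun p hp => by
        rw [pd_mul 0 (d pE hp) (d ((pC.mul hU P1).add hU (pN.mul hU (pS.mul hU P0))) hp),
          pd_add 0 (d (pC.mul hU P1) hp) (d (pN.mul hU (pS.mul hU P0)) hp),
          pd_const_mul 0 _ (d (pS.mul hU P0) hp), pd_mul 0 (d pC hp) (d P1 hp),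
          pd_mul 0 (d pS hp) (d P0 hp), gs.pd_zero, gc.pd_zero, ge.pd_zero, b2 p hp, c3 p hp]
        simp only [liftTY]
        ring)
      (fun p hp => by
        rw [pd_mul 2 (d pE hp) (d ((pC.mul hU P1).add hU (pN.mul hU (pS.mul hU P0))) hp),
          pd_add 2 (d (pC.mul hU P1) hp) (d (pN.mul hU (pS.mul hU P0)) hp),
          pd_const_mul 2 _ (d (pS.mul hU P0) hp), pd_mul 2 (d pC hp) (d P1 hp),
          pd_mul 2 (d pS hp) (d P0 hp), gs.pd_two, gc.pd_two, ge.pd_two, c1 p hp, b4 p hp]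
        simp only [liftTY]
        ring)
    have N1 : ∀ p ∈ dom D J, η₁ p = Real.exp (p 2) * (A * Real.sin (p 0) + B * Real.cos (p 0)) :=
      fun p hp => by
        rw [← hA p hp, ← hB p hp]
        simp only [liftTY, neg_mul, one_mul, Real.exp_neg]
        field_simp
        linear_combination -η₁ p * Real.sin_sq_add_cos_sq (p 0)
    have N0 : ∀ p ∈ dom D J, η₀ p = Real.exp (p 2) * (A * Real.cos (p 0) + -B * Real.sin (p 0)) :=
      fun p hp => by
        rw [← hA p hp, ← hB p hp]
        simp only [liftTY, neg_mul, one_mul, Real.exp_neg]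
        field_simp
        linear_combination -η₀ p * Real.sin_sq_add_cos_sq (p 0)
    refine ⟨![A, B], hk, fun p hp => ⟨?_, ?_, ?_, ?_⟩⟩
    · rw [hχ₀ p hp, N0 p hp]; simp
    · rw [hχ₂ p hp, N1 p hp, hk]; simp
    · simpa using N1 p hp
    · simpa using N0 p hp

/-- The opposite sign turns the rotation into a hyperbolic one. After `k = 0` the system is
symmetric in `η₁` and `η₀`, so one computation yields both first integrals. -/
theorem completesBasis_id_sq_sub_one (hD : IsOpen D) (hD' : IsConnected D) (hJ : IsOpen J)
    (hJ' : IsConnected J) :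
    CompletesBasis D J (fun u => u) (fun u => u ^ 2 - 1)
      [vf fun t _ y u =>
          ![0, 0, Real.exp y * Real.sinh t, Real.exp y * (Real.cosh t + u * Real.sinh t)],
        vf fun t _ y u =>
          ![0, 0, Real.exp y * Real.cosh t, Real.exp y * (Real.sinh t + u * Real.cosh t)]] := by
  have gs : HasGrad (fun t _ => Real.sinh t) _ _ :=
    HasGrad.ofT Real.contDiff_sinh Real.hasDerivAt_sinh
  have gc : HasGrad (fun t _ => Real.cosh t) _ _ :=
    HasGrad.ofT Real.contDiff_cosh Real.hasDerivAt_cosh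
  refine basis_of_solutions hD hD' hJ hJ' id_contDiffOn
    (id_nonconstOn hJ hJ'.nonempty) (fun c => 0)
    (fun c => HasGrad.expY_one.mul ((gs.smul (c 0)).add (gc.smul (c 1))))
    (fun c => HasGrad.expY_one.mul ((gs.smul (c 0)).add (gc.smul (c 1))))
    (fun c => HasGrad.expY_one.mul ((gc.smul (c 0)).add (gs.smul (c 1))))
    (fun c p => ?_) (fun c t y u hu => ?_)
    (fun c t y u hu => ?_) (fun c hl t y h1 h2 h3 h4 => ?_) (fun k χ η₁ η₀ R => ?_)
  · ext i; fin_cases i <;> simp [vf] <;> ring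
  · rw [deriv_id'']; ring
  · simp only [sub_eq_add_neg]
    rw [deriv_sq_add_const]; ring
  · have e1 := (mul_eq_zero.1 h3).resolve_left (Real.exp_ne_zero y)
    have e2 := (mul_eq_zero.1 h4).resolve_left (Real.exp_ne_zero y)
    have e3 := Real.cosh_sq t
    have f0 : c 0 = 0 := by linear_combination -Real.sinh t * e1 + Real.cosh t * e2 - c 0 * e3
    have f1 : c 1 = 0 := by linear_combination Real.cosh t * e1 - Real.sinh t * e2 - c 1 * e3
    ext i; fin_cases i
    exacts [f0, f1]
  · have hU := isOpen_dom hD hJ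
    have hU' := isConnected_dom hD' hJ'
    obtain ⟨hχ₀, hχ₂, -, -⟩ := R.id_case hU hJ hJ'.nonempty
    obtain ⟨a1, a2, a3, a4⟩ := R.quadratic_case (a := 1) (b := 0) (c := -1) hU hJ hJ'.nonempty
      (fun u => by ring)
    have b2 : ∀ p ∈ dom D J, pd 0 η₁ p = η₀ p := fun p hp => by linarith [a2 p hp]
    have b4 : ∀ p ∈ dom D J, pd 2 η₀ p = η₀ p := fun p hp => by rw [a4 p hp, b2 p hp]
    have b3 : ∀ p ∈ dom D J, pd 0 η₀ p = η₁ p + -k := fun p hp => by linarith [a3 p hp]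
    obtain ⟨p₀, hp₀⟩ := hU'.nonempty
    have hk : k = 0 := by
      have e1 := pd_congr hU b3 hp₀ 2
      have e2 := pd_congr hU b4 hp₀ 0
      rw [pd_add 2 (R.planar_η₁.differentiableAt hU hp₀) (differentiableAt_const (-k)),
        pd_comm hU R.smooth_η₀ hp₀, e2,
        pd_eq_zero hU (c := -k) (fun _ _ => rfl) hp₀, a1 p₀ hp₀, b3 p₀ hp₀] at e1
      linarith
    have c1 : ∀ p ∈ dom D J, pd 2 η₁ p = η₁ p := fun p hp => by rw [a1 p hp, hk]; ring
    have c3 : ∀ p ∈ dom D J, pd 0 η₀ p = η₁ p := fun p hp => by rw [b3 p hp, hk]; ring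
    have pE := planar_lift (dom D J) (HasGrad.expY (-1))
    have pS := planar_lift (dom D J) gs
    have pC := planar_lift (dom D J) gc
    have ge := HasGrad.expY (-1)
    have d : ∀ {F : Pt → ℝ}, Planar (dom D J) F → ∀ {p}, p ∈ dom D J → DifferentiableAt ℝ F p :=
      fun h _ hp => h.differentiableAt hU hp
    have pN := planar_const (dom D J) (-1)
    -- both coefficients have the form `exp (-y) * (cosh t * F - sinh t * G)`
    have conv : ∀ {F G : Pt → ℝ}, Planar (dom D J) F → Planar (dom D J) G →
        (∀ p ∈ dom D J, pd 0 F p = G p ∧ pd 0 G p = F p ∧ pd 2 F p = F p ∧ pd 2 G p = G p) →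
        ∃ A, ∀ p ∈ dom D J,
          liftTY (fun _ y => Real.exp (-1 * y)) p * (liftTY (fun t _ => Real.cosh t) p * F p
            + -1 * (liftTY (fun t _ => Real.sinh t) p * G p)) = A :=
      fun {F G} PF PG h =>
        (pE.mul hU ((pC.mul hU PF).add hU (pN.mul hU (pS.mul hU PG)))).exists_const hU hU'
          (fun p hp => by
            rw [pd_mul 0 (d pE hp) (d ((pC.mul hU PF).add hU (pN.mul hU (pS.mul hU PG))) hp),
              pd_add 0 (d (pC.mul hU PF) hp) (d (pN.mul hU (pS.mul hU PG)) hp),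
              pd_const_mul 0 _ (d (pS.mul hU PG) hp), pd_mul 0 (d pC hp) (d PF hp),
              pd_mul 0 (d pS hp) (d PG hp), gs.pd_zero, gc.pd_zero, ge.pd_zero, (h p hp).1,
              (h p hp).2.1]
            simp only [liftTY]
            ring)
          (fun p hp => by
            rw [pd_mul 2 (d pE hp) (d ((pC.mul hU PF).add hU (pN.mul hU (pS.mul hU PG))) hp),
              pd_add 2 (d (pC.mul hU PF) hp) (d (pN.mul hU (pS.mul hU PG)) hp),
              pd_const_mul 2 _ (d (pS.mul hU PG) hp), pd_mul 2 (d pC hp) (d PF hp),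
              pd_mul 2 (d pS hp) (d PG hp), gs.pd_two, gc.pd_two, ge.pd_two, (h p hp).2.2.1,
              (h p hp).2.2.2]
            simp only [liftTY]
            ring)
    obtain ⟨A, hA⟩ := conv R.planar_η₀ R.planar_η₁
      fun p hp => ⟨c3 p hp, b2 p hp, b4 p hp, c1 p hp⟩
    obtain ⟨B, hB⟩ := conv R.planar_η₁ R.planar_η₀
      fun p hp => ⟨b2 p hp, c3 p hp, c1 p hp, b4 p hp⟩
    have N1 : ∀ p ∈ dom D J, η₁ p = Real.exp (p 2) * (A * Real.sinh (p 0) + B * Real.cosh (p 0)) :=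
      fun p hp => by
        rw [← hA p hp, ← hB p hp]
        simp only [liftTY, neg_mul, one_mul, Real.exp_neg]
        field_simp
        linear_combination -η₁ p * Real.cosh_sq (p 0)
    have N0 : ∀ p ∈ dom D J, η₀ p = Real.exp (p 2) * (A * Real.cosh (p 0) + B * Real.sinh (p 0)) :=
      fun p hp => by
        rw [← hA p hp, ← hB p hp]
        simp only [liftTY, neg_mul, one_mul, Real.exp_neg]
        field_simp
        linear_combination -η₀ p * Real.cosh_sq (p 0)
    refine ⟨![A, B], hk, fun p hp => ⟨?_, ?_, ?_, ?_⟩⟩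
    · rw [hχ₀ p hp, N0 p hp]; simp
    · rw [hχ₂ p hp, N1 p hp, hk]; simp
    · simpa using N1 p hp
    · simpa using N0 p hp

theorem completesBasis_id_linear (hD : IsOpen D) (hD' : IsConnected D) (hJ : IsOpen J)
    (hJ' : IsConnected J) {ε : ℝ} (hε : IsSign ε) :
    CompletesBasis D J (fun u => u) (fun u => ε * u)
      [vf fun _ _ y u => ![0, 0, y, u],
        vf fun t _ _ _ => ![0, 0, Real.exp (ε * t), Real.exp (ε * t) * ε]] := by
  have hg : ∀ u, deriv (fun u => ε * u) u = ε := fun u => by simp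
  refine basis_of_solutions hD hD' hJ hJ' id_contDiffOn
    (id_nonconstOn hJ hJ'.nonempty) (fun c => 0)
    (fun c => (HasGrad.y.smul (c 0)).add ((HasGrad.expT ε).smul (c 1)))
    (fun c => HasGrad.const (c 0))
    (fun c => (HasGrad.expT ε).smul (c 1 * ε))
    (fun c p => ?_) (fun c t y u hu => ?_)
    (fun c t y u hu => ?_) (fun c hl t y h1 h2 h3 h4 => ?_) (fun k χ η₁ η₀ R => ?_)
  · ext i; fin_cases i <;> simp [vf] <;> ring
  · rw [deriv_id'']; ring
  · rw [hg]; ring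
  · ext i; fin_cases i
    · exact h3
    · simpa [hε.ne_zero] using h4
  · have hU := isOpen_dom hD hJ
    have hU' := isConnected_dom hD' hJ'
    obtain ⟨hχ₀, hχ₂, -, -⟩ := R.id_case hU hJ hJ'.nonempty
    obtain ⟨a1, a2, a3, a4⟩ := R.quadratic_case (a := 0) (b := ε) (c := 0) hU hJ hJ'.nonempty
      (fun u => by ring)
    have b3 : ∀ p ∈ dom D J, pd 0 η₀ p = ε * η₀ p := fun p hp => by linarith [a3 p hp]
    have b2 : ∀ p ∈ dom D J, pd 0 η₁ p = ε * k / 2 := fun p hp => by linarith [a2 p hp]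
    have b4 : ∀ p ∈ dom D J, pd 2 η₀ p = ε * k / 2 := fun p hp => by rw [a4 p hp, b2 p hp]
    obtain ⟨p₀, hp₀⟩ := hU'.nonempty
    -- The derivative `η₀_y = ε k / 2` is constant, while `η₀_t = ε η₀` gives `η₀_ty = ε² k / 2`.
    have hk : k = 0 := by
      have e1 := pd_congr hU b3 hp₀ 2
      rw [pd_const_mul 2 _ (R.planar_η₀.differentiableAt hU hp₀), pd_comm hU R.smooth_η₀ hp₀,
        pd_eq_zero hU b4 hp₀, b4 p₀ hp₀] at e1
      linear_combination -2 * e1 - k * hε.mul_self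
    obtain ⟨d, hd⟩ := R.planar_η₁.exists_const hU hU' (fun p hp => by rw [b2 p hp, hk]; ring)
      (fun p hp => by rw [a1 p hp]; ring)
    obtain ⟨d', hd'⟩ := R.planar_η₀.exists_exp_t hU hU' b3 (fun p hp => by rw [b4 p hp, hk]; ring)
    have N0 : ∀ p ∈ dom D J, η₀ p = d' * ε * ε * Real.exp (ε * p 0) := fun p hp => by
      linear_combination hd' p hp - d' * Real.exp (ε * p 0) * hε.mul_self
    refine ⟨![d, d' * ε], hk, fun p hp => ⟨?_, ?_, ?_, ?_⟩⟩
    · rw [hχ₀ p hp, N0 p hp]; simp; ring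
    · rw [hχ₂ p hp, hd p hp, hk]; simp
    · simpa using hd p hp
    · simpa using N0 p hp

theorem completesBasis_id_sq (hD : IsOpen D) (hD' : IsConnected D) (hJ : IsOpen J)
    (hJ' : IsConnected J) :
    CompletesBasis D J (fun u => u) (fun u => u ^ 2)
      [vf fun t x _ u => ![t, x / 2, 0, -u],
        vf fun _ _ y u => ![0, 0, Real.exp y, Real.exp y * u],
        vf fun t _ y u => ![0, 0, Real.exp y * t, Real.exp y * (t * u + 1)]] := by
  have hg : ∀ u, deriv (fun u : ℝ => u ^ 2) u = 2 * u := fun u => by simp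
  have gX : ∀ c : Fin 3 → ℝ, HasGrad (fun t y => Real.exp y * (c 1 + c 2 * t)) _ _ := fun c =>
    HasGrad.expY_one.mul ((HasGrad.const (c 1)).add (HasGrad.t.smul (c 2)))
  refine basis_of_solutions hD hD' hJ hJ' id_contDiffOn
    (id_nonconstOn hJ hJ'.nonempty) (fun c => c 0)
    gX (fun c => (gX c).add (HasGrad.const (-(c 0)))) (fun c => HasGrad.expY_one.smul (c 2))
    (fun c p => ?_) (fun c t y u hu => ?_)
    (fun c t y u hu => ?_) (fun c hl t y h1 h2 h3 h4 => ?_) (fun k χ η₁ η₀ R => ?_)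
  · ext i; fin_cases i <;> simp [vf, Fin.sum_univ_three] <;> ring
  · rw [deriv_id'']; ring
  · rw [hg]; ring
  · have e2 : c 2 = 0 := by simpa using h4
    have e1 : c 1 = 0 := by simpa [hl, e2] using h3
    ext i; fin_cases i
    exacts [hl, e1, e2]
  · have hU := isOpen_dom hD hJ
    have hU' := isConnected_dom hD' hJ'
    obtain ⟨hχ₀, hχ₂, -, -⟩ := R.id_case hU hJ hJ'.nonempty
    obtain ⟨a1, a2, a3, a4⟩ := R.quadratic_case (a := 1) (b := 0) (c := 0) hU hJ hJ'.nonempty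
      (fun u => by ring)
    have b2 : ∀ p ∈ dom D J, pd 0 η₁ p = η₀ p := fun p hp => by linarith [a2 p hp]
    obtain ⟨d, hd⟩ := R.planar_η₀.exists_exp_y (c := 1) hU hU'
      (fun p hp => by rw [a3 p hp]; ring) (fun p hp => by rw [a4 p hp, b2 p hp, one_mul])
    have pT := planar_lift (dom D J) (HasGrad.t.smul (-1))
    have P1 := R.planar_η₁.add hU (planar_const (dom D J) k)
    have PT := pT.mul hU R.planar_η₀
    have q1 : ∀ i, ∀ p ∈ dom D J, pd i (fun p => η₁ p + k) p = pd i η₁ p := fun i p hp => by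
      rw [pd_add i (R.planar_η₁.differentiableAt hU hp) (differentiableAt_const k),
        pd_eq_zero hU (c := k) (fun _ _ => rfl) hp, add_zero]
    -- The combination `η₁ + k - t η₀` has zero `t`-derivative and equals its own `y`-derivative.
    obtain ⟨d', hd'⟩ := (P1.add hU PT).exists_exp_y (c := 1) hU hU'
      (fun p hp => by
        rw [pd_add 0 (P1.differentiableAt hU hp) (PT.differentiableAt hU hp),
          pd_mul 0 (pT.differentiableAt hU hp) (R.planar_η₀.differentiableAt hU hp), q1 0 p hp,
          (HasGrad.t.smul (-1)).pd_zero, b2 p hp, a3 p hp]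
        ring)
      (fun p hp => by
        rw [pd_add 2 (P1.differentiableAt hU hp) (PT.differentiableAt hU hp),
          pd_mul 2 (pT.differentiableAt hU hp) (R.planar_η₀.differentiableAt hU hp), q1 2 p hp,
          (HasGrad.t.smul (-1)).pd_two, a1 p hp, a4 p hp, b2 p hp]
        ring)
    have N0 : ∀ p ∈ dom D J, η₀ p = d * Real.exp (p 2) := fun p hp => by simpa using hd p hp
    have N1 : ∀ p ∈ dom D J, η₁ p + k = Real.exp (p 2) * (d' + d * p 0) := fun p hp => by
      have := hd' p hp
      rw [N0 p hp] at this
      simp only [liftTY, one_mul] at this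
      linear_combination this
    refine ⟨![k, d', d], rfl, fun p hp => ⟨?_, ?_, ?_, ?_⟩⟩
    · rw [hχ₀ p hp, N0 p hp]; simp; ring
    · rw [hχ₂ p hp, N1 p hp]; simp
    · simp
      linear_combination N1 p hp
    · simpa using N0 p hp

theorem completesBasis_id_const (hD : IsOpen D) (hD' : IsConnected D) (hJ : IsOpen J)
    (hJ' : IsConnected J) (ε : ℝ) :
    CompletesBasis D J (fun u => u) (fun _ => ε)
      [vf fun t x _ u => ![t, x / 2, ε * t ^ 2, 2 * ε * t - u],
        vf fun t _ _ _ => ![0, 0, t, 1],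
        vf fun t _ y u => ![0, 0, y - 1 / 2 * ε * t ^ 2, u - ε * t]] := by
  refine basis_of_solutions hD hD' hJ hJ' id_contDiffOn
    (id_nonconstOn hJ hJ'.nonempty) (fun c => c 0)
    (fun c => (((HasGrad.t.mul HasGrad.t).smul (c 0 * ε - c 2 * ε / 2)).add
      (HasGrad.t.smul (c 1))).add (HasGrad.y.smul (c 2)))
    (fun c => HasGrad.const (c 2 - c 0))
    (fun c => (HasGrad.t.smul (2 * ε * c 0 - ε * c 2)).add (HasGrad.const (c 1)))
    (fun c p => ?_) (fun c t y u hu => ?_)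
    (fun c t y u hu => ?_) (fun c hl t y h1 h2 h3 h4 => ?_) (fun k χ η₁ η₀ R => ?_)
  · ext i; fin_cases i <;> simp [vf, Fin.sum_univ_three] <;> ring
  · rw [deriv_id'']; ring
  · rw [deriv_const]; ring
  · have hl' : c 0 = 0 := hl
    have e2 : c 2 = 0 := by simpa [hl'] using h3
    have e1 : c 1 = 0 := by simpa [hl', e2] using h4
    ext i; fin_cases i
    exacts [hl', e1, e2]
  · have hU := isOpen_dom hD hJ
    have hU' := isConnected_dom hD' hJ'
    obtain ⟨hχ₀, hχ₂, -, -⟩ := R.id_case hU hJ hJ'.nonempty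
    obtain ⟨a1, a2, a3, a4⟩ := R.quadratic_case (a := 0) (b := 0) (c := ε) hU hJ hJ'.nonempty
      (fun u => by ring)
    have b2 : ∀ p ∈ dom D J, pd 0 η₁ p = 0 := fun p hp => by linarith [a2 p hp]
    obtain ⟨d, hd⟩ := R.planar_η₁.exists_const hU hU' b2 (fun p hp => by rw [a1 p hp]; ring)
    obtain ⟨d', hd'⟩ := R.planar_η₀.exists_affine_t (c := ε * (k - d)) hU hU'
      (fun p hp => by rw [a3 p hp, hd p hp]; ring) (fun p hp => by rw [a4 p hp, b2 p hp])
    -- The first generator contributes `-k` to `η₁ = d`, which the third one has to compensate.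
    refine ⟨![k, d', d + k], rfl, fun p hp => ⟨?_, ?_, ?_, ?_⟩⟩
    · rw [hχ₀ p hp, hd' p hp]; simp; ring
    · rw [hχ₂ p hp, hd p hp]; simp
    · rw [hd p hp]; simp
    · rw [hd' p hp]
      simp only [Matrix.cons_val_zero, Matrix.cons_val_one, Matrix.cons_val]
      ring

theorem completesBasis_id_zero (hD : IsOpen D) (hD' : IsConnected D) (hJ : IsOpen J)
    (hJ' : IsConnected J) :
    CompletesBasis D J (fun u => u) (fun _ => 0)
      [vf fun t x y _ => ![t, x / 2, y, 0],
        vf fun t _ _ _ => ![0, 0, t, 1],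
        vf fun _ _ y u => ![0, 0, y, u]] := by
  refine basis_of_solutions hD hD' hJ hJ' id_contDiffOn
    (id_nonconstOn hJ hJ'.nonempty) (fun c => c 0)
    (fun c => (HasGrad.t.smul (c 1)).add (HasGrad.y.smul (c 0 + c 2)))
    (fun c => HasGrad.const (c 2)) (fun c => HasGrad.const (c 1))
    (fun c p => ?_) (fun c t y u hu => ?_)
    (fun c t y u hu => ?_) (fun c hl t y h1 h2 h3 h4 => ?_) (fun k χ η₁ η₀ R => ?_)
  · ext i; fin_cases i <;> simp [vf, Fin.sum_univ_three] <;> ring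
  · rw [deriv_id'']; ring
  · rw [deriv_const]; ring
  · ext i; fin_cases i
    exacts [hl, h4, h3]
  · have hU := isOpen_dom hD hJ
    have hU' := isConnected_dom hD' hJ'
    obtain ⟨hχ₀, hχ₂, -, -⟩ := R.id_case hU hJ hJ'.nonempty
    obtain ⟨a1, a2, a3, a4⟩ := R.quadratic_case (a := 0) (b := 0) (c := 0) hU hJ hJ'.nonempty
      (fun u => by ring)
    have b2 : ∀ p ∈ dom D J, pd 0 η₁ p = 0 := fun p hp => by linarith [a2 p hp]
    obtain ⟨d, hd⟩ := R.planar_η₁.exists_const hU hU' b2 (fun p hp => by rw [a1 p hp]; ring)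
    obtain ⟨d', hd'⟩ := R.planar_η₀.exists_const hU hU'
      (fun p hp => by rw [a3 p hp]; ring) (fun p hp => by rw [a4 p hp, b2 p hp])
    refine ⟨![k, d', d], rfl, fun p hp => ⟨?_, ?_, ?_, ?_⟩⟩
    · rw [hχ₀ p hp, hd' p hp]; simp
    · rw [hχ₂ p hp, hd p hp]; simp; ring
    · rw [hd p hp]; simp
    · rw [hd' p hp]; simp

end QuadraticRows

/-! ### The equation without source and with general `f`. -/

section GeneralRow

variable {D : Set (Fin 3 → ℝ)} {J : Set ℝ}

/-- If no equation `(a u + b) f' = c + d f` with `(a, b) ≠ 0` holds for `f`, then the equation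
without source term admits only the scaling symmetry in addition to the kernel. -/
theorem completesBasis_generic_zero (hD : IsOpen D) (hD' : IsConnected D) (hJ : IsOpen J)
    (hJ' : IsConnected J) {f : ℝ → ℝ} (hf : ContDiffOn ℝ ∞ f J) (hc : NonconstOn f J)
    (hgen : ∀ a b c d : ℝ, (∀ u ∈ J, (a * u + b) * deriv f u = c + f u * d) → a = 0 ∧ b = 0) :
    CompletesBasis D J f (fun _ => 0) [vf fun t x y _ => ![t, x / 2, y, 0]] := by
  refine basis_of_solutions hD hD' hJ hJ' hf hc (fun c => c 0)
    (fun c => HasGrad.y.smul (c 0)) (fun c => HasGrad.const 0)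
    (fun c => HasGrad.const 0) (fun c p => ?_) (fun c t y u hu => ?_)
    (fun c t y u hu => ?_) (fun c hl t y h1 h2 h3 h4 => ?_) (fun k χ η₁ η₀ R => ?_)
  · ext i; fin_cases i <;> simp [vf]; ring
  · ring
  · ring
  · ext i; fin_cases i; exact hl
  · refine ⟨fun _ => k, rfl, fun p hp => ?_⟩
    obtain ⟨e1, e0⟩ := hgen _ _ _ _ fun u hu => R.eq_f p hp u hu
    have key : ∀ u ∈ J, 0 = pd 0 χ p + f u * (pd 2 χ p - k) := fun u hu => by
      have := R.eq_f p hp u hu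
      rw [e1, e0] at this
      linarith
    obtain ⟨u, hu, v, hv, huv⟩ := hc
    have e2 : (f u - f v) * (pd 2 χ p - k) = 0 := by linear_combination key v hv - key u hu
    have e3 := (mul_eq_zero.1 e2).resolve_left (sub_ne_zero.2 huv)
    have e4 := key u hu
    rw [e3] at e4
    exact ⟨by simp; linarith, by simp; linarith, e1, e0⟩

end GeneralRow

/-! ### The ordinary differential equations satisfied by `f` and `g`. -/

section ODE

variable {J : Set ℝ} {φ : ℝ → ℝ} {m k : ℝ}

theorem hasDerivAt_of_smoothOn (hJ : IsOpen J) (hφ : ContDiffOn ℝ ∞ φ J) {u : ℝ} (hu : u ∈ J) :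
    HasDerivAt φ (deriv φ u) u :=
  ((hφ.contDiffAt (hJ.mem_nhds hu)).differentiableAt (by simp)).hasDerivAt

theorem smoothOn_deriv (hJ : IsOpen J) (hφ : ContDiffOn ℝ ∞ φ J) : ContDiffOn ℝ ∞ (deriv φ) J :=
  hφ.deriv_of_isOpen (m := ∞) hJ (by simp)

theorem exists_const_of_hasDerivAt_zero (hJ : IsOpen J) (hJ' : IsConnected J)
    (h : ∀ u ∈ J, HasDerivAt φ 0 u) : ∃ c, ∀ u ∈ J, φ u = c := by
  obtain ⟨u₀, hu₀⟩ := hJ'.nonempty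
  exact ⟨φ u₀, fun u hu => hJ.is_const_of_deriv_eq_zero hJ'.isPreconnected
    (fun v hv => (h v hv).differentiableAt.differentiableWithinAt) (fun v hv => (h v hv).deriv)
    hu hu₀⟩

theorem exists_exp_of_deriv (hJ : IsOpen J) (hJ' : IsConnected J) (hφ : ContDiffOn ℝ ∞ φ J)
    (h : ∀ u ∈ J, deriv φ u = k * φ u) : ∃ K, ∀ u ∈ J, φ u = K * Real.exp (k * u) := by
  obtain ⟨K, hK⟩ := exists_const_of_hasDerivAt_zero (φ := fun u => φ u * Real.exp (-k * u)) hJ hJ'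
    (fun u hu => ((hasDerivAt_of_smoothOn hJ hφ hu).mul (hasDerivAt_exp_mul (-k) u)).congr_deriv
      (by rw [h u hu]; ring))
  refine ⟨K, fun u hu => ?_⟩
  rw [← hK u hu, mul_assoc, ← Real.exp_add]
  simp

theorem exists_rpow_of_pos (hJ : IsOpen J) (hJ' : IsConnected J) (hpos : J ⊆ Set.Ioi 0)
    (hφ : ContDiffOn ℝ ∞ φ J) (h : ∀ u ∈ J, u * deriv φ u = m * φ u) :
    ∃ K, ∀ u ∈ J, φ u = K * u ^ m := by
  obtain ⟨K, hK⟩ := exists_const_of_hasDerivAt_zero (φ := fun u => φ u * u ^ (-m)) hJ hJ'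
    (fun u hu => ((hasDerivAt_of_smoothOn hJ hφ hu).mul
      (Real.hasDerivAt_rpow_const (Or.inl (hpos hu).ne'))).congr_deriv (by
        have hu0 : u ≠ 0 := (hpos hu).ne'
        rw [Real.rpow_sub_one hu0]
        field_simp
        linear_combination u ^ (-m) * h u hu))
  refine ⟨K, fun u hu => ?_⟩
  have hu0 : 0 < u := hpos hu
  rw [← hK u hu, mul_assoc, ← Real.rpow_add hu0]
  simp

/-- The smooth solutions of `u φ' = m φ` around zero are monomials. -/
theorem eq_monomial_of_zero_mem (hJ : IsOpen J) (hJ' : IsConnected J) (h0 : (0 : ℝ) ∈ J) (n : ℕ)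
    (hm : m < n) (hφ : ContDiffOn ℝ ∞ φ J) (h : ∀ u ∈ J, u * deriv φ u = m * φ u) :
    (∀ u ∈ J, φ u = 0) ∨ ∃ (k : ℕ) (K : ℝ), m = k ∧ ∀ u ∈ J, φ u = K * u ^ k := by
  induction n generalizing m φ with
  | zero =>
    left
    have hm' : m < 0 := by simpa using hm
    have z0 : φ 0 = 0 := by
      have := h 0 h0
      rw [zero_mul] at this
      exact (mul_eq_zero.1 this.symm).resolve_left hm'.ne
    have hE : ∀ u ∈ J, HasDerivAt (fun u => φ u ^ 2) (2 * φ u * deriv φ u) u := fun u hu =>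
      ((hasDerivAt_of_smoothOn hJ hφ hu).pow 2).congr_deriv (by simp)
    -- For `m < 0` the function `φ²` decreases away from zero, where it vanishes; hence `φ = 0`.
    have hsign : ∀ u ∈ J, u * (2 * φ u * deriv φ u) ≤ 0 := fun u hu => by
      have e : u * (2 * φ u * deriv φ u) = 2 * m * φ u ^ 2 := by
        linear_combination 2 * φ u * h u hu
      rw [e]
      nlinarith [sq_nonneg (φ u)]
    have hoc : Set.OrdConnected J := hJ'.isPreconnected.ordConnected
    have hcont : ContinuousOn (fun u => φ u ^ 2) J := fun u hu =>
      (hE u hu).continuousAt.continuousWithinAt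
    intro u hu
    have hle : φ u ^ 2 ≤ φ 0 ^ 2 := by
      rcases le_total 0 u with hu0 | hu0
      · have hsub : Set.Icc 0 u ⊆ J := hoc.out h0 hu
        refine antitoneOn_of_deriv_nonpos (convex_Icc 0 u) (hcont.mono hsub) ?_ ?_
          (Set.left_mem_Icc.2 hu0) (Set.right_mem_Icc.2 hu0) hu0
        · intro v hv
          exact (hE v (hsub (interior_subset hv))).differentiableAt.differentiableWithinAt
        · intro v hv
          have hvJ := hsub (interior_subset hv)
          rw [(hE v hvJ).deriv]
          rw [interior_Icc] at hv
          have := hsign v hvJ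
          by_contra hpos
          push Not at hpos
          nlinarith [mul_pos hv.1 hpos]
      · have hsub : Set.Icc u 0 ⊆ J := hoc.out hu h0
        refine monotoneOn_of_deriv_nonneg (convex_Icc u 0) (hcont.mono hsub) ?_ ?_
          (Set.left_mem_Icc.2 hu0) (Set.right_mem_Icc.2 hu0) hu0
        · intro v hv
          exact (hE v (hsub (interior_subset hv))).differentiableAt.differentiableWithinAt
        · intro v hv
          have hvJ := hsub (interior_subset hv)
          rw [(hE v hvJ).deriv]
          rw [interior_Icc] at hv
          have := hsign v hvJ
          by_contra hneg
          push Not at hneg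
          nlinarith [mul_pos_of_neg_of_neg hv.2 hneg]
    rw [z0] at hle
    have : φ u ^ 2 = 0 := le_antisymm (by simpa using hle) (sq_nonneg _)
    exact pow_eq_zero_iff (two_ne_zero) |>.1 this
  | succ n ih =>
    -- The derivative solves the same equation with `m - 1`, so the induction lowers `m` until it is
    -- negative.
    have hd : ∀ u ∈ J, u * deriv (deriv φ) u = (m - 1) * deriv φ u := fun u hu => by
      have d1 := hasDerivAt_of_smoothOn hJ hφ hu
      have d2 := hasDerivAt_of_smoothOn hJ (smoothOn_deriv hJ hφ) hu
      have h1 : HasDerivAt (fun u => u * deriv φ u - m * φ u)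
          (1 * deriv φ u + u * deriv (deriv φ) u - m * deriv φ u) u :=
        ((hasDerivAt_id u).mul d2).sub (d1.const_mul m)
      have := hasDerivAt_eq_zero hJ (c := 0) (fun v hv => by rw [h v hv, sub_self]) hu h1
      linear_combination this
    have hm1 : m - 1 < n := by push_cast at hm; linarith
    -- For `m = 0` the derivative belongs to the exponent `-1` and vanishes; otherwise `φ = u φ' /
    -- m`.
    by_cases hm0 : m = 0
    · right
      rcases ih hm1 (smoothOn_deriv hJ hφ) hd with hz | ⟨k, K, hk, -⟩
      · obtain ⟨c, hc⟩ := exists_const_of_hasDerivAt_zero hJ hJ' (fun u hu => by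
          have := hasDerivAt_of_smoothOn hJ hφ hu
          rwa [hz u hu] at this)
        exact ⟨0, c, by simpa using hm0, fun u hu => by simpa using hc u hu⟩
      · rw [hm0] at hk
        have : (0 : ℝ) ≤ k := k.cast_nonneg
        linarith
    · rcases ih hm1 (smoothOn_deriv hJ hφ) hd with hz | ⟨k, K, hk, hK⟩
      · left
        intro u hu
        have := h u hu
        rw [hz u hu, mul_zero] at this
        exact (mul_eq_zero.1 this.symm).resolve_left hm0
      · right
        refine ⟨k + 1, K / m, by push_cast; linarith, fun u hu => ?_⟩
        have := h u hu
        rw [hK u hu] at this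
        field_simp
        rw [pow_succ]
        linear_combination -this

/-- On positive intervals every exponent occurs. Across zero, smoothness forces a natural exponent,
with the same constant on both sides, unless `φ = 0`. -/
theorem exists_rpow_of_mul_deriv (hJ : IsOpen J) (hJ' : IsConnected J)
    (hJ0 : J ⊆ Set.Ioi 0 ∨ (0 : ℝ) ∈ J) (hφ : ContDiffOn ℝ ∞ φ J)
    (h : ∀ u ∈ J, u * deriv φ u = m * φ u) :
    ∃ K, (∀ u ∈ J, φ u = K * u ^ m) ∧ (K ≠ 0 → PowDomain m J) := by
  rcases hJ0 with hpos | h0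
  · obtain ⟨K, hK⟩ := exists_rpow_of_pos hJ hJ' hpos hφ h
    exact ⟨K, hK, fun _ u hu => Or.inl (hpos hu)⟩
  · obtain ⟨n, hn⟩ := exists_nat_gt m
    rcases eq_monomial_of_zero_mem hJ hJ' h0 n hn hφ h with hz | ⟨k, K, rfl, hK⟩
    · exact ⟨0, fun u hu => by rw [hz u hu, zero_mul], fun h => absurd rfl h⟩
    · exact ⟨K, fun u hu => by rw [hK u hu, Real.rpow_natCast], fun _ => powDomain_natCast k J⟩

/-- A continuous function which vanishes off a point of an open set vanishes there too. -/
theorem eq_zero_of_add_mul_eq_zero (hJ : IsOpen J) {ψ : ℝ → ℝ} (hψ : ContinuousOn ψ J) {b : ℝ}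
    (h : ∀ u ∈ J, (u + b) * ψ u = 0) : ∀ u ∈ J, ψ u = 0 := by
  intro u hu
  by_contra hne
  have hev : ∀ᶠ v in nhds u, v ∈ J ∧ ψ v ≠ 0 :=
    Filter.Eventually.and (hJ.mem_nhds hu) ((hψ.continuousAt (hJ.mem_nhds hu)).eventually_ne hne)
  obtain ⟨v, ⟨hv, hv'⟩, hvu⟩ :=
    ((hev.filter_mono nhdsWithin_le_nhds).and
      (self_mem_nhdsWithin : {u}ᶜ ∈ nhdsWithin u {u}ᶜ)).exists
  have e1 := (mul_eq_zero.1 (h u hu)).resolve_right hne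
  have e2 := (mul_eq_zero.1 (h v hv)).resolve_right hv'
  exact hvu (by rw [Set.mem_singleton_iff]; linarith)

end ODE

/-! ### Affine changes of `u`. -/

section AffineImage

variable {J : Set ℝ} {s σ : ℝ}

/-- The image of a set of values of `u` under `u ↦ s u + σ`. -/
def affImage (s σ : ℝ) (J : Set ℝ) : Set ℝ := (fun u => s * u + σ) '' J

theorem mem_affImage (hs : s ≠ 0) {w : ℝ} : w ∈ affImage s σ J ↔ (w - σ) / s ∈ J := by
  constructor
  · rintro ⟨u, hu, rfl⟩
    simpa [hs] using hu
  · intro h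
    exact ⟨_, h, by field_simp; ring⟩

theorem isOpen_affImage (hs : s ≠ 0) (hJ : IsOpen J) : IsOpen (affImage s σ J) := by
  have : affImage s σ J = (fun w => (w - σ) / s) ⁻¹' J := by
    ext w; exact mem_affImage hs
  rw [this]
  exact hJ.preimage (by fun_prop)

theorem isConnected_affImage (hJ : IsConnected J) : IsConnected (affImage s σ J) :=
  hJ.image _ (by fun_prop)

theorem smoothOn_comp_affine (hs : s ≠ 0) {f : ℝ → ℝ} (hf : ContDiffOn ℝ ∞ f J) :
    ContDiffOn ℝ ∞ (fun w => f ((w - σ) / s)) (affImage s σ J) := by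
  have h1 : ContDiffOn ℝ ∞ (fun w : ℝ => (w - σ) / s) (affImage s σ J) :=
    ((contDiff_id.sub contDiff_const).div_const s).contDiffOn
  exact hf.comp h1 fun w hw => (mem_affImage hs).1 hw

theorem deriv_comp_affine (hs : s ≠ 0) {f : ℝ → ℝ} {w : ℝ} :
    deriv (fun w => f ((w - σ) / s)) w = deriv f ((w - σ) / s) / s := by
  have h1 : (fun w => f ((w - σ) / s)) = fun w => (fun v => f (s⁻¹ * v)) (w - σ) := by
    funext w; congr 1; field_simp
  rw [h1, deriv_comp_sub_const (fun v => f (s⁻¹ * v)) σ, deriv_comp_mul_left s⁻¹ f]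
  rw [smul_eq_mul, show s⁻¹ * (w - σ) = (w - σ) / s by field_simp]
  field_simp

/-- After a shift and possibly a reflection, an interval contains zero or lies to the right of
zero. -/
theorem exists_reflection (hJ' : IsConnected J) (b : ℝ) : ∃ ε : ℝ, IsSign ε ∧
    (affImage ε (ε * b) J ⊆ Set.Ioi 0 ∨ (0 : ℝ) ∈ affImage ε (ε * b) J) := by
  by_cases h0 : (0 : ℝ) ∈ affImage 1 (1 * b) J
  · exact ⟨1, Or.inl rfl, Or.inr h0⟩
  have hne : ∀ u ∈ J, u + b ≠ 0 := fun u hu h => h0 ⟨u, hu, by simpa using h⟩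
  have hoc : Set.OrdConnected J := hJ'.isPreconnected.ordConnected
  obtain ⟨u₀, hu₀⟩ := hJ'.nonempty
  rcases lt_or_gt_of_ne (hne u₀ hu₀) with hlt | hgt
  · refine ⟨-1, Or.inr rfl, Or.inl ?_⟩
    rintro _ ⟨u, hu, rfl⟩
    by_contra hcon
    simp only [Set.mem_Ioi, not_lt] at hcon
    exact hne (-b) (hoc.out hu₀ hu ⟨by linarith, by linarith⟩) (by ring)
  · refine ⟨1, Or.inl rfl, Or.inl ?_⟩
    rintro _ ⟨u, hu, rfl⟩
    by_contra hcon
    simp only [Set.mem_Ioi, not_lt] at hcon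
    exact hne (-b) (hoc.out hu hu₀ ⟨by linarith, by linarith⟩) (by ring)

/-- Solutions of `(u + b) φ' = m φ`. -/
theorem exists_rpow_of_add_mul_deriv (hJ : IsOpen J) (hJ' : IsConnected J) {φ : ℝ → ℝ} {b m : ℝ}
    (hφ : ContDiffOn ℝ ∞ φ J) (h : ∀ u ∈ J, (u + b) * deriv φ u = m * φ u) :
    ∃ ε K : ℝ, IsSign ε ∧
      (affImage ε (ε * b) J ⊆ Set.Ioi 0 ∨ (0 : ℝ) ∈ affImage ε (ε * b) J) ∧
      (∀ u ∈ J, φ u = K * (ε * u + ε * b) ^ m) ∧ (K ≠ 0 → PowDomain m (affImage ε (ε * b) J)) := by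
  obtain ⟨ε, hε, h0⟩ := exists_reflection hJ' b
  obtain ⟨K, hK, hp⟩ := exists_rpow_of_mul_deriv (m := m) (isOpen_affImage hε.ne_zero hJ)
    (isConnected_affImage hJ') h0 (smoothOn_comp_affine hε.ne_zero hφ) (fun w hw => by
      obtain ⟨u, hu, rfl⟩ := hw
      have e : (ε * u + ε * b - ε * b) / ε = u := by field_simp [hε.ne_zero]; ring
      rw [deriv_comp_affine hε.ne_zero, e, ← h u hu]
      field_simp [hε.ne_zero])
  refine ⟨ε, K, hε, h0, fun u hu => ?_, hp⟩
  have := hK _ ⟨u, hu, rfl⟩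
  have e : (ε * u + ε * b - ε * b) / ε = u := by field_simp [hε.ne_zero]; ring
  rwa [e] at this

end AffineImage

/-! ### Normal forms of `f`. -/

section NormalForm

variable {J : Set ℝ} {f : ℝ → ℝ}

/-- The functions to which the solutions of `(a u + b) f' = c + d f` reduce. -/
def IsNormalForm (J : Set ℝ) (F : ℝ → ℝ) : Prop :=
  F = Real.exp ∨ (F = Real.log ∧ J ⊆ Set.Ioi 0) ∨
    ∃ m : ℝ, m ≠ 0 ∧ PowDomain m J ∧ (m = 1 ∨ J ⊆ Set.Ioi 0 ∨ (0 : ℝ) ∈ J) ∧ F = fun u => u ^ m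

theorem IsNormalForm.isSpecial {F : ℝ → ℝ} (h : IsNormalForm J F) : IsSpecial J F := by
  rcases h with h | h | ⟨m, h0, hm, -, hF⟩
  · exact Or.inl h
  · exact Or.inr (Or.inl h)
  · exact Or.inr (Or.inr ⟨m, h0, hm, hF⟩)

/-- Whether `a` and `d` vanish decides between a linear function, `exp`, `log` and a power. For `d ≠
0` the shift `f + c / d` makes the equation homogeneous; for `a ≠ 0` a reflection brings the
interval to the right of, or across, the zero of `a u + b`. This position is recorded in
`IsNormalForm` because the equation for `g` is later solved on the same interval. -/
theorem exists_normalForm (hJ : IsOpen J) (hJ' : IsConnected J) (hf : ContDiffOn ℝ ∞ f J)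
    (hc : NonconstOn f J) {a b c d : ℝ} (hab : a ≠ 0 ∨ b ≠ 0)
    (h : ∀ u ∈ J, (a * u + b) * deriv f u = c + f u * d) :
    ∃ (s σ α β : ℝ) (F : ℝ → ℝ), s ≠ 0 ∧ α ≠ 0 ∧ IsNormalForm (affImage s σ J) F ∧
      ∀ u ∈ J, F (s * u + σ) = α * f u + β := by
  have notconst : ∀ e : ℝ, ¬ ∀ u ∈ J, f u = e := fun e he => by
    obtain ⟨u, hu, v, hv, huv⟩ := hc
    exact huv ((he u hu).trans (he v hv).symm)
  have hfd := fun u (hu : u ∈ J) => hasDerivAt_of_smoothOn hJ hf hu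
  have hsh : d ≠ 0 → ContDiffOn ℝ ∞ (fun u => f u + c / d) J ∧
      ∀ u ∈ J, deriv (fun u => f u + c / d) u = deriv f u := fun _ =>
    ⟨hf.add contDiffOn_const, fun u hu => by rw [deriv_add_const]⟩
  by_cases ha : a = 0
  · subst ha
    have hb : b ≠ 0 := hab.resolve_left (fun h => h rfl)
    by_cases hd : d = 0
    · subst hd
      obtain ⟨e, he⟩ := exists_const_of_hasDerivAt_zero (φ := fun u => f u - c / b * u) hJ hJ'
        (fun u hu => ((hfd u hu).sub ((hasDerivAt_id u).const_mul (c / b))).congr_deriv (by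
          have := h u hu
          field_simp
          linear_combination this))
      have hcb : c / b ≠ 0 := fun h0 => notconst e fun u hu => by
        have := he u hu
        rw [h0] at this
        linarith
      exact ⟨c / b, e, 1, 0, fun u => u ^ (1 : ℝ), hcb, one_ne_zero,
        Or.inr (Or.inr ⟨1, one_ne_zero, powDomain_one _, Or.inl rfl, rfl⟩), fun u hu => by
          simp only [Real.rpow_one]
          linarith [he u hu]⟩
    · obtain ⟨hs1, hs2⟩ := hsh hd
      obtain ⟨K, hK⟩ := exists_exp_of_deriv (k := d / b) hJ hJ' hs1 (fun u hu => by
        rw [hs2 u hu]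
        have := h u hu
        field_simp
        linear_combination this)
      have hK0 : K ≠ 0 := fun h0 => notconst (-(c / d)) fun u hu => by
        have := hK u hu
        rw [h0] at this
        linarith
      refine ⟨d / b, 0, 1 / K, c / d / K, Real.exp, div_ne_zero hd hb, one_div_ne_zero hK0,
        Or.inl rfl, fun u hu => ?_⟩
      have e : 1 / K * f u + c / d / K = (f u + c / d) / K := by ring
      rw [e, hK u hu, add_zero]
      field_simp
  · by_cases hd : d = 0
    · subst hd
      obtain ⟨ε, hε, h0⟩ := exists_reflection hJ' (b / a)
      have h' : ∀ u ∈ J, (u + b / a) * deriv f u = c / a := fun u hu => by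
        have := h u hu
        field_simp
        linear_combination this
      rcases h0 with hpos | h0
      · have hp : ∀ u ∈ J, 0 < ε * u + ε * (b / a) := fun u hu => hpos ⟨u, hu, rfl⟩
        obtain ⟨e, he⟩ := exists_const_of_hasDerivAt_zero
          (φ := fun u => f u - c / a * Real.log (ε * u + ε * (b / a))) hJ hJ'
          (fun u hu => by
            have hlog := ((((hasDerivAt_id u).const_mul ε).add_const (ε * (b / a))).log
              (hp u hu).ne').const_mul (c / a)
            refine ((hfd u hu).sub hlog).congr_deriv ?_
            have hne := (hp u hu).ne'
            have e2 : ε * u + ε * (b / a) = ε * (u + b / a) := by ring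
            simp only [id]
            rw [← h' u hu]
            rw [e2] at hne ⊢
            have hub : u + b / a ≠ 0 := right_ne_zero_of_mul hne
            have hεne := hε.ne_zero
            have e3 : ε * 1 / (ε * (u + b / a)) = 1 / (u + b / a) := by
              rw [mul_div_mul_left _ _ hεne]
            rw [e3, mul_comm (u + b / a), mul_assoc, mul_one_div_cancel hub]
            ring)
        have hca : c / a ≠ 0 := fun h0 => notconst e fun u hu => by
          have := he u hu
          rw [h0] at this
          linarith
        refine ⟨ε, ε * (b / a), 1 / (c / a), -(e / (c / a)), Real.log, hε.ne_zero,
          one_div_ne_zero hca, Or.inr (Or.inl ⟨rfl, hpos⟩), fun u hu => ?_⟩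
        generalize c / a = κ at *
        have := he u hu
        generalize Real.log (ε * u + ε * (b / a)) = L at *
        field_simp
        linarith
      -- At the zero of `u + b / a` the equation gives `c / a = 0`; then `f'` vanishes off this
      -- point and, by continuity, everywhere.
      · exfalso
        obtain ⟨u₀, hu₀, hu₀'⟩ := h0
        have hub : u₀ + b / a = 0 := by
          have : ε * (u₀ + b / a) = 0 := by linear_combination hu₀'
          exact (mul_eq_zero.1 this).resolve_left hε.ne_zero
        have hca : c / a = 0 := by rw [← h' u₀ hu₀, hub, zero_mul]
        have hz := eq_zero_of_add_mul_eq_zero hJ (smoothOn_deriv hJ hf).continuousOn (b := b / a)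
          (fun u hu => by rw [h' u hu, hca])
        obtain ⟨u, hu, hne⟩ := exists_deriv_ne_zero hJ hJ' hf hc
        exact hne (hz u hu)
    · obtain ⟨hs1, hs2⟩ := hsh hd
      obtain ⟨ε, K, hε, h0, hK, hp⟩ := exists_rpow_of_add_mul_deriv (b := b / a) (m := d / a)
        hJ hJ' hs1 (fun u hu => by
          rw [hs2 u hu]
          have := h u hu
          field_simp
          linear_combination this)
      have hK0 : K ≠ 0 := fun h0 => notconst (-(c / d)) fun u hu => by
        have := hK u hu
        rw [h0] at this
        linarith
      refine ⟨ε, ε * (b / a), 1 / K, c / d / K, fun u => u ^ (d / a), hε.ne_zero,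
        one_div_ne_zero hK0, Or.inr (Or.inr ⟨d / a, div_ne_zero hd ha, hp hK0, Or.inr h0, rfl⟩),
        fun u hu => ?_⟩
      have e : 1 / K * f u + c / d / K = (f u + c / d) / K := by ring
      rw [e, hK u hu]
      field_simp

end NormalForm

/-! ### Working with the equivalence group. -/

section Reduction

variable {J J' : Set ℝ} {f g F G : ℝ → ℝ}

theorem EquivTransf.reduces_iff (T : EquivTransf) : T.Reduces J f g J' F G ↔
    J' = affImage T.a₇ T.a₈ J ∧ ∀ u ∈ J,
      F (T.a₇ * u + T.a₈) = T.a₄ / T.a₁ ^ 2 * f u + T.a₅ / T.a₁ ^ 2 ∧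
      G (T.a₇ * u + T.a₈) = T.a₇ / T.a₁ ^ 2 * g u := by
  have hset : (fun p => T.toFun p 3) '' {p : Pt | p 3 ∈ J} = affImage T.a₇ T.a₈ J := by
    ext w
    constructor
    · rintro ⟨p, hp, rfl⟩
      exact ⟨p 3, hp, rfl⟩
    · rintro ⟨u, hu, rfl⟩
      exact ⟨fun _ => u, hu, rfl⟩
  unfold EquivTransf.Reduces
  rw [hset]
  refine and_congr_right fun _ => ⟨fun h u hu => h (fun _ => u) hu, fun h p hp => h (p 3) hp⟩

/-- The equation with arbitrary elements `f, g` reduces to an equation of the table. -/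
def Tabled (J : Set ℝ) (f g : ℝ → ℝ) : Prop :=
  ∃ (T : EquivTransf) (J' : Set ℝ) (n : ℕ) (F₁ F₂ : ℝ → ℝ) (gens : List VField),
    T.Reduces J f g J' F₁ F₂ ∧ TableRow J' n F₁ F₂ gens

/-- The number `r` stands for `1 / a₁ ^ 2`. Through `a₄` and `a₅` the constants `α ≠ 0` and `β` are
free, whereas `r` must be positive; this is where the signs in the table come from. -/
theorem exists_reduces {r a σ α β : ℝ} (hr : 0 < r) (ha : a ≠ 0) (hα : α ≠ 0)
    (hF : ∀ u ∈ J, F (a * u + σ) = α * f u + β) (hG : ∀ u ∈ J, G (a * u + σ) = r * a * g u) :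
    ∃ T : EquivTransf, T.Reduces J f g (affImage a σ J) F G := by
  have hs : ((Real.sqrt r)⁻¹) ^ 2 = r⁻¹ := by rw [inv_pow, Real.sq_sqrt hr.le]
  have hs0 : (Real.sqrt r)⁻¹ ≠ 0 := inv_ne_zero (Real.sqrt_pos.2 hr).ne'
  refine ⟨⟨(Real.sqrt r)⁻¹, 0, 0, α / r, β / r, 0, a, σ,
    mul_ne_zero (mul_ne_zero hs0 (div_ne_zero hα hr.ne')) ha⟩, ?_⟩
  rw [EquivTransf.reduces_iff]
  refine ⟨rfl, fun u hu => ?_⟩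
  simp only [hs]
  rw [hF u hu, hG u hu]
  constructor
  · field_simp
  · field_simp

theorem tabled_of {r a σ α β : ℝ} (hr : 0 < r) (ha : a ≠ 0) (hα : α ≠ 0)
    (hF : ∀ u ∈ J, F (a * u + σ) = α * f u + β) (hG : ∀ u ∈ J, G (a * u + σ) = r * a * g u)
    {n : ℕ} {gens : List VField} (h : TableRow (affImage a σ J) n F G gens) : Tabled J f g := by
  obtain ⟨T, hT⟩ := exists_reduces hr ha hα hF hG
  exact ⟨T, _, n, F, G, gens, hT, h⟩

/-- The reduction is composed with the transformation that normalises `f`; the latter has `a₁ = 1`,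
so it turns the source `g` into `s g`. -/
theorem Tabled.of_affine {s σ α β : ℝ} (hs : s ≠ 0) (hα : α ≠ 0)
    (hF : ∀ u ∈ J, F (s * u + σ) = α * f u + β)
    (h : Tabled (affImage s σ J) F (fun w => s * g ((w - σ) / s))) : Tabled J f g := by
  obtain ⟨T, J', n, F₁, F₂, gens, hT, hrow⟩ := h
  obtain ⟨hJ', hT⟩ := T.reduces_iff.1 hT
  have h1 : T.a₁ ≠ 0 := left_ne_zero_of_mul (left_ne_zero_of_mul T.ne_zero)
  have h4 : T.a₄ ≠ 0 := right_ne_zero_of_mul (left_ne_zero_of_mul T.ne_zero)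
  have h7 : T.a₇ ≠ 0 := right_ne_zero_of_mul T.ne_zero
  refine ⟨⟨T.a₁, 0, 0, T.a₄ * α, T.a₄ * β + T.a₅, 0, T.a₇ * s, T.a₇ * σ + T.a₈,
    mul_ne_zero (mul_ne_zero h1 (mul_ne_zero h4 hα)) (mul_ne_zero h7 hs)⟩, J', n, F₁, F₂, gens,
    ?_, hrow⟩
  rw [EquivTransf.reduces_iff]
  constructor
  · rw [hJ']
    ext w
    simp only [affImage, Set.image_image, Set.mem_image]
    refine exists_congr fun u => and_congr_right fun _ => ?_
    rw [show T.a₇ * (s * u + σ) + T.a₈ = T.a₇ * s * u + (T.a₇ * σ + T.a₈) by ring]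
  · intro u hu
    obtain ⟨e1, e2⟩ := hT (s * u + σ) ⟨u, hu, rfl⟩
    simp only
    rw [show T.a₇ * s * u + (T.a₇ * σ + T.a₈) = T.a₇ * (s * u + σ) + T.a₈ by ring, e1, e2,
      hF u hu, show (s * u + σ - σ) / s = u by field_simp; ring]
    constructor <;> ring

theorem exists_sign_scale {K : ℝ} (hK : K ≠ 0) : ∃ ε r : ℝ, IsSign ε ∧ 0 < r ∧ r * K = ε := by
  rcases lt_or_gt_of_ne hK with h | h
  · exact ⟨-1, -K⁻¹, Or.inr rfl, by simpa using h, by field_simp⟩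
  · exact ⟨1, K⁻¹, Or.inl rfl, by simpa using h, by field_simp⟩

theorem affImage_one_zero : affImage 1 0 J = J := by
  simp [affImage]

end Reduction

/-! ### Normalising the constants in the source term. -/

section Rows

variable {J : Set ℝ} {f g : ℝ → ℝ}

/-- Rescaling of `t`, `x` and `y` only. -/
theorem tabled_of_scale {F : ℝ → ℝ} {r : ℝ} (hr : 0 < r) (hF : ∀ u ∈ J, F u = r * g u)
    {n : ℕ} {gens : List VField} (h : TableRow J n f F gens) : Tabled J f g :=
  tabled_of (F := f) (σ := 0) (β := 0) hr one_ne_zero one_ne_zero (fun u _ => by simp)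
    (fun u hu => by simpa using hF u hu) (by rwa [affImage_one_zero])

theorem tabled_exp_exp {K k : ℝ} (hK : K ≠ 0) (hg : ∀ u ∈ J, g u = K * Real.exp (k * u)) :
    Tabled J Real.exp g := by
  obtain ⟨ε, r, hε, hr, rK⟩ := exists_sign_scale hK
  by_cases h0 : k = 0
  · subst h0
    exact tabled_of_scale hr (fun u hu => by rw [hg u hu]; simpa using rK.symm) (.row4 ε hε)
  by_cases h1 : k = 1
  · subst h1
    exact tabled_of_scale hr (fun u hu => by rw [hg u hu, ← rK, one_mul]; ring) (.row5 ε hε)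
  · exact tabled_of_scale hr (fun u hu => by rw [hg u hu, ← rK]; ring) (.row2 ε k hε h0 h1)

theorem tabled_exp_add {κ δ : ℝ} (h : κ ≠ 0 ∨ δ ≠ 0)
    (hg : ∀ u ∈ J, g u = κ * Real.exp u + δ) : Tabled J Real.exp g := by
  by_cases hκ : κ = 0
  · subst hκ
    exact tabled_exp_exp (k := 0) (h.resolve_left fun h => h rfl) fun u hu => by
      rw [hg u hu]; simp
  by_cases hδ : δ = 0
  · subst hδ
    exact tabled_exp_exp (k := 1) hκ fun u hu => by rw [hg u hu]; simp
  obtain ⟨ε₂, r, hε₂, hr, e2⟩ := exists_sign_scale hδ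
  obtain ⟨ε₁, q, hε₁, hq, e1⟩ := exists_sign_scale hκ
  -- The factor `r` turns `δ` into a sign; shifting `u` by `log (r / q)` then turns the coefficient
  -- `r κ` of `e^u` into `q κ = ε₁`.
  have hrq : 0 < r / q := div_pos hr hq
  refine tabled_of (σ := Real.log (r / q)) (α := r / q) (β := 0) hr one_ne_zero hrq.ne'
    (fun u hu => ?_) (fun u hu => ?_) (.row3 ε₁ ε₂ hε₁ hε₂)
  · rw [Real.exp_add, Real.exp_log hrq, one_mul]; ring
  · rw [Real.exp_add, Real.exp_log hrq, hg u hu, ← e1, ← e2]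
    field_simp

theorem tabled_log_rpow (hpos : J ⊆ Set.Ioi 0) {K m : ℝ} (hK : K ≠ 0)
    (hg : ∀ u ∈ J, g u = K * u ^ m) : Tabled J Real.log g := by
  obtain ⟨ε, r, hε, hr, rK⟩ := exists_sign_scale hK
  by_cases h1 : m = 1
  · subst h1
    exact tabled_of_scale hr (fun u hu => by rw [hg u hu, ← rK, Real.rpow_one]; ring)
      (.row9 ε hε hpos)
  · exact tabled_of_scale hr (fun u hu => by rw [hg u hu, ← rK]; ring) (.row7 ε m hε h1 hpos)

theorem tabled_log_mul_log (hpos : J ⊆ Set.Ioi 0) {κ δ : ℝ} (h : κ ≠ 0 ∨ δ ≠ 0)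
    (hg : ∀ u ∈ J, g u = κ * (u * Real.log u) + δ * u) : Tabled J Real.log g := by
  by_cases hκ : κ = 0
  · subst hκ
    exact tabled_log_rpow (m := 1) hpos (h.resolve_left fun h => h rfl) fun u hu => by
      rw [hg u hu, Real.rpow_one]; ring
  obtain ⟨ε, r, hε, hr, rK⟩ := exists_sign_scale hκ
  -- This dilation adds `δ / κ` to `log u`, which absorbs the term `δ u`.
  have ha : 0 < Real.exp (δ / κ) := Real.exp_pos _
  have hlog : ∀ u ∈ J, Real.log (Real.exp (δ / κ) * u + 0) = Real.log u + δ / κ := fun u hu => by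
    rw [add_zero, Real.log_mul ha.ne' (ne_of_gt (hpos hu)), Real.log_exp, add_comm]
  refine tabled_of (σ := 0) (α := 1) (β := δ / κ) hr ha.ne' one_ne_zero
    (fun u hu => by rw [hlog u hu, one_mul]) (fun u hu => ?_) (.row8 ε hε ?_)
  · simp only [hlog u hu]
    rw [hg u hu, ← rK, add_zero]
    field_simp
  · rintro _ ⟨u, hu, rfl⟩
    have : 0 < Real.exp (δ / κ) * u := mul_pos ha (hpos hu)
    simpa using this

theorem tabled_rpow_rpow {m n K : ℝ} (h0 : m ≠ 0) (h1 : m ≠ 1) (hJm : PowDomain m J) (hK : K ≠ 0)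
    (hJn : PowDomain n J) (hg : ∀ u ∈ J, g u = K * u ^ n) : Tabled J (fun u => u ^ m) g := by
  obtain ⟨ε, r, hε, hr, rK⟩ := exists_sign_scale hK
  by_cases hn : n = m + 1
  · subst hn
    exact tabled_of_scale hr (fun u hu => by rw [hg u hu, ← rK]; ring) (.row13 ε m hε h0 h1 hJm)
  · exact tabled_of_scale hr (fun u hu => by rw [hg u hu, ← rK]; ring)
      (.row11 ε m n hε h0 h1 hn hJm hJn)

theorem mul_rpow_of_pos {a : ℝ} (ha : 0 < a) {m u : ℝ} (hu : 0 ≤ u ∨ ∃ k : ℤ, m = k) :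
    (a * u) ^ m = a ^ m * u ^ m := by
  rcases hu with hu | ⟨k, rfl⟩
  · exact Real.mul_rpow ha.le hu
  · simp only [Real.rpow_intCast, mul_zpow]

theorem PowDomain.nonneg_or_int {m : ℝ} (h : PowDomain m J) {u : ℝ} (hu : u ∈ J) :
    0 ≤ u ∨ ∃ k : ℤ, m = k := by
  rcases h u hu with h | ⟨-, h⟩ | ⟨k, hk⟩
  · exact Or.inl h.le
  · exact Or.inr h
  · exact Or.inr ⟨k, by simpa using hk⟩

theorem PowDomain.affImage {m a : ℝ} (h : PowDomain m J) (ha : 0 < a) :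
    PowDomain m (affImage a 0 J) := by
  rintro _ ⟨u, hu, rfl⟩
  simp only [add_zero]
  rcases h u hu with h | ⟨h, h'⟩ | h
  · exact Or.inl (mul_pos ha h)
  · exact Or.inr (Or.inl ⟨mul_ne_zero ha.ne' h, h'⟩)
  · exact Or.inr (Or.inr h)

theorem tabled_rpow_add {m κ δ : ℝ} (h0 : m ≠ 0) (h1 : m ≠ 1) (hJm : PowDomain m J)
    (h : κ ≠ 0 ∨ δ ≠ 0) (hg : ∀ u ∈ J, g u = κ * (u ^ m * u) + δ * u) :
    Tabled J (fun u => u ^ m) g := by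
  by_cases hκ : κ = 0
  · subst hκ
    exact tabled_rpow_rpow (n := 1) h0 h1 hJm (h.resolve_left fun h => h rfl) (powDomain_one J)
      fun u hu => by rw [hg u hu, Real.rpow_one]; ring
  obtain ⟨ε₁, q, hε₁, hq, e1⟩ := exists_sign_scale hκ
  by_cases hδ : δ = 0
  · subst hδ
    exact tabled_of_scale hq (fun u hu => by
      rw [hg u hu, ← e1, hJm.rpow_add_one hu]; ring) (.row13 ε₁ m hε₁ h0 h1 hJm)
  obtain ⟨ε₂, r, hε₂, hr, e2⟩ := exists_sign_scale hδ
  have hrq : 0 < r / q := div_pos hr hq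
  -- The dilation multiplies `u ^ m` by `r / q`, as the shift did for the exponential.
  have ha : 0 < (r / q) ^ (1 / m) := Real.rpow_pos_of_pos hrq _
  have ham : ((r / q) ^ (1 / m)) ^ m = r / q := by
    rw [← Real.rpow_mul hrq.le, one_div_mul_cancel h0, Real.rpow_one]
  have hdom := hJm.affImage ha
  have hpow : ∀ u ∈ J, ((r / q) ^ (1 / m) * u + 0) ^ m = r / q * u ^ m := fun u hu => by
    rw [add_zero, mul_rpow_of_pos ha (hJm.nonneg_or_int hu), ham]
  refine tabled_of (σ := 0) (α := r / q) (β := 0) hr ha.ne' hrq.ne'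
    (fun u hu => by rw [hpow u hu, add_zero]) (fun u hu => ?_)
    (.row12 ε₁ ε₂ m hε₁ hε₂ h0 h1 hdom)
  rw [hdom.rpow_add_one ⟨u, hu, rfl⟩]
  simp only [hpow u hu]
  rw [hg u hu, ← e1, ← e2]
  field_simp
  ring

theorem tabled_id_exp {K k : ℝ} (hK : K ≠ 0) (hk : k ≠ 0)
    (hg : ∀ u ∈ J, g u = K * Real.exp (k * u)) : Tabled J (fun u => u) g := by
  obtain ⟨ε, r, hε, hr, rK⟩ := exists_sign_scale (mul_ne_zero hk hK)
  refine tabled_of (σ := 0) (α := k) (β := 0) hr hk hk (fun u _ => rfl) (fun u hu => ?_)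
    (.row15 ε hε)
  rw [hg u hu, ← rK, add_zero]
  ring

theorem tabled_id_rpow {s σ m K : ℝ} (hs : s ≠ 0) (h0 : m ≠ 0) (h1 : m ≠ 1) (h2 : m ≠ 2)
    (hK : K ≠ 0) (hJm : PowDomain m (affImage s σ J))
    (hg : ∀ u ∈ J, g u = K * (s * u + σ) ^ m) : Tabled J (fun u => u) g := by
  obtain ⟨ε, r, hε, hr, rK⟩ := exists_sign_scale (mul_ne_zero hs hK)
  refine tabled_of (α := s) (β := σ) hr hs hs (fun u _ => rfl) (fun u hu => ?_)
    (.row16 ε m hε h0 h1 h2 hJm)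
  rw [hg u hu, ← rK]
  ring

/-- Completing the square leaves the sign of `a c - b² / 4` as the only invariant for `a ≠ 0`. The
sign of `a` is absorbed by the dilation of `u`, so the rows with `u²` carry no sign parameter. -/
theorem tabled_id_quadratic {a b c : ℝ} (h : a ≠ 0 ∨ b ≠ 0 ∨ c ≠ 0)
    (hg : ∀ u ∈ J, g u = a * u ^ 2 + b * u + c) : Tabled J (fun u => u) g := by
  by_cases ha : a = 0
  · subst ha
    by_cases hb : b = 0
    · subst hb
      have hc : c ≠ 0 := by simpa using h
      obtain ⟨ε, r, hε, hr, rK⟩ := exists_sign_scale hc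
      exact tabled_of_scale hr (fun u hu => by rw [hg u hu, ← rK]; ring) (.row21 ε hε)
    · obtain ⟨ε, r, hε, hr, rK⟩ := exists_sign_scale hb
      refine tabled_of (σ := c / b) (α := 1) (β := c / b) hr one_ne_zero one_ne_zero
        (fun u _ => rfl) (fun u hu => ?_) (.row19 ε hε)
      rw [hg u hu, ← rK]
      field_simp
      ring
  set d := a * c - b ^ 2 / 4 with hd
  by_cases hd0 : d = 0
  · refine tabled_of (σ := b / 2) (α := a) (β := b / 2) one_pos ha ha (fun u _ => rfl)
      (fun u hu => ?_) .row20
    rw [hg u hu]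
    linear_combination -hd0 + hd
  obtain ⟨ε, q, hε, hq, e⟩ := exists_sign_scale hd0
  -- A dilation of `u` by `r a` together with the scale `r` multiplies the constant `d` by `r²`,
  -- hence the square root.
  have hr : 0 < Real.sqrt q := Real.sqrt_pos.2 hq
  have hrq : Real.sqrt q ^ 2 = q := Real.sq_sqrt hq.le
  rw [← hrq] at e
  generalize Real.sqrt q = r at *
  have key : ∀ u ∈ J, (r * a * u + r * b / 2) ^ 2 + ε = r * (r * a) * g u := fun u hu => by
    rw [hg u hu, ← e, hd]; ring
  have hra : r * a ≠ 0 := mul_ne_zero hr.ne' ha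
  rcases hε with rfl | rfl
  · exact tabled_of (σ := r * b / 2) (α := r * a) (β := r * b / 2) hr hra hra (fun u _ => rfl)
      (fun u hu => key u hu) .row17
  · exact tabled_of (σ := r * b / 2) (α := r * a) (β := r * b / 2) hr hra hra (fun u _ => rfl)
      (fun u hu => by rw [← key u hu]; ring) .row18

/-- The first row is the complement of the other rows without source, so a case distinction
suffices. -/
theorem tabled_zero (hf : ContDiffOn ℝ ∞ f J) (hc : NonconstOn f J) (hg : ∀ u ∈ J, g u = 0) :
    Tabled J f g := by
  by_cases h : ∃ (T : EquivTransf) (J' : Set ℝ) (F₁ : ℝ → ℝ),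
      IsSpecial J' F₁ ∧ T.Reduces J f (fun _ => 0) J' F₁ (fun _ => 0)
  · obtain ⟨T, J', F₁, hF₁, hT⟩ := h
    have hT' : T.Reduces J f g J' F₁ (fun _ => 0) := by
      refine ⟨hT.1, fun p hp => ?_⟩
      rw [hg _ hp]
      exact hT.2 p hp
    rcases hF₁ with rfl | ⟨rfl, hpos⟩ | ⟨m, h0, hm, rfl⟩
    · exact ⟨T, J', 6, _, _, _, hT', .row6⟩
    · exact ⟨T, J', 10, _, _, _, hT', .row10 hpos⟩
    · by_cases h1 : m = 1
      · subst h1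
        simp only [Real.rpow_one] at hT'
        exact ⟨T, J', 22, _, _, _, hT', .row22⟩
      · exact ⟨T, J', 14, _, _, _, hT', .row14 m h0 h1 hm⟩
  · exact tabled_of_scale one_pos (fun u hu => by rw [hg u hu, mul_zero]) (.row1 f hf hc h)

end Rows

/-! ### Determining the source `g` for the normal forms `exp`, `log` and `u ^ m`. -/

/-- The system to which the determining equations for `η = η₁ u + η₀` reduce, written with respect
to two constant vector fields `v₀`, `v₂`. -/
structure DetSystem (U : Set Pt) (J : Set ℝ) (f g : ℝ → ℝ) (v₀ v₂ : Pt) (l : ℝ)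
    (P Q η₁ η₀ : Pt → ℝ) : Prop where
  smooth_P : ContDiffOn ℝ ∞ P U
  smooth_Q : ContDiffOn ℝ ∞ Q U
  smooth_η₁ : ContDiffOn ℝ ∞ η₁ U
  smooth_η₀ : ContDiffOn ℝ ∞ η₀ U
  curl : ∀ p ∈ U, dirDeriv v₂ P p = dirDeriv v₀ Q p
  eq_f : ∀ p ∈ U, ∀ u ∈ J, (η₁ p * u + η₀ p) * deriv f u = P p + f u * Q p
  eq_g : ∀ p ∈ U, ∀ u ∈ J,
    dirDeriv v₀ η₁ p * u + dirDeriv v₀ η₀ p + f u * (dirDeriv v₂ η₁ p * u + dirDeriv v₂ η₀ p)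
      + g u * (η₁ p - l) - (η₁ p * u + η₀ p) * deriv g u = 0

section Det

variable {U : Set Pt} {J : Set ℝ} {f g : ℝ → ℝ} {v₀ v₂ : Pt} {l : ℝ} {P Q η₁ η₀ : Pt → ℝ}

theorem sum_dirDeriv_eq_zero (hU : IsOpen U) {n : ℕ} (c : Fin n → ℝ) (A : Fin n → Pt → ℝ)
    (hA : ∀ i, ContDiffOn ℝ ∞ (A i) U) {c₀ : ℝ} (h : ∀ q ∈ U, ∑ i, c i * A i q = c₀) {p : Pt}
    (hp : p ∈ U) (v : Pt) : ∑ i, c i * dirDeriv v (A i) p = 0 := by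
  rw [← dirDeriv_eq_zero (v := v) hU h hp]
  have hd : ∀ i ∈ Finset.univ, DifferentiableAt ℝ (fun q => c i * A i q) p := fun i _ =>
    (differentiableAt_of_smoothOn hU (hA i) hp).const_mul (c i)
  rw [dirDeriv, fderiv_fun_sum hd, _root_.sum_apply]
  exact Finset.sum_congr rfl fun i _ =>
    (dirDeriv_const_mul (c i) (differentiableAt_of_smoothOn hU (hA i) hp)).symm

/-- The function `χ` enters only through its gradient, so it is replaced by `P = χ_t`, `Q = χ_y - l`
and the equality of mixed derivatives. -/
theorem ReducedSymmetry.detSystem (hU : IsOpen U) {χ : Pt → ℝ}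
    (R : ReducedSymmetry U J f g l χ η₁ η₀) :
    DetSystem U J f g (Pi.single 0 1) (Pi.single 2 1) l (pd 0 χ) (fun p => pd 2 χ p - l) η₁ η₀ where
  smooth_P := smoothOn_pd hU R.smooth_χ 0
  smooth_Q := (smoothOn_pd hU R.smooth_χ 2).sub contDiffOn_const
  smooth_η₁ := R.smooth_η₁
  smooth_η₀ := R.smooth_η₀
  curl := fun p hp => by
    rw [dirDeriv_sub (differentiableAt_of_smoothOn hU (smoothOn_pd hU R.smooth_χ 2) hp)
      (differentiableAt_const l), dirDeriv_const, sub_zero]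
    exact pd_comm hU R.smooth_χ hp 2 0
  eq_f := R.eq_f
  eq_g := R.eq_g

/-- The operator `v₀ + f v₂` is unchanged when `f` becomes `α f + β`, `v₂` becomes `v₂ / α` and `v₀`
becomes `v₀ - (β / α) v₂`. Hence `f` can be normalised without changing the base coordinates. -/
theorem DetSystem.affine (hU : IsOpen U) (hJ : IsOpen J) (S : DetSystem U J f g v₀ v₂ l P Q η₁ η₀)
    {F : ℝ → ℝ} {s σ α β : ℝ} (hs : s ≠ 0) (hα : α ≠ 0)
    (hF : ∀ u ∈ J, F (s * u + σ) = α * f u + β) :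
    DetSystem U (affImage s σ J) F (fun w => s * g ((w - σ) / s)) (v₀ + (-(β / α)) • v₂)
      (α⁻¹ • v₂) l (fun p => α * P p - β * Q p) Q η₁ (fun p => s * η₀ p - σ * η₁ p) where
  smooth_P := (contDiffOn_const.mul S.smooth_P).sub (contDiffOn_const.mul S.smooth_Q)
  smooth_Q := S.smooth_Q
  smooth_η₁ := S.smooth_η₁
  smooth_η₀ := (contDiffOn_const.mul S.smooth_η₀).sub (contDiffOn_const.mul S.smooth_η₁)
  curl := fun p hp => by
    have dP := differentiableAt_of_smoothOn hU S.smooth_P hp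
    have dQ := differentiableAt_of_smoothOn hU S.smooth_Q hp
    rw [dirDeriv_dir_smul, dirDeriv_sub (dP.const_mul α) (dQ.const_mul β),
      dirDeriv_const_mul α dP, dirDeriv_const_mul β dQ, dirDeriv_dir_add, dirDeriv_dir_smul,
      ← S.curl p hp]
    field_simp
    ring
  eq_f := fun p hp w hw => by
    obtain ⟨u, hu, rfl⟩ := hw
    have e : (s * u + σ - σ) / s = u := by field_simp; ring
    have hFd : deriv F (s * u + σ) = α * (deriv f u / s) := by
      rw [deriv_eq_of_eqOn (isOpen_affImage hs hJ)
        (G := fun w => α * (fun w => f ((w - σ) / s)) w + β) (fun w hw => by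
          obtain ⟨v, hv, rfl⟩ := hw
          have e' : (s * v + σ - σ) / s = v := by field_simp; ring
          simp only [e']
          exact hF v hv) ⟨u, hu, rfl⟩, deriv_add_const, deriv_const_mul_field,
        deriv_comp_affine hs]
      simp only [e]
    simp only [hFd, hF u hu]
    have := S.eq_f p hp u hu
    field_simp
    linear_combination s * α * this
  eq_g := fun p hp w hw => by
    obtain ⟨u, hu, rfl⟩ := hw
    have e : (s * u + σ - σ) / s = u := by field_simp; ring
    have d1 := differentiableAt_of_smoothOn hU S.smooth_η₁ hp
    have d0 := differentiableAt_of_smoothOn hU S.smooth_η₀ hp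
    have hη : ∀ v : Pt, dirDeriv v (fun p => s * η₀ p - σ * η₁ p) p
        = s * dirDeriv v η₀ p - σ * dirDeriv v η₁ p := fun v => by
      rw [dirDeriv_sub (d0.const_mul s) (d1.const_mul σ), dirDeriv_const_mul s d0,
        dirDeriv_const_mul σ d1]
    have hg : deriv (fun w => s * g ((w - σ) / s)) (s * u + σ) = deriv g u := by
      rw [deriv_const_mul_field, deriv_comp_affine hs, e]
      field_simp
    simp only [hη, hg, dirDeriv_dir_add, dirDeriv_dir_smul, hF u hu, e]
    have := S.eq_g p hp u hu
    field_simp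
    linear_combination α * s * this

/-- Differentiation along the base removes the only term `l g` that is not linear in `η`. -/
theorem DetSystem.dirDeriv_eq_g (hU : IsOpen U) (S : DetSystem U J f g v₀ v₂ l P Q η₁ η₀) {p : Pt}
    (hp : p ∈ U) (v : Pt) {u : ℝ} (hu : u ∈ J) :
    dirDeriv v (dirDeriv v₀ η₁) p * u + dirDeriv v (dirDeriv v₀ η₀) p
      + f u * (dirDeriv v (dirDeriv v₂ η₁) p * u + dirDeriv v (dirDeriv v₂ η₀) p)
      + g u * dirDeriv v η₁ p - (dirDeriv v η₁ p * u + dirDeriv v η₀ p) * deriv g u = 0 := by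
  have := sum_dirDeriv_eq_zero hU ![u, 1, f u * u, f u, g u - u * deriv g u, -deriv g u]
    ![dirDeriv v₀ η₁, dirDeriv v₀ η₀, dirDeriv v₂ η₁, dirDeriv v₂ η₀, η₁, η₀]
    (fun i => by
      fin_cases i
      · exact smoothOn_dirDeriv hU S.smooth_η₁ v₀
      · exact smoothOn_dirDeriv hU S.smooth_η₀ v₀
      · exact smoothOn_dirDeriv hU S.smooth_η₁ v₂
      · exact smoothOn_dirDeriv hU S.smooth_η₀ v₂
      · exact S.smooth_η₁
      · exact S.smooth_η₀) (c₀ := l * g u)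
    (fun q hq => by
      simp [Fin.sum_univ_succ]
      linear_combination S.eq_g q hq u hu) hp v
  simp [Fin.sum_univ_succ] at this
  linear_combination this

variable (hU : IsOpen U) (hJ : IsOpen J) (hJ' : IsConnected J) (hg : ContDiffOn ℝ ∞ g J)
  (hg0 : ∃ u ∈ J, g u ≠ 0) (hη : ∃ p ∈ U, η₁ p ≠ 0 ∨ η₀ p ≠ 0)

include hU hJ hJ' hg hg0 hη

/-- Here `η = η₀` and `v₀ η₀ = v₂ P = 0`. If `v₂ η₀ ≠ 0` somewhere, the equation differentiated
along `v₂` says `g' = κ e^u`. Otherwise it says `η₀ g' = -l g`. -/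
theorem DetSystem.tabled_exp (S : DetSystem U J Real.exp g v₀ v₂ l P Q η₁ η₀) :
    Tabled J Real.exp g := by
  have hrel : ∀ p ∈ U, η₁ p = 0 ∧ P p = 0 ∧ η₀ p = Q p := fun p hp =>
    exp_relation hJ hJ'.nonempty fun u hu => by
      have := S.eq_f p hp u hu
      rwa [Real.deriv_exp] at this
  have z1 : ∀ p ∈ U, ∀ v, dirDeriv v η₁ p = 0 := fun p hp v =>
    dirDeriv_eq_zero hU (fun q hq => (hrel q hq).1) hp
  have z0 : ∀ p ∈ U, dirDeriv v₀ η₀ p = 0 := fun p hp => by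
    rw [dirDeriv_congr hU (fun q hq => (hrel q hq).2.2) hp, ← S.curl p hp,
      dirDeriv_eq_zero hU (fun q hq => (hrel q hq).2.1) hp]
  obtain ⟨p, hp, hη⟩ := hη
  obtain ⟨u₀, hu₀, hg0⟩ := hg0
  by_cases hE : ∃ q ∈ U, dirDeriv v₂ η₀ q ≠ 0
  · obtain ⟨q, hq, hE⟩ := hE
    have hd : ∀ u ∈ J, deriv g u
        = dirDeriv v₂ (dirDeriv v₂ η₀) q / dirDeriv v₂ η₀ q * Real.exp u := fun u hu => by
      have := S.dirDeriv_eq_g hU hq v₂ hu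
      rw [z1 q hq, dirDeriv_eq_zero hU (fun q hq => z1 q hq v₀) hq,
        dirDeriv_eq_zero hU (fun q hq => z1 q hq v₂) hq, dirDeriv_eq_zero hU z0 hq] at this
      field_simp
      linear_combination -this
    generalize dirDeriv v₂ (dirDeriv v₂ η₀) q / dirDeriv v₂ η₀ q = κ at hd
    obtain ⟨δ, hδ⟩ := exists_const_of_hasDerivAt_zero (φ := fun u => g u - κ * Real.exp u) hJ hJ'
      (fun u hu => ((hasDerivAt_of_smoothOn hJ hg hu).sub
        ((Real.hasDerivAt_exp u).const_mul κ)).congr_deriv (by rw [hd u hu, sub_self]))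
    have hgu : ∀ u ∈ J, g u = κ * Real.exp u + δ := fun u hu => by linarith [hδ u hu]
    refine tabled_exp_add ?_ hgu
    by_contra! hcon
    exact hg0 (by rw [hgu u₀ hu₀, hcon.1, hcon.2]; ring)
  · push Not at hE
    have h0 : η₀ p ≠ 0 := hη.resolve_left fun h => h (hrel p hp).1
    obtain ⟨K, hK⟩ := exists_exp_of_deriv (k := -l / η₀ p) hJ hJ' hg (fun u hu => by
      have := S.eq_g p hp u hu
      rw [z1 p hp, z1 p hp, z0 p hp, hE p hp, (hrel p hp).1] at this
      field_simp
      linear_combination -this)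
    refine tabled_exp_exp (fun h => hg0 ?_) hK
    rw [hK u₀ hu₀, h, zero_mul]

/-- Here `η = η₁ u` and `v₂ η₁ = v₀ Q = 0`. If `v₀ η₁ ≠ 0` somewhere, differentiation along `v₀`
gives `u g' = g + κ u`, that is `(g / u)' = κ / u`. Otherwise `η₁ u g' = (η₁ - l) g`. -/
theorem DetSystem.tabled_log (hpos : J ⊆ Set.Ioi 0)
    (S : DetSystem U J Real.log g v₀ v₂ l P Q η₁ η₀) : Tabled J Real.log g := by
  have hne : ∀ u ∈ J, u ≠ 0 := fun u hu => ne_of_gt (hpos hu)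
  have hrel : ∀ p ∈ U, η₀ p = 0 ∧ η₁ p = P p ∧ Q p = 0 := fun p hp =>
    log_relation hJ hJ'.nonempty hpos fun u hu => by
      have := S.eq_f p hp u hu
      have hu0 := hne u hu
      rw [Real.deriv_log] at this
      generalize Real.log u = L at *
      field_simp at this
      linear_combination this
  have z0 : ∀ p ∈ U, ∀ v, dirDeriv v η₀ p = 0 := fun p hp v =>
    dirDeriv_eq_zero hU (fun q hq => (hrel q hq).1) hp
  have z1 : ∀ p ∈ U, dirDeriv v₂ η₁ p = 0 := fun p hp => by
    rw [dirDeriv_congr hU (fun q hq => (hrel q hq).2.1) hp, S.curl p hp,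
      dirDeriv_eq_zero hU (fun q hq => (hrel q hq).2.2) hp]
  obtain ⟨p, hp, hη⟩ := hη
  obtain ⟨u₀, hu₀, hg0⟩ := hg0
  by_cases hE : ∃ q ∈ U, dirDeriv v₀ η₁ q ≠ 0
  · obtain ⟨q, hq, hE⟩ := hE
    have hd : ∀ u ∈ J, u * deriv g u
        = g u + dirDeriv v₀ (dirDeriv v₀ η₁) q / dirDeriv v₀ η₁ q * u := fun u hu => by
      have := S.dirDeriv_eq_g hU hq v₀ hu
      rw [z0 q hq, dirDeriv_eq_zero hU (fun q hq => z0 q hq v₀) hq,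
        dirDeriv_eq_zero hU (fun q hq => z0 q hq v₂) hq, dirDeriv_eq_zero hU z1 hq] at this
      field_simp
      linear_combination -this
    generalize dirDeriv v₀ (dirDeriv v₀ η₁) q / dirDeriv v₀ η₁ q = κ at hd
    obtain ⟨δ, hδ⟩ := exists_const_of_hasDerivAt_zero
      (φ := fun u => g u / u - κ * Real.log u) hJ hJ' (fun u hu =>
        (((hasDerivAt_of_smoothOn hJ hg hu).div (hasDerivAt_id u) (hne u hu)).sub
          ((Real.hasDerivAt_log (hne u hu)).const_mul κ)).congr_deriv (by
            have hu0 := hne u hu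
            simp only [id]
            field_simp
            linear_combination hd u hu))
    have hgu : ∀ u ∈ J, g u = κ * (u * Real.log u) + δ * u := fun u hu => by
      have hu0 := hne u hu
      rw [← hδ u hu]
      generalize Real.log u = L
      field_simp
      ring
    refine tabled_log_mul_log hpos ?_ hgu
    by_contra! hcon
    exact hg0 (by rw [hgu u₀ hu₀, hcon.1, hcon.2]; ring)
  · push Not at hE
    have h1 : η₁ p ≠ 0 := hη.resolve_right fun h => h (hrel p hp).1
    obtain ⟨K, hK⟩ := exists_rpow_of_pos (m := (η₁ p - l) / η₁ p) hJ hJ' hpos hg (fun u hu => by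
      have := S.eq_g p hp u hu
      rw [z0 p hp, z0 p hp, z1 p hp, hE p hp, (hrel p hp).1] at this
      field_simp
      linear_combination -this)
    refine tabled_log_rpow hpos (fun h => hg0 ?_) hK
    rw [hK u₀ hu₀, h, zero_mul]

/-- Here `η = η₁ u` and `v₀ η₁ = 0`. If `v₂ η₁ ≠ 0` somewhere, differentiation along `v₂` gives `u
g' = g + κ u ^ (m + 1)`. Otherwise `g` is a power. -/
theorem DetSystem.tabled_rpow {m : ℝ} (h0 : m ≠ 0) (h1 : m ≠ 1) (hm : PowDomain m J)
    (hJ0 : J ⊆ Set.Ioi 0 ∨ (0 : ℝ) ∈ J)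
    (S : DetSystem U J (fun u => u ^ m) g v₀ v₂ l P Q η₁ η₀) : Tabled J (fun u => u ^ m) g := by
  have hrel : ∀ p ∈ U, η₀ p = 0 ∧ P p = 0 ∧ m * η₁ p = Q p := fun p hp =>
    pow_relation hJ hJ'.nonempty hm h0 h1 (S.eq_f p hp)
  have z0 : ∀ p ∈ U, ∀ v, dirDeriv v η₀ p = 0 := fun p hp v =>
    dirDeriv_eq_zero hU (fun q hq => (hrel q hq).1) hp
  have z1 : ∀ p ∈ U, dirDeriv v₀ η₁ p = 0 := fun p hp => by
    have e := dirDeriv_congr (v := v₀) hU (fun q hq => (hrel q hq).2.2) hp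
    rw [dirDeriv_const_mul m (differentiableAt_of_smoothOn hU S.smooth_η₁ hp), ← S.curl p hp,
      dirDeriv_eq_zero hU (fun q hq => (hrel q hq).2.1) hp] at e
    exact (mul_eq_zero.1 e).resolve_left h0
  obtain ⟨p, hp, hη⟩ := hη
  obtain ⟨u₀, hu₀, hg0⟩ := hg0
  by_cases hE : ∃ q ∈ U, dirDeriv v₂ η₁ q ≠ 0
  · obtain ⟨q, hq, hE⟩ := hE
    have hd : ∀ u ∈ J, u * deriv g u
        = g u + dirDeriv v₂ (dirDeriv v₂ η₁) q / dirDeriv v₂ η₁ q * (u ^ m * u) := fun u hu => by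
      have := S.dirDeriv_eq_g hU hq v₂ hu
      rw [z0 q hq, dirDeriv_eq_zero hU (fun q hq => z0 q hq v₀) hq,
        dirDeriv_eq_zero hU (fun q hq => z0 q hq v₂) hq, dirDeriv_eq_zero hU z1 hq] at this
      generalize u ^ m = w at *
      field_simp
      linear_combination -this
    generalize dirDeriv v₂ (dirDeriv v₂ η₁) q / dirDeriv v₂ η₁ q = κ at hd
    -- A particular solution is `(κ / m) u ^ (m + 1)`; the remainder solves `u φ' = φ`, also across
    -- zero.
    obtain ⟨δ, hδ, -⟩ := exists_rpow_of_mul_deriv (m := 1)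
      (φ := fun u => g u - κ / m * u ^ (m + 1)) hJ hJ' hJ0
      (hg.sub (contDiffOn_const.mul hm.add_one.contDiffOn)) (fun u hu => by
        have e := ((hasDerivAt_of_smoothOn hJ hg hu).sub
          ((hm.add_one.hasDerivAt hu).const_mul (κ / m))).deriv
        have e' : deriv (fun u => g u - κ / m * u ^ (m + 1)) u
            = deriv g u - κ / m * deriv (fun u => u ^ (m + 1)) u := e
        have e2 := hm.add_one.mul_deriv hu
        rw [e', mul_sub, hd u hu, ← hm.rpow_add_one hu, mul_left_comm, e2]
        generalize u ^ (m + 1) = w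
        field_simp
        ring)
    have hgu : ∀ u ∈ J, g u = κ / m * (u ^ m * u) + δ * u := fun u hu => by
      have := hδ u hu
      rw [Real.rpow_one, hm.rpow_add_one hu] at this
      linarith
    refine tabled_rpow_add h0 h1 hm ?_ hgu
    by_contra! hcon
    exact hg0 (by rw [hgu u₀ hu₀, hcon.1, hcon.2]; ring)
  · push Not at hE
    have hp1 : η₁ p ≠ 0 := hη.resolve_right fun h => h (hrel p hp).1
    obtain ⟨K, hK, hKn⟩ := exists_rpow_of_mul_deriv (m := (η₁ p - l) / η₁ p) hJ hJ' hJ0 hg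
      (fun u hu => by
        have := S.eq_g p hp u hu
        rw [z0 p hp, z0 p hp, z1 p hp, hE p hp, (hrel p hp).1] at this
        field_simp
        linear_combination -this)
    have hK0 : K ≠ 0 := fun h => hg0 (by rw [hK u₀ hu₀, h, zero_mul])
    exact tabled_rpow_rpow h0 h1 hm hK0 (hKn hK0) hK

end Det

/-! ### Determining the source `g` for `f = u`. -/

section Identity

variable {J : Set ℝ} {g : ℝ → ℝ}

theorem exists_quadratic_of_deriv_deriv (hJ : IsOpen J) (hJ' : IsConnected J)
    (hg : ContDiffOn ℝ ∞ g J) {k : ℝ} (h : ∀ u ∈ J, deriv (deriv g) u = k) :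
    ∃ a b c : ℝ, ∀ u ∈ J, g u = a * u ^ 2 + b * u + c := by
  obtain ⟨b, hb⟩ := exists_const_of_hasDerivAt_zero (φ := fun u => deriv g u - k * u) hJ hJ'
    (fun u hu => ((hasDerivAt_of_smoothOn hJ (smoothOn_deriv hJ hg) hu).sub
      ((hasDerivAt_id u).const_mul k)).congr_deriv (by rw [h u hu]; ring))
  obtain ⟨c, hc⟩ := exists_const_of_hasDerivAt_zero
    (φ := fun u => g u - (k / 2 * u ^ 2 + b * u)) hJ hJ'
    (fun u hu => ((hasDerivAt_of_smoothOn hJ hg hu).sub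
      ((((hasDerivAt_id u).pow 2).const_mul (k / 2)).add
        ((hasDerivAt_id u).const_mul b))).congr_deriv (by
          simp only [id, Nat.cast_ofNat, Nat.add_one_sub_one, pow_one, mul_one]
          linear_combination hb u hu))
  exact ⟨k / 2, b, c, fun u hu => by linarith [hc u hu]⟩

/-- Two independent relations `(a u + b) h = c u + d` force `h` to be constant. -/
theorem exists_const_of_two_relations (hJ : IsOpen J) (hJ' : IsConnected J) {h : ℝ → ℝ}
    {a b c d a' b' c' d' : ℝ} (hdet : a * b' - a' * b ≠ 0)
    (h1 : ∀ u ∈ J, (a * u + b) * h u = c * u + d)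
    (h2 : ∀ u ∈ J, (a' * u + b') * h u = c' * u + d') : ∃ k, ∀ u ∈ J, h u = k := by
  set Δ := a * b' - a' * b with hΔ
  have hlin : ∀ u ∈ J, Δ * h u = (a * c' - a' * c) * u + (a * d' - a' * d) := fun u hu => by
    linear_combination a * h2 u hu - a' * h1 u hu + hΔ * h u
  -- Substituting `Δ h = p u + q` into either relation gives a quadratic identity with leading
  -- coefficient `a p`. If `p ≠ 0`, both `a` and `a'` vanish, and so does the determinant.
  have hq : ∀ {a b c d : ℝ}, (∀ u ∈ J, (a * u + b) * h u = c * u + d) →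
      ∀ {p q : ℝ}, (∀ u ∈ J, Δ * h u = p * u + q) → a * p = 0 := fun {a b c d} h1 {p q} hl => by
    refine (quadratic_eq_zero (b := a * q + b * p - Δ * c) (c := b * q - Δ * d) hJ hJ'.nonempty
      fun u hu => ?_).1
    linear_combination Δ * h1 u hu - (a * u + b) * hl u hu
  have e1 := hq h1 hlin
  have e2 := hq h2 hlin
  have hp : a * c' - a' * c = 0 := by
    by_contra hp
    have ha := (mul_eq_zero.1 e1).resolve_right hp
    have ha' := (mul_eq_zero.1 e2).resolve_right hp
    exact hdet (by rw [hΔ, ha, ha']; ring)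
  refine ⟨(a * d' - a' * d) / Δ, fun u hu => ?_⟩
  have := hlin u hu
  rw [hp] at this
  field_simp
  linear_combination this

variable {U : Set Pt} {v₀ v₂ : Pt} {l : ℝ} {P Q η₁ η₀ : Pt → ℝ}

/-- Differentiating the second equation along `v` and in `u` gives `(v η₁ · u + v η₀) g'' = 2 c u +
2 d`. If `η₁` has a nonzero derivative along `v₀` or `v₂`, this makes `g''` constant. If only `v₀
η₀` is nonzero somewhere, then `g'' = 0`. Otherwise the undifferentiated equation `(η₁ u + η₀) g' =
(η₁ - l) g` makes `g` an exponential or a power. -/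
theorem DetSystem.tabled_id (hU : IsOpen U) (hJ : IsOpen J) (hJ' : IsConnected J)
    (hg : ContDiffOn ℝ ∞ g J) (hg0 : ∃ u ∈ J, g u ≠ 0) (hη : ∃ p ∈ U, η₁ p ≠ 0 ∨ η₀ p ≠ 0)
    (S : DetSystem U J (fun u => u) g v₀ v₂ l P Q η₁ η₀) : Tabled J (fun u => u) g := by
  have hrel : ∀ p ∈ U, η₁ p = Q p ∧ η₀ p = P p := fun p hp => by
    have := affine_eq_zero (b := η₁ p - Q p) (c := η₀ p - P p) hJ hJ'.nonempty fun u hu => by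
      have := S.eq_f p hp u hu
      rw [deriv_id'', mul_one] at this
      linear_combination this
    exact ⟨sub_eq_zero.1 this.1, sub_eq_zero.1 this.2⟩
  have hcurl : ∀ p ∈ U, dirDeriv v₂ η₀ p = dirDeriv v₀ η₁ p := fun p hp => by
    rw [dirDeriv_congr hU (fun q hq => (hrel q hq).2) hp,
      dirDeriv_congr (v := v₀) hU (fun q hq => (hrel q hq).1) hp, S.curl p hp]
  obtain ⟨u₀, hu₀, hg0⟩ := hg0
  have tquad : (∃ a b c : ℝ, ∀ u ∈ J, g u = a * u ^ 2 + b * u + c) →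
      Tabled J (fun u => u) g := by
    rintro ⟨a, b, c, h⟩
    refine tabled_id_quadratic ?_ h
    by_contra! hcon
    exact hg0 (by rw [h u₀ hu₀, hcon.1, hcon.2.1, hcon.2.2]; ring)
  have hg1 := fun u (hu : u ∈ J) => hasDerivAt_of_smoothOn hJ hg hu
  have hg2 := fun u (hu : u ∈ J) => hasDerivAt_of_smoothOn hJ (smoothOn_deriv hJ hg) hu
  -- the equations for `g`, differentiated in a direction `v` and with respect to `u`
  have key : ∀ p ∈ U, ∀ v, ∀ u ∈ J,
      (dirDeriv v η₁ p * u + dirDeriv v η₀ p) * deriv (deriv g) u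
        = 2 * dirDeriv v (dirDeriv v₂ η₁) p * u + 2 * dirDeriv v (dirDeriv v₀ η₁) p := by
    intro p hp v u hu
    have hz : ∀ u ∈ J, _ := fun u hu => S.dirDeriv_eq_g hU hp v hu
    rw [dirDeriv_congr hU hcurl hp] at hz
    generalize dirDeriv v η₁ p = a at *
    generalize dirDeriv v η₀ p = b at *
    generalize dirDeriv v (dirDeriv v₂ η₁) p = c at *
    generalize dirDeriv v (dirDeriv v₀ η₁) p = d at *
    generalize dirDeriv v (dirDeriv v₀ η₀) p = e at *
    have i := hasDerivAt_id u
    have hd := ((((i.const_mul d).add_const e).add (i.mul ((i.const_mul c).add_const d))).add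
      ((hg1 u hu).mul_const a)).sub (((i.const_mul a).add_const b).mul (hg2 u hu))
    have := hasDerivAt_eq_zero hJ hz hu hd
    simp only [id] at this
    linear_combination -this
  by_cases hE : ∃ q ∈ U, ∃ v, (v = v₀ ∨ v = v₂) ∧ dirDeriv v η₁ q ≠ 0
  · refine tquad (Exists.elim ?_ fun k hk => exists_quadratic_of_deriv_deriv (k := k) hJ hJ' hg hk)
    obtain ⟨q, hq, v, hv, hE⟩ := hE
    by_contra hcon
    -- Two independent relations would make `g''` constant, so all pairs `(w η₁, w η₀)` are
    -- proportional to one of them.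
    have hdep : ∀ p ∈ U, ∀ w,
        dirDeriv w η₀ p = dirDeriv v η₀ q / dirDeriv v η₁ q * dirDeriv w η₁ p := by
      intro p hp w
      by_contra hne
      refine hcon (exists_const_of_two_relations hJ hJ' (fun h => hne ?_) (key q hq v) (key p hp w))
      field_simp
      linear_combination h
    generalize dirDeriv v η₀ q / dirDeriv v η₁ q = β at hdep
    have h01 : ∀ p ∈ U, dirDeriv v₀ η₁ p = β * dirDeriv v₂ η₁ p := fun p hp => by
      rw [← hcurl p hp, hdep p hp v₂]
    have hE2 : dirDeriv v₂ η₁ q ≠ 0 := by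
      rcases hv with rfl | rfl
      · rw [h01 q hq] at hE
        exact right_ne_zero_of_mul hE
      · exact hE
    have hk := key q hq v₂
    rw [hdep q hq, dirDeriv_congr hU h01 hq, dirDeriv_const_mul β
      (differentiableAt_of_smoothOn hU (smoothOn_dirDeriv hU S.smooth_η₁ v₂) hq)] at hk
    generalize dirDeriv v₂ (dirDeriv v₂ η₁) q = c at hk
    generalize dirDeriv v₂ η₁ q = a at hk hE2
    -- Proportionality and `v₀ η₁ = v₂ η₀` give both sides of the relation for `v₂` the factor `u +
    -- β`, so `g''` is constant after all.
    refine hcon ⟨2 * c / a, fun u hu => sub_eq_zero.1 ?_⟩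
    refine eq_zero_of_add_mul_eq_zero (ψ := fun u => deriv (deriv g) u - 2 * c / a) (b := β) hJ
      ((smoothOn_deriv hJ (smoothOn_deriv hJ hg)).continuousOn.sub continuousOn_const)
      (fun u hu => ?_) u hu
    have := hk u hu
    field_simp
    linear_combination this
  push Not at hE
  have z0 : ∀ p ∈ U, dirDeriv v₀ η₁ p = 0 := fun p hp => hE p hp v₀ (Or.inl rfl)
  have z2 : ∀ p ∈ U, dirDeriv v₂ η₁ p = 0 := fun p hp => hE p hp v₂ (Or.inr rfl)
  have z20 : ∀ p ∈ U, dirDeriv v₂ η₀ p = 0 := fun p hp => by rw [hcurl p hp, z0 p hp]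
  by_cases hz : ∃ q ∈ U, dirDeriv v₀ η₀ q ≠ 0
  · obtain ⟨q, hq, hz⟩ := hz
    have hd : ∀ u ∈ J, deriv (deriv g) u = 0 := fun u hu => by
      have := key q hq v₀ u hu
      rw [z0 q hq, dirDeriv_eq_zero hU z2 hq, dirDeriv_eq_zero hU z0 hq] at this
      simpa [hz] using this
    exact tquad (exists_quadratic_of_deriv_deriv hJ hJ' hg hd)
  push Not at hz
  obtain ⟨p, hp, hη⟩ := hη
  have heq : ∀ u ∈ J, (η₁ p * u + η₀ p) * deriv g u = (η₁ p - l) * g u := fun u hu => by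
    have := S.eq_g p hp u hu
    rw [z0 p hp, z2 p hp, z20 p hp, hz p hp] at this
    linear_combination -this
  generalize η₁ p = a at *
  generalize η₀ p = b at *
  by_cases ha : a = 0
  · subst ha
    have hb : b ≠ 0 := hη.resolve_left fun h => h rfl
    obtain ⟨K, hK⟩ := exists_exp_of_deriv (k := -l / b) hJ hJ' hg (fun u hu => by
      have := heq u hu
      field_simp
      linear_combination this)
    by_cases hk : -l / b = 0
    · rw [hk] at hK
      exact tquad ⟨0, 0, K, fun u hu => by rw [hK u hu]; simp⟩
    · exact tabled_id_exp (fun h => hg0 (by rw [hK u₀ hu₀, h, zero_mul])) hk hK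
  · obtain ⟨ε, K, hε, -, hK, hKn⟩ := exists_rpow_of_add_mul_deriv (b := b / a) (m := (a - l) / a)
      hJ hJ' hg (fun u hu => by
        have := heq u hu
        field_simp
        linear_combination this)
    have hK0 : K ≠ 0 := fun h => hg0 (by rw [hK u₀ hu₀, h, zero_mul])
    generalize (a - l) / a = m at *
    by_cases h0 : m = 0
    · subst h0
      exact tquad ⟨0, 0, K, fun u hu => by rw [hK u hu]; simp⟩
    by_cases h1 : m = 1
    · subst h1
      exact tquad ⟨0, K * ε, K * (ε * (b / a)), fun u hu => by
        rw [hK u hu, Real.rpow_one]; ring⟩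
    by_cases h2 : m = 2
    · subst h2
      exact tquad ⟨K * ε ^ 2, 2 * K * ε * (ε * (b / a)), K * (ε * (b / a)) ^ 2, fun u hu => by
        rw [hK u hu, Real.rpow_two]; ring⟩
    exact tabled_id_rpow hε.ne_zero h0 h1 h2 hK0 (hKn hK0) hK

end Identity

/-! ### Assembling the two parts of the theorem. -/

section Classification

variable {D : Set (Fin 3 → ℝ)} {J : Set ℝ} {f g : ℝ → ℝ}

theorem DetSystem.tabled_of_isNormalForm {U : Set Pt} {v₀ v₂ : Pt} {l : ℝ} {P Q η₁ η₀ : Pt → ℝ}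
    (hU : IsOpen U) (hJ : IsOpen J) (hJ' : IsConnected J) (hg : ContDiffOn ℝ ∞ g J)
    (hg0 : ∃ u ∈ J, g u ≠ 0) (hη : ∃ p ∈ U, η₁ p ≠ 0 ∨ η₀ p ≠ 0) (hf : IsNormalForm J f)
    (S : DetSystem U J f g v₀ v₂ l P Q η₁ η₀) : Tabled J f g := by
  rcases hf with rfl | ⟨rfl, hpos⟩ | ⟨m, h0, hm, hm', rfl⟩
  · exact S.tabled_exp hU hJ hJ' hg hg0 hη
  · exact S.tabled_log hU hJ hJ' hg hg0 hη hpos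
  · by_cases h1 : m = 1
    · subst h1
      have e : (fun u : ℝ => u ^ (1 : ℝ)) = fun u => u := funext fun u => Real.rpow_one u
      rw [e] at S ⊢
      exact S.tabled_id hU hJ hJ' hg hg0 hη
    · exact S.tabled_rpow hU hJ hJ' hg hg0 hη h0 h1 hm (hm'.resolve_left h1)

theorem mem_spanOn_kerFields {V : VField} {c₀ c₁ c₂ : ℝ}
    (h : ∀ p ∈ dom D J, V p = ![c₀, c₁, c₂, 0]) :
    (dom D J).domRestrict V ∈ spanOn D J kerFields := by
  have hmem : ∀ i : Fin kerFields.length, family D J kerFields i ∈ spanOn D J kerFields :=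
    fun i => Submodule.subset_span ⟨i, rfl⟩
  have e : (dom D J).domRestrict V = c₀ • family D J kerFields ⟨0, by simp [kerFields]⟩
      + c₁ • family D J kerFields ⟨1, by simp [kerFields]⟩
      + c₂ • family D J kerFields ⟨2, by simp [kerFields]⟩ := by
    funext p i
    have := congrFun (h p p.2) i
    fin_cases i <;> simpa [family, kerFields, vf, Set.domRestrict] using this
  rw [e]
  exact add_mem (add_mem (Submodule.smul_mem _ _ (hmem _)) (Submodule.smul_mem _ _ (hmem _)))
    (Submodule.smul_mem _ _ (hmem _))

/-- For `g ≠ 0` a symmetry outside the kernel has `η ≠ 0` somewhere: with `η = 0` the first equation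
gives `χ_t = 0` and `χ_y = l`, the second one `l g = 0`, and the field lies in the kernel. -/
theorem tabled_of_ssubset (hD : IsOpen D) (hD' : IsConnected D) (hJ : IsOpen J)
    (hJ' : IsConnected J) (hf : ContDiffOn ℝ ∞ f J) (hg : ContDiffOn ℝ ∞ g J)
    (hc : NonconstOn f J)
    (h : (spanOn D J kerFields : Set (dom D J → Fin 4 → ℝ)) ⊂ maxAlgebra D J f g) :
    Tabled J f g := by
  by_cases hg0 : ∃ u ∈ J, g u ≠ 0
  swap
  · push Not at hg0
    exact tabled_zero hf hc hg0
  have hU := isOpen_dom hD hJ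
  have hU' := isConnected_dom hD' hJ'
  obtain ⟨W, ⟨V, hV, rfl⟩, hVs⟩ := Set.exists_of_ssubset h
  obtain ⟨l, c₀, c₁, χ, η₁, η₀, R, hVp⟩ := hV.exists_reducedSymmetry hD hD' hJ hJ' hf hc
  by_cases hη : ∃ p ∈ dom D J, η₁ p ≠ 0 ∨ η₀ p ≠ 0
  · obtain ⟨p, hp, hηp⟩ := hη
    have S := R.detSystem hU
    obtain ⟨s, σ, α, β, F, hs, hα, hF, hFf⟩ := exists_normalForm hJ hJ' hf hc hηp (R.eq_f p hp)
    refine Tabled.of_affine hs hα hFf ((S.affine hU hJ hs hα hFf).tabled_of_isNormalForm hU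
      (isOpen_affImage hs hJ) (isConnected_affImage hJ')
      (contDiffOn_const.mul (smoothOn_comp_affine hs hg)) ?_ ⟨p, hp, ?_⟩ hF)
    · obtain ⟨u, hu, hgu⟩ := hg0
      refine ⟨s * u + σ, ⟨u, hu, rfl⟩, mul_ne_zero hs ?_⟩
      rwa [show (s * u + σ - σ) / s = u by field_simp; ring]
    · by_cases h1 : η₁ p = 0
      · right
        rw [h1, mul_zero, sub_zero]
        exact mul_ne_zero hs (hηp.resolve_left fun h => h h1)
      · exact Or.inl h1
  · exfalso
    push Not at hη
    obtain ⟨u, hu, v, hv, huv⟩ := hc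
    have hχ : ∀ p ∈ dom D J, pd 0 χ p = 0 ∧ pd 2 χ p = l := fun p hp => by
      have e1 := R.eq_f p hp u hu
      have e2 := R.eq_f p hp v hv
      rw [(hη p hp).1, (hη p hp).2] at e1 e2
      have e3 : (f u - f v) * (pd 2 χ p - l) = 0 := by linear_combination e2 - e1
      have e4 := (mul_eq_zero.1 e3).resolve_left (sub_ne_zero.2 huv)
      exact ⟨by rw [e4] at e1; linarith, by linarith⟩
    have hl : l = 0 := by
      obtain ⟨p, hp⟩ := hU'.nonempty
      obtain ⟨u, hu, hgu⟩ := hg0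
      have e := R.eq_g p hp u hu
      simp only [pd_eq_zero hU (fun q hq => (hη q hq).1) hp,
        pd_eq_zero hU (fun q hq => (hη q hq).2) hp, (hη p hp).1, (hη p hp).2] at e
      have : g u * l = 0 := by linear_combination -e
      exact (mul_eq_zero.1 this).resolve_left hgu
    obtain ⟨c₂, hc₂⟩ := exists_const_of_pd_eq_zero hU hU'
      (fun p hp => (differentiableAt_of_smoothOn hU R.smooth_χ hp).differentiableWithinAt)
      (fun i q hq => by
        fin_cases i
        · exact (hχ q hq).1
        · exact R.χ_x q hq
        · exact (hχ q hq).2.trans hl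
        · exact R.χ_u q hq)
    refine hVs (mem_spanOn_kerFields (c₀ := c₀) (c₁ := c₁) (c₂ := c₂) fun p hp => ?_)
    rw [hVp p hp, (hη p hp).1, (hη p hp).2, hc₂ p hp, hl]
    simp

theorem TableRow.completesBasis (hD : IsOpen D) (hD' : IsConnected D) (hJ : IsOpen J)
    (hJ' : IsConnected J) {n : ℕ} {gens : List VField} (h : TableRow J n f g gens) :
    CompletesBasis D J f g gens := by
  cases h with
  | row1 f₁ hs hc hgen =>
    refine completesBasis_generic_zero hD hD' hJ hJ' hs hc fun a b c d h => ?_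
    -- A nontrivial relation for `f` would give a reduction to a special function, which this row
    -- excludes.
    by_contra hab
    have hab' : a ≠ 0 ∨ b ≠ 0 := by tauto
    obtain ⟨s, σ, α, β, F, hs', hα, hF, hFf⟩ := exists_normalForm hJ hJ' hs hc hab' h
    obtain ⟨T, hT⟩ := exists_reduces (g := fun _ => 0) (G := fun _ => 0) one_pos hs' hα hFf
      (fun u _ => (mul_zero _).symm)
    exact hgen ⟨T, _, F, hF.isSpecial, hT⟩
  | row2 ε m hε h0 h1 => exact completesBasis_exp_expMul hD hD' hJ hJ' hε h0 h1
  | row3 ε₁ ε₂ hε₁ hε₂ => exact completesBasis_exp_exp_add hD hD' hJ hJ' hε₁ hε₂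
  | row4 ε hε => exact completesBasis_exp_const hD hD' hJ hJ' hε
  | row5 ε hε => exact completesBasis_exp_exp hD hD' hJ hJ' hε
  | row6 => exact completesBasis_exp_zero hD hD' hJ hJ'
  | row7 ε m hε h1 hpos => exact completesBasis_log_rpow hD hD' hJ hJ' hpos hε h1
  | row8 ε hε hpos => exact completesBasis_log_mul_log hD hD' hJ hJ' hpos hε
  | row9 ε hε hpos => exact completesBasis_log_linear hD hD' hJ hJ' hpos
  | row10 hpos => exact completesBasis_log_zero hD hD' hJ hJ' hpos
  | row11 ε m n hε h0 h1 hn hJm hJn =>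
    exact completesBasis_rpow_rpow hD hD' hJ hJ' hε h0 h1 hn hJm hJn
  | row12 ε₁ ε₂ m hε₁ hε₂ h0 h1 hJm =>
    exact completesBasis_rpow_add_linear hD hD' hJ hJ' hε₁ hε₂ h0 h1 hJm
  | row13 ε m hε h0 h1 hJm => exact completesBasis_rpow_rpow_succ hD hD' hJ hJ' hε h0 h1 hJm
  | row14 m h0 h1 hJm => exact completesBasis_rpow_zero hD hD' hJ hJ' h0 h1 hJm
  | row15 ε hε => exact completesBasis_id_exp hD hD' hJ hJ' hε
  | row16 ε m hε h0 h1 h2 hJm => exact completesBasis_id_rpow hD hD' hJ hJ' hε h0 h1 h2 hJm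
  | row17 => exact completesBasis_id_sq_add_one hD hD' hJ hJ'
  | row18 => exact completesBasis_id_sq_sub_one hD hD' hJ hJ'
  | row19 ε hε => exact completesBasis_id_linear hD hD' hJ hJ' hε
  | row20 => exact completesBasis_id_sq hD hD' hJ hJ'
  | row21 ε hε => exact completesBasis_id_const hD hD' hJ hJ' ε
  | row22 => exact completesBasis_id_zero hD hD' hJ hJ'

end Classification

end Kolmogorov

end

theorem theorem5 :
    -- every equation with a Lie symmetry algebra larger than `⟨∂_t, ∂_x, ∂_y⟩` reduces to the table
    (∀ (D : Set (Fin 3 → ℝ)) (J : Set ℝ) (f₁ f₂ : ℝ → ℝ),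
      IsOpen D → IsConnected D → IsOpen J → IsConnected J →
      ContDiffOn ℝ ∞ f₁ J → ContDiffOn ℝ ∞ f₂ J → Kolmogorov.NonconstOn f₁ J →
      (Kolmogorov.spanOn D J Kolmogorov.kerFields : Set (Kolmogorov.dom D J → Fin 4 → ℝ)) ⊂
        Kolmogorov.maxAlgebra D J f₁ f₂ →
      ∃ (T : Kolmogorov.EquivTransf) (J' : Set ℝ) (n : ℕ) (F₁ F₂ : ℝ → ℝ)
        (gens : List Kolmogorov.VField),
        T.Reduces J f₁ f₂ J' F₁ F₂ ∧ Kolmogorov.TableRow J' n F₁ F₂ gens) ∧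
    -- for every equation of the table, `∂_t, ∂_x, ∂_y` and the listed generators form a basis of
    -- the maximal Lie invariance algebra
    (∀ (D : Set (Fin 3 → ℝ)) (J : Set ℝ) (n : ℕ) (F₁ F₂ : ℝ → ℝ)
      (gens : List Kolmogorov.VField),
      IsOpen D → IsConnected D → IsOpen J → IsConnected J →
      Kolmogorov.TableRow J n F₁ F₂ gens →
      LinearIndependent ℝ (Kolmogorov.family D J (Kolmogorov.kerFields ++ gens)) ∧
      Kolmogorov.maxAlgebra D J F₁ F₂ =
        (Kolmogorov.spanOn D J (Kolmogorov.kerFields ++ gens) :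
          Set (Kolmogorov.dom D J → Fin 4 → ℝ))) := by
  refine ⟨fun D J f₁ f₂ hD hD' hJ hJ' hf₁ hf₂ hc h => ?_,
    fun D J n F₁ F₂ gens hD hD' hJ hJ' h => ?_⟩
  · exact Kolmogorov.tabled_of_ssubset hD hD' hJ hJ' hf₁ hf₂ hc h
  · exact h.completesBasis hD hD' hJ hJ'
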